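/- **Setting.** Let $(G,G')$ be an irreducible type I reductive dual pair in stable range with $G$ the smaller member, that is, one of (1) $(\mathrm{Sp}(2n,\mathbb R),\mathrm O(p,q))$ with $2n\le p,q$; (2) $(\mathrm O(p,q),\mathrm{Sp}(2n,\mathbb R))$ with $p+q\le n$; (3) $(\mathrm U(n_1,n_2),\mathrm U(p,q))$ with $n_1+n_2\le p,q$; (4) $(\mathrm O^*(2n),\mathrm{Sp}(p,q))$ with $n\le p,q$; (5) $(\mathrm{Sp}(p,q),\mathrm O^*(2n))$ with $2(p+q)\le n$; (6) $(\mathrm{Sp}(2n,\mathbb C),\mathrm O(p,\mathbb C))$ with $4n\le p$; (7) $(\mathrm O(p,\mathbb C),\mathrm{Sp}(2n,\mathbb C))$ with $p\le n$. Let $K_{\mathbb C},K'_{\mathbb C}$ be the complexified maximal compact subgroups, $\mathfrak g=\mathfrak k\oplus\mathfrak p$ and $\mathfrak g'=\mathfrak k'\oplus\mathfrak p'$ the complexified Cartan decompositions, $W$ the complex space on whose polynomial functions the oscillator representation is realized, and $\phi:W\to\mathfrak p^*$, $\phi':W\to\mathfrak p'^*$ the moment maps. Explicitly, with $M_{a,b}$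 the complex $a\times b$ matrices and $J_{2m}=\begin{pmatrix}0&1\\-1&0\end{pmatrix}$ (in (2), (5), (7) the roles of the two members are exchanged): - $\mathrm{Sp}(2n,\mathbb R)$, $\mathrm O(p,q)$: $W=M_{p,n}\times M_{q,n}\ni(A,B)$; $\mathrm{GL}_n$ acts by $(Ak^{-1},Bk^T)$ and $\mathrm O_p\times\mathrm O_q$ by $(k_1A,k_2B)$; the moment maps are $(A^TA,B^TB)\in\mathrm{Sym}_n\times\mathrm{Sym}_n$ and $AB^T\in M_{p,q}$. - $\mathrm O^*(2n)$, $\mathrm{Sp}(p,q)$: $W=M_{2p,n}\times M_{2q,n}$; $\mathrm{GL}_n$ and $\mathrm{Sp}_{2p}\times\mathrm{Sp}_{2q}$ act by the same formulas; the moment maps are $(A^TJ_{2p}A,B^TJ_{2q}B)\in\mathrm{Alt}_n\times\mathrm{Alt}_n$ and $AB^T\in M_{2p,2q}$. - $\mathrm U(n_1,n_2)$, $\mathrm U(p,q)$: $W=M_{p,n_1}\times M_{p,n_2}\times M_{q,n_1}\times M_{q,n_2}\ni(A,B,C,D)$; $\mathrm{GL}_{n_1}\times\mathrm{GL}_{n_2}$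 acts by $(Ak_1^{-1},Bk_2^T,Ck_1^T,Dk_2^{-1})$ and $\mathrm{GL}_p\times\mathrm{GL}_q$ by $(k_1A,k_1^{-T}B,k_2^{-T}C,k_2D)$; the moment maps are $(A^TB,D^TC)\in M_{n_1,n_2}\times M_{n_2,n_1}$ and $(AC^T,DB^T)\in M_{p,q}\times M_{q,p}$. - $\mathrm{Sp}(2n,\mathbb C)$, $\mathrm O(p,\mathbb C)$: $W=M_{p,2n}\ni A$; $\mathrm{Sp}_{2n}$ acts by $Ak^{-1}$ and $\mathrm O_p$ by $kA$; the moment maps are $A^TA\in\mathrm{Sym}_{2n}$ and $AJ_{2n}A^T\in\mathrm{Alt}_p$. The groups $K_{\mathbb C}$, $K'_{\mathbb C}$ act on $\mathfrak p^*$, $\mathfrak p'^*$ by the coadjoint action, which makes $\phi$, $\phi'$ equivariant. For $x\in\mathfrak p^*$ let $K_x$ be its stabilizer in $K_{\mathbb C}$, with Lie algebra $\mathfrak k_x$, and let $\widetilde K_x=\{(k,z)\in K_x\times\mathbb C^\times: z^2=\det(k|_W)\}$ be its inverse image in the metaplectic cover; $\varsigma(k,z)=z^{-1}$ is the lowest type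 of the Fock module. Put $\gamma_x(k)=\det\bigl(\mathrm{Ad}(k)|_{(\mathfrak k/\mathfrak k_x)^*}\bigr)$ for $k\in K_x$. An *orbit datum* for $\widetilde G$ is a triple $(\mathcal O,x,[\chi_x])$, where $\mathcal O\subset\mathfrak p^*$ is a nilpotent $K_{\mathbb C}$-orbit (i.e. $0\in\overline{\mathcal O}$), $x\in\mathcal O$, and $[\chi_x]$ is the class, in the Grothendieck group, of a finite-dimensional rational representation $\chi_x$ of $\widetilde K_x$ that is genuine ($(1,-1)$ acts by $-1$). It is *admissible* if $\chi_x$ is admissible, that is, $$\chi_x(\exp X)=\gamma_x(\exp(X/2))\cdot\mathrm{Id}\qquad\text{for all }X\in\mathfrak k_x ,$$ where $\exp X$ on the left is taken in $\widetilde K_x$. The same definitions are made for $\widetilde G'$. The *theta lift* of $(\mathcal O,x,[\chi_x])$ is $(\mathcal O',x',[\chi_{x'}])$, where $\mathcal O'=\theta(\mathcal O)$ is the $K'_{\mathbb C}$-orbit in $\mathfrak p'^*$ with $\overline{\mathcal O'}=\phi'(\phi^{-1}(\overline{\mathcal O}))$, where $w\in W$ is a point with $\phi(w)=x$ and $x'=\phi'(w)\in\mathcal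 O'$, and $$\chi_{x'}=\varsigma|_{\widetilde K'_{x'}}\otimes\bigl((\varsigma|_{\widetilde K_x}\otimes\chi_x)\circ\alpha\bigr),$$ with $\alpha:K'_{x'}\to K_x$ the homomorphism determined by $k'\cdot w=\alpha(k')^{-1}\cdot w$ (the representation $\varsigma\otimes\chi_x$ descends from $\widetilde K_x$ to $K_x$ because $\chi_x$ is genuine). **Proposition G.** Let $(\mathcal O,x,[\chi_x])$ be an admissible orbit datum for $\widetilde G$, with $\chi_x$ admissible. Let $\mathcal O'=\theta(\mathcal O)$, and let $w\in W$ with $\phi(w)=x$ and $x'=\phi'(w)\in\mathcal O'$. Then the representation $\chi_{x'}$ above is well defined, and the theta lift $(\mathcal O',x',[\chi_{x'}])$ is an admissible orbit datum for $\widetilde G'$. -/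

import Mathlib

open scoped Matrix

/-- The Zariski closure of a subset `S` of a complex vector space `E`: the common zeros of all
polynomial functions on `E` (the algebra generated by the linear functionals) vanishing on `S`. -/
def zariskiClosure {E : Type} [AddCommGroup E] [Module ℂ E] (S : Set E) : Set E :=
  {y | ∀ f ∈ Algebra.adjoin ℂ (Set.range fun (l : Module.Dual ℂ E) (e : E) => l e),
    (∀ s ∈ S, f s = 0) → f y = 0}

/-- Conjugation by a unit commutes with the exponential in a Hausdorff topological algebra. -/
theorem exp_conj_unit {A : Type} [Ring A] [Algebra ℂ A] [TopologicalSpace A]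
    [IsTopologicalRing A] [T2Space A] (u : Aˣ) (X : A) :
    NormedSpace.exp ((u : A) * X * (↑u⁻¹ : A)) =
      (u : A) * NormedSpace.exp X * (↑u⁻¹ : A) := by
  have hpow : ∀ k : ℕ, ((u : A) * X * (↑u⁻¹ : A)) ^ k = (u : A) * X ^ k * (↑u⁻¹ : A) := by
    intro k
    exact Units.conj_pow u X k
  let e : A ≃L[ℂ] A :=
    { toFun := fun Y => (u : A) * Y * (↑u⁻¹ : A)
      invFun := fun Y => (↑u⁻¹ : A) * Y * (u : A)
      map_add' := by intro a b; simp [mul_add, add_mul]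
      map_smul' := by intro c a; simp
      left_inv := by intro Y; simp [mul_assoc]
      right_inv := by intro Y; simp [mul_assoc]
      continuous_toFun := by fun_prop
      continuous_invFun := by fun_prop }
  have h := e.map_tsum (f := fun k : ℕ => ((k.factorial : ℂ)⁻¹) • X ^ k)
    (L := SummationFilter.unconditional ℕ)
  rw [NormedSpace.exp_eq_tsum ℂ]
  simp only [hpow]
  refine Eq.trans ?_ h.symm
  refine tsum_congr fun k => ?_
  simp [e]

/-- The data attached to one member `G` of a reductive dual pair whose oscillator representation
is realized on polynomials on the complex vector space `W`:
* `K` is the complexification `K_ℂ` of a maximal compact subgroup of `G`, a group of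
  units of a matrix algebra `A`;
* `onW` is its linear action on `W`;
* `pStar` is the space `𝔭^*`, a subspace of a space `E` of matrices;
* `onP` is the (coadjoint) action of `K_ℂ`, given on all of `E`;
* `φ : W → 𝔭^*` is the moment map.
The members that are used are constructed explicitly below. -/
structure Member (W : Type) [AddCommGroup W] [Module ℂ W] where
  A : Type
  [ringA : Ring A]
  [algA : Algebra ℂ A]
  [topA : TopologicalSpace A]
  [topRingA : IsTopologicalRing A]
  [t2A : T2Space A]
  K : Subgroup Aˣ
  onW : K →* (W →ₗ[ℂ] W)
  E : Type
  [addE : AddCommGroup E]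
  [modE : Module ℂ E]
  pStar : Submodule ℂ E
  onP : K →* (E →ₗ[ℂ] E)
  φ : W → E

namespace Member

attribute [instance] ringA algA topA topRingA t2A addE modE

variable {W : Type} [AddCommGroup W] [Module ℂ W] (M : Member W)

/-- The underlying matrix of an element of `K_ℂ`. -/
def mat (k : M.K) : M.A := ((k : M.Aˣ) : M.A)

/-- The `K_ℂ`-orbit of `x`. -/
def orbit (x : M.E) : Set M.E := {y | ∃ k : M.K, M.onP k x = y}

/-- `O` is a nilpotent `K_ℂ`-orbit in `𝔭^*`. -/
def IsNilpotentOrbit (O : Set M.E) : Prop :=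
  (∃ x ∈ M.pStar, O = M.orbit x) ∧ (0 : M.E) ∈ zariskiClosure O

/-- The stabilizer `K_x` of `x` in `K_ℂ`. -/
def stab (x : M.E) : Subgroup M.K where
  carrier := {k | M.onP k x = x}
  one_mem' := by simp
  mul_mem' := by
    intro a b ha hb
    simp only [Set.mem_ofPred_eq] at *
    rw [map_mul, Module.End.mul_apply, hb, ha]
  inv_mem' := by
    intro a ha
    simp only [Set.mem_ofPred_eq] at *
    have h : M.onP (a⁻¹ * a) x = x := by simp
    rw [map_mul, Module.End.mul_apply, ha] at h
    exact h

/-- The inverse image `K̃_x` of `K_x` in the metaplectic cover. The inverse image of the unitary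
group `U` of `W` in the metaplectic group is the double cover `{(u, z) | z ^ 2 = det u}` of `U`,
because `ς ^ (-2) = det` for the minimal type `ς` of the Fock module; in these
coordinates `ς (u, z) = z⁻¹`. -/
def coverStab (x : M.E) : Subgroup (M.K × ℂˣ) where
  carrier := {g | g.1 ∈ M.stab x ∧ (g.2 : ℂ) ^ 2 = LinearMap.det (M.onW g.1)}
  one_mem' := by simp
  mul_mem' := by
    rintro a b ⟨ha, ha'⟩ ⟨hb, hb'⟩
    refine ⟨Subgroup.mul_mem _ ha hb, ?_⟩
    simp only [Prod.snd_mul, Prod.fst_mul, Units.val_mul, map_mul, mul_pow, ha', hb']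
  inv_mem' := by
    rintro a ⟨ha, ha'⟩
    refine ⟨Subgroup.inv_mem _ ha, ?_⟩
    have h : LinearMap.det (M.onW a.1⁻¹) * LinearMap.det (M.onW a.1) = 1 := by
      rw [← map_mul, ← map_mul]; simp
    rw [← ha'] at h
    simp only [Prod.snd_inv, Prod.fst_inv, Units.val_inv_eq_inv_val, inv_pow]
    exact (eq_inv_of_mul_eq_one_left h).symm

variable {M}

/-- The element of `K_x` below an element of `K̃_x`. -/
def base {x : M.E} (g : M.coverStab x) : M.stab x := ⟨g.1.1, g.2.1⟩

/-- The minimal type `ς` of the Fock module, restricted to `K̃_x`. -/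
noncomputable def varsigma {x : M.E} (g : M.coverStab x) : ℂ := (g.1.2 : ℂ)⁻¹

variable (M)

/-- The matrices `X` such that `exp (t X) ∈ H` for all `t`. If `H` is a closed complex subgroup,
as all groups below are, then this is the Lie algebra of `H`. -/
def lieSet (H : Subgroup M.K) : Set M.A :=
  {X | ∀ t : ℂ, ∃ k ∈ H, M.mat k = NormedSpace.exp (t • X)}

/-- The Lie algebra of `H` as a subspace (the span only provides the bundled subspace). -/
def lieAlg (H : Subgroup M.K) : Submodule ℂ M.A := Submodule.span ℂ (M.lieSet H)

/-- `Ad k : X ↦ k X k⁻¹`. -/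
def Ad (k : M.K) : M.A →ₗ[ℂ] M.A :=
  LinearMap.mulLeft ℂ (M.mat k) ∘ₗ LinearMap.mulRight ℂ (M.mat k⁻¹)

theorem Ad_mem (H : Subgroup M.K) {k : M.K} (hk : k ∈ H) :
    ∀ X ∈ M.lieAlg H, M.Ad k X ∈ M.lieAlg H := by
  intro X hX
  have hle : M.lieAlg H ≤ (M.lieAlg H).comap (M.Ad k) := by
    refine Submodule.span_le.2 ?_
    intro Y hY
    refine Submodule.subset_span ?_
    intro t
    obtain ⟨g, hg, hge⟩ := hY t
    refine ⟨k * g * k⁻¹, H.mul_mem (H.mul_mem hk hg) (H.inv_mem hk), ?_⟩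
    have e1 : t • M.Ad k Y
        = ((k : M.Aˣ) : M.A) * (t • Y) * (↑((k : M.Aˣ)⁻¹) : M.A) := by
      simp [Ad, mat, mul_assoc]
    rw [e1, exp_conj_unit, ← hge]
    simp [mat]
  exact hle hX

/-- The tangent space `T_x O = 𝔨 / 𝔨_x`. -/
abbrev tangent (x : M.E) : Type :=
  M.lieAlg ⊤ ⧸ (M.lieAlg (M.stab x)).submoduleOf (M.lieAlg ⊤)

/-- The action of `K_x` on `𝔨 / 𝔨_x` induced by `Ad`. -/
def tangentAct (x : M.E) (k : M.stab x) : M.tangent x →ₗ[ℂ] M.tangent x :=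
  Submodule.mapQ _ _ ((M.Ad k).restrict (M.Ad_mem ⊤ (Subgroup.mem_top _)))
    (fun _ hX => M.Ad_mem (M.stab x) k.2 _ hX)

/-- The character `γ_x (k) = det (Ad k | (𝔨 / 𝔨_x)^*)` of `K_x`; `k` acts on the dual space by the
transpose of `Ad k⁻¹`. -/
noncomputable def gamma (x : M.E) (k : M.stab x) : ℂ :=
  LinearMap.det (M.tangentAct x k⁻¹).dualMap

variable {M}

/-- `g = exp X` in the covering group `K̃_x`: the path `t ↦ exp (t X)` in `K_x` lifts to a
continuous path in `K̃_x` that starts at the identity and ends at `g`. -/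
def IsCoverExp {x : M.E} (X : M.A) (g : M.coverStab x) : Prop :=
  ∃ c : ℝ → M.coverStab x,
    (∀ t, M.mat (base (c t)) = NormedSpace.exp ((t : ℂ) • X)) ∧
    Continuous (fun t => ((c t).1.2 : ℂ)) ∧ c 0 = 1 ∧ c 1 = g

section

variable {V : Type*} [AddCommGroup V] [Module ℂ V]

/-- The regular functions on the linear algebraic group `K̃_x`: the algebra generated by the
matrix coordinates of `k` and `k⁻¹` and by `z` and `z⁻¹`. -/
def regularFunctions (x : M.E) : Subalgebra ℂ (M.coverStab x → ℂ) :=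
  Algebra.adjoin ℂ
    ({f | ∃ l : Module.Dual ℂ M.A, f = fun g => l (M.mat (base g))} ∪
     {f | ∃ l : Module.Dual ℂ M.A, f = fun g => l (M.mat ((base g)⁻¹ : M.stab x))} ∪
     {fun g => ((g.1.2 : ℂˣ) : ℂ), fun g => ((g.1.2⁻¹ : ℂˣ) : ℂ)})

/-- `χ` is a rational (that is, algebraic) representation of `K̃_x`. -/
def IsRational {x : M.E} (χ : Representation ℂ (M.coverStab x) V) : Prop :=
  ∀ (v : V) (l : Module.Dual ℂ V), (fun g => l (χ g v)) ∈ regularFunctions x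

/-- `χ` is genuine: the nontrivial element of the kernel of `K̃_x → K_x` acts by `-1`. -/
def IsGenuine {x : M.E} (χ : Representation ℂ (M.coverStab x) V) : Prop :=
  ∀ g : M.coverStab x, g.1 = (1, -1) → χ g = -1

/-- `χ` is admissible: `χ (exp X) = γ_x (exp (X / 2)) • Id` for all `X ∈ 𝔨_x`. -/
def IsAdmissible {x : M.E} (χ : Representation ℂ (M.coverStab x) V) : Prop :=
  ∀ X ∈ M.lieSet (M.stab x), ∀ g : M.coverStab x, IsCoverExp X g →
    ∀ k : M.stab x, M.mat k = NormedSpace.exp ((1 / 2 : ℂ) • X) →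
      χ g = M.gamma x k • (1 : V →ₗ[ℂ] V)

/-- `(O, x, χ)` is an orbit datum. -/
structure IsOrbitDatum (O : Set M.E) (x : M.E)
    (χ : Representation ℂ (M.coverStab x) V) : Prop where
  nilpotent : M.IsNilpotentOrbit O
  mem : x ∈ O
  finite : FiniteDimensional ℂ V
  rational : IsRational χ
  genuine : IsGenuine χ

/-- `(O, x, [χ])` is an admissible orbit datum. -/
structure IsAdmissibleOrbitDatum (O : Set M.E) (x : M.E)
    (χ : Representation ℂ (M.coverStab x) V) : Prop extends IsOrbitDatum O x χ where
  admissible : IsAdmissible χ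

variable {M' : Member W}

/-- `O' = θ(O)`: `O'` is a `K'_ℂ`-orbit in `𝔭'^*` whose closure is `φ' (φ⁻¹ (closure of O))`. -/
def IsThetaLiftOrbit (O : Set M.E) (O' : Set M'.E) : Prop :=
  (∃ x' ∈ M'.pStar, O' = M'.orbit x') ∧
    zariskiClosure O' = M'.φ '' (M.φ ⁻¹' zariskiClosure O)

/-- `(O', x', χ')` is the theta lift of `(O, x, χ)`, formed with the point `w` of `W`:
`O' = θ(O)`, `φ w = x ∈ O`, `φ' w = x' ∈ O'`, and `χ' = ς ⊗ (ς ⊗ χ) ∘ α`, where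
`α : K'_{x'} → K_x` is the homomorphism with `k' w = α(k')⁻¹ w`. The representation `ς ⊗ χ` of
`K̃_x` is evaluated at `α(k') ∈ K_x` by means of any element of `K̃_x` above `α(k')`. -/
def IsThetaLift (w : W)
    (O : Set M.E) (x : M.E) (χ : Representation ℂ (M.coverStab x) V)
    (O' : Set M'.E) (x' : M'.E) (χ' : Representation ℂ (M'.coverStab x') V) : Prop :=
  IsThetaLiftOrbit O O' ∧ x ∈ O ∧ x' ∈ O' ∧ M.φ w = x ∧ M'.φ w = x' ∧
    ∃ α : M'.stab x' →* M.stab x,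
      (∀ k' : M'.stab x', M'.onW k' w = M.onW ((α k')⁻¹ : M.stab x) w) ∧
      ∀ (g' : M'.coverStab x') (g : M.coverStab x), base g = α (base g') →
        χ' g' = varsigma g' • (varsigma g • χ g)

end

end Member

/-! ### The members of the irreducible type I dual pairs -/

/-- The space of symmetric `n × n` matrices. -/
def symMatrices (n : Type) : Submodule ℂ (Matrix n n ℂ) where
  carrier := {S | Sᵀ = S}
  zero_mem' := by simp
  add_mem' := by intro a b ha hb; simp_all
  smul_mem' := by intro c a ha; simp_all

/-- The space of alternating `n × n` matrices. -/
def altMatrices (n : Type) : Submodule ℂ (Matrix n n ℂ) where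
  carrier := {S | Sᵀ = -S}
  zero_mem' := by simp
  add_mem' := by intro a b ha hb; simp_all; abel
  smul_mem' := by intro c a ha; simp_all

/-- The matrix `J_{2n} = (0, 1; -1, 0)`. -/
def Jmat (n : ℕ) : Matrix (Fin n ⊕ Fin n) (Fin n ⊕ Fin n) ℂ := Matrix.fromBlocks 0 1 (-1) 0

/-- The group of the invertible matrices `g` with `gᵀ F g = F`. -/
def isometries {n : Type} [Fintype n] [DecidableEq n] (F : Matrix n n ℂ) :
    Subgroup (Matrix n n ℂ)ˣ where
  carrier := {g | (g : Matrix n n ℂ)ᵀ * F * (g : Matrix n n ℂ) = F}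
  one_mem' := by simp
  mul_mem' := by
    intro a b ha hb
    simp only [Set.mem_ofPred_eq, Units.val_mul, Matrix.transpose_mul] at *
    calc _ = (b : Matrix n n ℂ)ᵀ * ((a : Matrix n n ℂ)ᵀ * F * (a : Matrix n n ℂ))
          * (b : Matrix n n ℂ) := by simp only [Matrix.mul_assoc]
      _ = F := by rw [ha, hb]
  inv_mem' := by
    intro a ha
    simp only [Set.mem_ofPred_eq] at *
    have h1 : (a : Matrix n n ℂ) * (↑a⁻¹ : Matrix n n ℂ) = 1 := by simp
    have h2 : (↑a⁻¹ : Matrix n n ℂ)ᵀ * (a : Matrix n n ℂ)ᵀ = 1 := by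
      rw [← Matrix.transpose_mul, h1, Matrix.transpose_one]
    calc _ = (↑a⁻¹ : Matrix n n ℂ)ᵀ * ((a : Matrix n n ℂ)ᵀ * F * (a : Matrix n n ℂ))
          * (↑a⁻¹ : Matrix n n ℂ) := by rw [ha]
      _ = ((↑a⁻¹ : Matrix n n ℂ)ᵀ * (a : Matrix n n ℂ)ᵀ) * F
          * ((a : Matrix n n ℂ) * (↑a⁻¹ : Matrix n n ℂ)) := by simp only [Matrix.mul_assoc]
      _ = F := by rw [h1, h2]; simp

/-- The pairs of isometries of two bilinear forms, inside a product of matrix algebras. -/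
def isometries₂ {m n : Type} [Fintype m] [DecidableEq m] [Fintype n] [DecidableEq n]
    (F : Matrix m m ℂ) (F' : Matrix n n ℂ) : Subgroup (Matrix m m ℂ × Matrix n n ℂ)ˣ :=
  (isometries F).comap (Units.map (MonoidHom.fst (Matrix m m ℂ) (Matrix n n ℂ))) ⊓
    (isometries F').comap (Units.map (MonoidHom.snd (Matrix m m ℂ) (Matrix n n ℂ)))

section Pairs

/-- Members with `K_ℂ = GL_n`, acting on `W = M_{a,n} × M_{b,n}` by
`(A, B) ↦ (A k⁻¹, B kᵀ)`; the moment map is `(A, B) ↦ (Aᵀ F A, Bᵀ F' B)`, and `k` acts on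
`𝔭^*` by `(S, T) ↦ (k⁻ᵀ S k⁻¹, k T kᵀ)`. -/
noncomputable def glMember (n a b : Type) [Fintype n] [DecidableEq n] [Fintype a] [Fintype b]
    (F : Matrix a a ℂ) (F' : Matrix b b ℂ) (p : Submodule ℂ (Matrix n n ℂ)) :
    Member (Matrix a n ℂ × Matrix b n ℂ) where
  A := Matrix n n ℂ
  K := ⊤
  onW :=
    { toFun := fun k =>
        { toFun := fun w =>
            (w.1 * (↑(k : (Matrix n n ℂ)ˣ)⁻¹ : Matrix n n ℂ),
             w.2 * (↑(k : (Matrix n n ℂ)ˣ) : Matrix n n ℂ)ᵀ)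
          map_add' := by intro v w; simp [Matrix.add_mul]
          map_smul' := by intro c w; simp }
      map_one' := by refine LinearMap.ext fun w => ?_; simp
      map_mul' := by
        intro k l
        refine LinearMap.ext fun w => ?_
        simp [Matrix.mul_assoc, Matrix.transpose_mul] }
  E := Matrix n n ℂ × Matrix n n ℂ
  pStar := p.prod p
  onP :=
    { toFun := fun k =>
        { toFun := fun s =>
            ((↑(k : (Matrix n n ℂ)ˣ)⁻¹ : Matrix n n ℂ)ᵀ * s.1
                * (↑(k : (Matrix n n ℂ)ˣ)⁻¹ : Matrix n n ℂ),
             (↑(k : (Matrix n n ℂ)ˣ) : Matrix n n ℂ) * s.2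
                * (↑(k : (Matrix n n ℂ)ˣ) : Matrix n n ℂ)ᵀ)
          map_add' := by intro v w; simp [Matrix.add_mul, Matrix.mul_add]
          map_smul' := by intro c w; simp }
      map_one' := by refine LinearMap.ext fun w => ?_; simp
      map_mul' := by
        intro k l
        refine LinearMap.ext fun w => ?_
        simp [Matrix.mul_assoc, Matrix.transpose_mul] }
  φ := fun w => (w.1ᵀ * F * w.1, w.2ᵀ * F' * w.2)

/-- Members with `K_ℂ` the product of the isometry groups of two forms on `ℂ^a` and `ℂ^b`, acting
on `W = M_{a,n} × M_{b,n}` by `(A, B) ↦ (k₁ A, k₂ B)`; here `𝔭^* = M_{a,b}` with the action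
`y ↦ k₁ y k₂ᵀ`, and the moment map is `(A, B) ↦ A Bᵀ`. -/
noncomputable def isoMember (n a b : Type) [Fintype n] [Fintype a] [DecidableEq a] [Fintype b] [DecidableEq b]
    (F : Matrix a a ℂ) (F' : Matrix b b ℂ) :
    Member (Matrix a n ℂ × Matrix b n ℂ) where
  A := Matrix a a ℂ × Matrix b b ℂ
  K := isometries₂ F F'
  onW :=
    { toFun := fun k =>
        { toFun := fun w =>
            ((k : (Matrix a a ℂ × Matrix b b ℂ)ˣ).val.1 * w.1,
             (k : (Matrix a a ℂ × Matrix b b ℂ)ˣ).val.2 * w.2)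
          map_add' := by intro v w; simp [Matrix.mul_add]
          map_smul' := by intro c w; simp }
      map_one' := by refine LinearMap.ext fun w => ?_; simp
      map_mul' := by
        intro k l
        refine LinearMap.ext fun w => ?_
        simp [Matrix.mul_assoc] }
  E := Matrix a b ℂ
  pStar := ⊤
  onP :=
    { toFun := fun k =>
        { toFun := fun y =>
            (k : (Matrix a a ℂ × Matrix b b ℂ)ˣ).val.1 * y *
              (k : (Matrix a a ℂ × Matrix b b ℂ)ˣ).val.2ᵀ
          map_add' := by intro v w; simp [Matrix.add_mul, Matrix.mul_add]
          map_smul' := by intro c w; simp }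
      map_one' := by refine LinearMap.ext fun w => ?_; simp
      map_mul' := by
        intro k l
        refine LinearMap.ext fun w => ?_
        simp [Matrix.mul_assoc, Matrix.transpose_mul] }
  φ := fun w => w.1 * w.2ᵀ

/-- The space `W` of a pair of unitary groups `U(n₁, n₂)`, `U(p, q)`, with elements
`(A, B, C, D)`. -/
abbrev UnitaryW (n₁ n₂ p q : ℕ) : Type :=
  Matrix (Fin p) (Fin n₁) ℂ × Matrix (Fin p) (Fin n₂) ℂ ×
    Matrix (Fin q) (Fin n₁) ℂ × Matrix (Fin q) (Fin n₂) ℂ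

/-- The member `U(n₁, n₂)` of the pair `(U(n₁, n₂), U(p, q))`: `K_ℂ = GL_{n₁} × GL_{n₂}`. -/
noncomputable def uSmall (n₁ n₂ p q : ℕ) : Member (UnitaryW n₁ n₂ p q) where
  A := Matrix (Fin n₁) (Fin n₁) ℂ × Matrix (Fin n₂) (Fin n₂) ℂ
  K := ⊤
  onW :=
    { toFun := fun k =>
        { toFun := fun w =>
            (w.1 * k.1⁻¹.val.1, w.2.1 * k.1.val.2ᵀ, w.2.2.1 * k.1.val.1ᵀ, w.2.2.2 * k.1⁻¹.val.2)
          map_add' := by intro v w; simp [Matrix.add_mul]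
          map_smul' := by intro c w; simp }
      map_one' := by refine LinearMap.ext fun w => ?_; simp
      map_mul' := by
        intro k l
        refine LinearMap.ext fun w => ?_
        simp [Matrix.mul_assoc, Matrix.transpose_mul] }
  E := Matrix (Fin n₁) (Fin n₂) ℂ × Matrix (Fin n₂) (Fin n₁) ℂ
  pStar := ⊤
  onP :=
    { toFun := fun k =>
        { toFun := fun s =>
            (k.1⁻¹.val.1ᵀ * s.1 * k.1.val.2ᵀ, k.1⁻¹.val.2ᵀ * s.2 * k.1.val.1ᵀ)
          map_add' := by intro v w; simp [Matrix.add_mul, Matrix.mul_add]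
          map_smul' := by intro c w; simp }
      map_one' := by refine LinearMap.ext fun w => ?_; simp
      map_mul' := by
        intro k l
        refine LinearMap.ext fun w => ?_
        simp [Matrix.mul_assoc, Matrix.transpose_mul] }
  φ := fun w => (w.1ᵀ * w.2.1, w.2.2.2ᵀ * w.2.2.1)

/-- The member `U(p, q)` of the pair `(U(n₁, n₂), U(p, q))`: `K'_ℂ = GL_p × GL_q`. -/
noncomputable def uLarge (n₁ n₂ p q : ℕ) : Member (UnitaryW n₁ n₂ p q) where
  A := Matrix (Fin p) (Fin p) ℂ × Matrix (Fin q) (Fin q) ℂ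
  K := ⊤
  onW :=
    { toFun := fun k =>
        { toFun := fun w =>
            (k.1.val.1 * w.1, k.1⁻¹.val.1ᵀ * w.2.1, k.1⁻¹.val.2ᵀ * w.2.2.1, k.1.val.2 * w.2.2.2)
          map_add' := by intro v w; simp [Matrix.mul_add]
          map_smul' := by intro c w; simp }
      map_one' := by refine LinearMap.ext fun w => ?_; simp
      map_mul' := by
        intro k l
        refine LinearMap.ext fun w => ?_
        simp [Matrix.mul_assoc, Matrix.transpose_mul] }
  E := Matrix (Fin p) (Fin q) ℂ × Matrix (Fin q) (Fin p) ℂ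
  pStar := ⊤
  onP :=
    { toFun := fun k =>
        { toFun := fun s =>
            (k.1.val.1 * s.1 * k.1⁻¹.val.2, k.1.val.2 * s.2 * k.1⁻¹.val.1)
          map_add' := by intro v w; simp [Matrix.add_mul, Matrix.mul_add]
          map_smul' := by intro c w; simp }
      map_one' := by refine LinearMap.ext fun w => ?_; simp
      map_mul' := by
        intro k l
        refine LinearMap.ext fun w => ?_
        simp [Matrix.mul_assoc] }
  φ := fun w => (w.1 * w.2.2.1ᵀ, w.2.2.2 * w.2.1ᵀ)

/-- The member `Sp(2n, ℝ)` of the pair `(Sp(2n, ℝ), O(p, q))`: `K_ℂ = GL_n`. -/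
noncomputable def spR (n p q : ℕ) : Member (Matrix (Fin p) (Fin n) ℂ × Matrix (Fin q) (Fin n) ℂ) :=
  glMember (Fin n) (Fin p) (Fin q) 1 1 (symMatrices (Fin n))

/-- The member `O(p, q)` of the pair `(Sp(2n, ℝ), O(p, q))`: `K_ℂ = O_p × O_q`. -/
noncomputable def oR (n p q : ℕ) : Member (Matrix (Fin p) (Fin n) ℂ × Matrix (Fin q) (Fin n) ℂ) :=
  isoMember (Fin n) (Fin p) (Fin q) 1 1

/-- The member `O^*(2n)` of the pair `(O^*(2n), Sp(p, q))`: `K_ℂ = GL_n`. -/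
noncomputable def oStar (n p q : ℕ) :
    Member (Matrix (Fin p ⊕ Fin p) (Fin n) ℂ × Matrix (Fin q ⊕ Fin q) (Fin n) ℂ) :=
  glMember (Fin n) (Fin p ⊕ Fin p) (Fin q ⊕ Fin q) (Jmat p) (Jmat q) (altMatrices (Fin n))

/-- The member `Sp(p, q)` of the pair `(O^*(2n), Sp(p, q))`: `K_ℂ = Sp_{2p} × Sp_{2q}`. -/
noncomputable def spH (n p q : ℕ) :
    Member (Matrix (Fin p ⊕ Fin p) (Fin n) ℂ × Matrix (Fin q ⊕ Fin q) (Fin n) ℂ) :=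
  isoMember (Fin n) (Fin p ⊕ Fin p) (Fin q ⊕ Fin q) (Jmat p) (Jmat q)

/-- The member `Sp(2n, ℂ)` of the pair of complex groups `(Sp(2n, ℂ), O(p, ℂ))`:
`K_ℂ = Sp_{2n}` acts on `W = M_{p,2n}` by `A ↦ A k⁻¹` and on `𝔭^* = Sym_{2n}` by
`S ↦ k⁻ᵀ S k⁻¹`, and the moment map is `A ↦ Aᵀ A`. -/
noncomputable def spC (n p : ℕ) : Member (Matrix (Fin p) (Fin n ⊕ Fin n) ℂ) where
  A := Matrix (Fin n ⊕ Fin n) (Fin n ⊕ Fin n) ℂ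
  K := isometries (Jmat n)
  onW :=
    { toFun := fun k =>
        { toFun := fun w => w * k.1⁻¹.val
          map_add' := by intro v w; simp [Matrix.add_mul]
          map_smul' := by intro c w; simp }
      map_one' := by refine LinearMap.ext fun w => ?_; simp
      map_mul' := by
        intro k l
        refine LinearMap.ext fun w => ?_
        simp [Matrix.mul_assoc] }
  E := Matrix (Fin n ⊕ Fin n) (Fin n ⊕ Fin n) ℂ
  pStar := symMatrices (Fin n ⊕ Fin n)
  onP :=
    { toFun := fun k =>
        { toFun := fun s => k.1⁻¹.valᵀ * s * k.1⁻¹.val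
          map_add' := by intro v w; simp [Matrix.add_mul, Matrix.mul_add]
          map_smul' := by intro c w; simp }
      map_one' := by refine LinearMap.ext fun w => ?_; simp
      map_mul' := by
        intro k l
        refine LinearMap.ext fun w => ?_
        simp [Matrix.mul_assoc, Matrix.transpose_mul] }
  φ := fun w => wᵀ * w

/-- The member `O(p, ℂ)` of the pair of complex groups `(Sp(2n, ℂ), O(p, ℂ))`:
`K_ℂ = O_p` acts on `W = M_{p,2n}` by `A ↦ k A` and on `𝔭^* = Alt_p` by
`S ↦ k S kᵀ`, and the moment map is `A ↦ A J Aᵀ`. -/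
noncomputable def oC (n p : ℕ) : Member (Matrix (Fin p) (Fin n ⊕ Fin n) ℂ) where
  A := Matrix (Fin p) (Fin p) ℂ
  K := isometries 1
  onW :=
    { toFun := fun k =>
        { toFun := fun w => k.1.val * w
          map_add' := by intro v w; simp [Matrix.mul_add]
          map_smul' := by intro c w; simp }
      map_one' := by refine LinearMap.ext fun w => ?_; simp
      map_mul' := by
        intro k l
        refine LinearMap.ext fun w => ?_
        simp [Matrix.mul_assoc] }
  E := Matrix (Fin p) (Fin p) ℂ
  pStar := altMatrices (Fin p)
  onP :=
    { toFun := fun k =>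
        { toFun := fun s => k.1.val * s * k.1.valᵀ
          map_add' := by intro v w; simp [Matrix.add_mul, Matrix.mul_add]
          map_smul' := by intro c w; simp }
      map_one' := by refine LinearMap.ext fun w => ?_; simp
      map_mul' := by
        intro k l
        refine LinearMap.ext fun w => ?_
        simp [Matrix.mul_assoc, Matrix.transpose_mul] }
  φ := fun w => w * Jmat n * wᵀ

end Pairs

/-- `(M, M')` are the two members `(G, G')` of an irreducible type I reductive dual pair in stable
range, with `G` the smaller member. -/
inductive StableRange : {W : Type} → [AddCommGroup W] → [Module ℂ W] →
    Member W → Member W → Prop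
  /-- `(Sp(2n, ℝ), O(p, q))` -/
  | sp_o (n p q : ℕ) : 2 * n ≤ p → 2 * n ≤ q → StableRange (spR n p q) (oR n p q)
  /-- `(O(p, q), Sp(2n, ℝ))` -/
  | o_sp (n p q : ℕ) : p + q ≤ n → StableRange (oR n p q) (spR n p q)
  /-- `(U(n₁, n₂), U(p, q))` -/
  | u_u (n₁ n₂ p q : ℕ) : n₁ + n₂ ≤ p → n₁ + n₂ ≤ q →
      StableRange (uSmall n₁ n₂ p q) (uLarge n₁ n₂ p q)
  /-- `(O^*(2n), Sp(p, q))` -/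
  | oStar_sp (n p q : ℕ) : n ≤ p → n ≤ q → StableRange (oStar n p q) (spH n p q)
  /-- `(Sp(p, q), O^*(2n))` -/
  | sp_oStar (n p q : ℕ) : 2 * (p + q) ≤ n → StableRange (spH n p q) (oStar n p q)
  /-- `(Sp(2n, ℂ), O(p, ℂ))` -/
  | spC_oC (n p : ℕ) : 4 * n ≤ p → StableRange (spC n p) (oC n p)
  /-- `(O(p, ℂ), Sp(2n, ℂ))` -/
  | oC_spC (n p : ℕ) : p ≤ n → StableRange (oC n p) (spC n p)

/-!
The theta lift of admissible orbit data in stable range.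

The heart of the matter is a comparison of characters at a point `w` with `φ w = x` and
`φ' w = x'`. In stable range the points over `θ(O)` are *regular*
(`Member.IsRegularPoint`): `K_ℂ` acts freely on the orbit of `w`, every `k' ∈ K'_{x'}` moves `w`
inside this orbit, which gives `α : K'_{x'} → K_x`, the differential `D` of `φ` at `w` maps onto
`𝔭^*`, and its kernel is the tangent space `𝔨' w` of the `K'_ℂ`-orbit of `w`. Let `k'` lie in
`K'_{x'}` and put `k = α(k')`, so that `h = k k'` fixes `w` and acts on `W`. The filtration
`𝔨 w ∩ 𝔨' w ⊆ 𝔨' w ⊆ W` is stable under `h`, with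
* `W / 𝔨' w ≅ 𝔭^*`, by `D`, where `h` acts by the coadjoint action of `k`;
* `𝔨' w / (𝔨 w ∩ 𝔨' w) ≅ 𝔨' / 𝔨'_{x'}`, where `h` acts by `Ad k'`;
* `𝔨 w ∩ 𝔨' w ≅ 𝔨_x`, where `h` acts by `Ad k`.

The actions of `k` on `𝔭^*` and on `𝔨` preserve nondegenerate symmetric forms, so that their
determinants are `± 1`, and they are `1` if `k` is a square, as every `exp X` is. Then the
determinant of `k` on `𝔨_x` is inverse to that on `𝔨 / 𝔨_x`, and the determinants of the three
pieces multiply to (`Member.IsRegularPoint.gamma_comparison`)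
`γ_{x'}(k') det(k' | W) det(k | W) = γ_x(k)`.
The element `exp X` of the metaplectic cover has the second coordinate `det(exp(X/2) | W)`, because
both are continuous square roots along a path, and `ς` is its inverse. For `k' = exp(X'/2)` the
identity above therefore says that the two factors `ς` in the definition of `χ_{x'}` turn `γ_x` into
`γ_{x'}`, which is admissibility (`Member.IsAdmissible.lift`). Rationality and genuineness follow
from the same formula, since `α` is the restriction of a linear map of `k'` and `k'⁻¹`; the orbit
`O'` is nilpotent because `φ'(0) = 0` lies in `φ' (φ⁻¹ (closure of O))`. Together these give
`Member.IsRegularPoint.thetaLift`.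

What remains is linear algebra for each pair. A point is regular as soon as its matrices have
one-sided inverses: injective ones over the groups `GL` and `Sp_{2n}`, surjective ones over `O_p`
and the products of isometry groups. That this holds for every `w` over `x` with `φ' w ∈ O'` is
where the stable range enters: it provides some `w₁` over `x` with matrices of full rank, by means of
a totally isotropic subspace with a dual one (`IsSignedForm.exists_gram_eq`) or by splitting off
coordinates. Then `φ' w₁` lies in the closure of `O'`, so a minor that does not vanish at `φ' w₁`
does not vanish identically on `O'` either (`Member.IsThetaLiftOrbit.exists_ne_zero`), and the
rank of `φ' w` forces the matrices of `w` to have full rank.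
-/

set_option linter.unusedSectionVars false

/-! ### Exponentials of matrices -/

section Exponentials

attribute [local instance] Matrix.linftyOpNormedRing Matrix.linftyOpNormedAlgebra

variable {m n : Type} [Fintype m] [DecidableEq m] [Fintype n] [DecidableEq n]

theorem Matrix.exp_mul_eq_mul_exp {a : Matrix m m ℂ} {b : Matrix n n ℂ} {y : Matrix m n ℂ}
    (h : a * y = y * b) : NormedSpace.exp a * y = y * NormedSpace.exp b := by
  have ha := (NormedSpace.exp_series_hasSum_exp' (𝕂 := ℂ) a).map
    (Matrix.addMonoidHomMulRight y) (by
      change Continuous fun M : Matrix m m ℂ => M * y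
      fun_prop)
  have hb := (NormedSpace.exp_series_hasSum_exp' (𝕂 := ℂ) b).map
    (Matrix.addMonoidHomMulLeft y) (by
      change Continuous fun M : Matrix n n ℂ => y * M
      fun_prop)
  refine ha.unique ?_
  convert hb using 1
  · funext k
    have hk : a ^ k * y = y * b ^ k := by
      induction k with
      | zero => simp
      | succ k ih => rw [pow_succ, Matrix.mul_assoc, h, ← Matrix.mul_assoc, ih, Matrix.mul_assoc,
          ← pow_succ]
    simp [Matrix.addMonoidHomMulRight, Matrix.addMonoidHomMulLeft, hk]
  · rfl

/-- One-parameter groups `exp (t a)` and `exp (t b)` are intertwined by `y` exactly when their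
generators are. -/
theorem Matrix.forall_exp_smul_mul_eq_iff {a : Matrix m m ℂ} {b : Matrix n n ℂ}
    {y : Matrix m n ℂ} :
    (∀ t : ℂ, NormedSpace.exp (t • a) * y = y * NormedSpace.exp (t • b)) ↔ a * y = y * b := by
  refine ⟨fun h => ?_, fun h t => Matrix.exp_mul_eq_mul_exp (by simp [h])⟩
  ext i j
  let l : Matrix m m ℂ →ₗ[ℂ] ℂ :=
    { toFun := fun M => (M * y) i j
      map_add' := by intro M N; simp [Matrix.add_mul]
      map_smul' := by intro c M; simp }
  let r : Matrix n n ℂ →ₗ[ℂ] ℂ :=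
    { toFun := fun M => (y * M) i j
      map_add' := by intro M N; simp [Matrix.mul_add]
      map_smul' := by intro c M; simp }
  have hl : HasDerivAt (fun t : ℂ => (NormedSpace.exp (t • a) * y) i j)
      ((NormedSpace.exp ((0 : ℂ) • a) * a * y) i j) 0 :=
          (LinearMap.toContinuousLinearMap l).hasFDerivAt.comp_hasDerivAt (0 : ℂ)
    (hasDerivAt_exp_smul_const (𝕂 := ℂ) a (0 : ℂ))
  have hr : HasDerivAt (fun t : ℂ => (y * NormedSpace.exp (t • b)) i j)
      ((y * (NormedSpace.exp ((0 : ℂ) • b) * b)) i j) 0 :=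
          (LinearMap.toContinuousLinearMap r).hasFDerivAt.comp_hasDerivAt (0 : ℂ)
    (hasDerivAt_exp_smul_const (𝕂 := ℂ) b (0 : ℂ))
  have he : (fun t : ℂ => (NormedSpace.exp (t • a) * y) i j) =
      fun t : ℂ => (y * NormedSpace.exp (t • b)) i j := by
    funext t
    rw [h t]
  rw [he] at hl
  simpa using hl.unique hr

theorem Matrix.exp_mul_exp_neg (a : Matrix m m ℂ) :
    NormedSpace.exp a * NormedSpace.exp (-a) = 1 := by
  rw [← Matrix.exp_add_of_commute _ _ (Commute.neg_right (Commute.refl a))]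
  simp

theorem Matrix.exp_neg_mul_exp (a : Matrix m m ℂ) :
    NormedSpace.exp (-a) * NormedSpace.exp a = 1 := by
  simpa using Matrix.exp_mul_exp_neg (-a)

theorem Matrix.exp_prod (X : Matrix m m ℂ × Matrix n n ℂ) :
    NormedSpace.exp X = (NormedSpace.exp X.1, NormedSpace.exp X.2) :=
  Prod.ext (Prod.fst_exp X) (Prod.snd_exp X)

theorem Matrix.exp_add_smul (X : Matrix m m ℂ) (s t : ℂ) :
    NormedSpace.exp ((s + t) • X) = NormedSpace.exp (s • X) * NormedSpace.exp (t • X) := by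
  rw [add_smul]
  exact Matrix.exp_add_of_commute _ _ (((Commute.refl X).smul_left s).smul_right t)

theorem Matrix.continuous_exp_smul (X : Matrix m m ℂ) :
    Continuous fun t : ℝ => NormedSpace.exp ((t : ℂ) • X) :=
  (NormedSpace.exp_continuous (𝔸 := Matrix m m ℂ)).comp
    ((Complex.continuous_ofReal).smul continuous_const)

end Exponentials

/-! ### Determinants on short exact sequences and of isometries -/

section Determinants

variable {U V Q : Type*} [AddCommGroup U] [Module ℂ U] [AddCommGroup V] [Module ℂ V]
  [AddCommGroup Q] [Module ℂ Q]

theorem LinearMap.det_eq_of_bijective {f : U →ₗ[ℂ] V} (hf : Function.Bijective f)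
    {u : U →ₗ[ℂ] U} {v : V →ₗ[ℂ] V} (h : ∀ x, f (u x) = v (f x)) :
    LinearMap.det u = LinearMap.det v := by
  let e := LinearEquiv.ofBijective f hf
  rw [← LinearMap.det_conj u e]
  congr 1
  ext x
  obtain ⟨y, rfl⟩ := e.surjective x
  simpa [e] using h y

/-- The determinant is multiplicative on short exact sequences. -/
theorem LinearMap.det_eq_mul_of_exact [FiniteDimensional ℂ V] {f : U →ₗ[ℂ] V} {g : V →ₗ[ℂ] Q}
    (hf : Function.Injective f) (hg : Function.Surjective g)
    (hfg : ∀ x, g x = 0 ↔ ∃ y, f y = x)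
    {u : U →ₗ[ℂ] U} {v : V →ₗ[ℂ] V} {q : Q →ₗ[ℂ] Q}
    (hu : ∀ x, f (u x) = v (f x)) (hq : ∀ x, g (v x) = q (g x)) :
    LinearMap.det v = LinearMap.det u * LinearMap.det q := by
  have hinv : LinearMap.ker g ≤ (LinearMap.ker g).comap v := by
    intro x hx
    simp only [Submodule.mem_comap, LinearMap.mem_ker] at *
    rw [hq, hx, map_zero]
  rw [LinearMap.det_eq_det_mul_det (LinearMap.ker g) v hinv]
  congr 1
  · symm
    refine LinearMap.det_eq_of_bijective
      (f := f.codRestrict (LinearMap.ker g) fun y => (hfg _).2 ⟨y, rfl⟩) ⟨?_, ?_⟩ ?_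
    · intro a b hab
      exact hf (congrArg Subtype.val hab)
    · rintro ⟨x, hx⟩
      obtain ⟨y, rfl⟩ := (hfg x).1 hx
      exact ⟨y, rfl⟩
    · intro x
      exact Subtype.ext (hu x)
  · refine LinearMap.det_eq_of_bijective
      (f := (g.quotKerEquivOfSurjective hg).toLinearMap) (LinearEquiv.bijective _) ?_
    intro x
    obtain ⟨y, rfl⟩ := Submodule.Quotient.mk_surjective _ x
    exact hq y

/-- An isometry of a nondegenerate bilinear form has determinant `± 1`. -/
theorem LinearMap.det_mul_self_of_isometry [FiniteDimensional ℂ V]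
    {B : V →ₗ[ℂ] V →ₗ[ℂ] ℂ} (hB : ∀ x, (∀ y, B x y = 0) → x = 0) {u : V →ₗ[ℂ] V}
    (hu : ∀ x y, B (u x) (u y) = B x y) :
    LinearMap.det u * LinearMap.det u = 1 := by
  have hinj : Function.Injective B := by
    rw [← LinearMap.ker_eq_bot, LinearMap.ker_eq_bot']
    intro x hx
    exact hB x fun y => by rw [hx]; rfl
  have huinj : Function.Injective u := by
    rw [← LinearMap.ker_eq_bot, LinearMap.ker_eq_bot']
    intro x hx
    exact hB x fun y => by rw [← hu, hx]; simp
  have hbij : Function.Bijective (B : V →ₗ[ℂ] Module.Dual ℂ V) :=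
    ⟨hinj, (LinearMap.injective_iff_surjective_of_finrank_eq_finrank
      (Subspace.dual_finrank_eq (K := ℂ) (V := V)).symm).1 hinj⟩
  let e := LinearEquiv.ofInjectiveEndo u huinj
  have h := LinearMap.det_eq_of_bijective (f := (B : V →ₗ[ℂ] Module.Dual ℂ V)) hbij
    (u := e.symm.toLinearMap) (v := u.dualMap) (by
      intro x
      ext y
      obtain ⟨z, rfl⟩ := e.surjective x
      have hez : e z = u z := rfl
      change B (e.symm (e z)) y = B (e z) (u y)
      rw [LinearEquiv.symm_apply_apply, hez]
      exact (hu z y).symm)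
  rw [LinearMap.det_dualMap] at h
  nth_rewrite 1 [← h]
  have h2 := e.det_symm_mul_det
  exact h2

end Determinants

section DeterminantIdentity

/-- The determinant identity behind the comparison of `γ_x` and `γ_{x'}`. The maps `δ`, `δ'` stand
for the actions of the two Lie algebras on the point `w` and `D` for the differential of `φ` at `w`.
One has `W / im δ' ≅ P`, `im δ' / (im δ ∩ im δ') ≅ 𝔨' / 𝔪'` and `im δ ∩ im δ' ≅ 𝔪`. -/
theorem LinearMap.det_mul_det_mapQ {k k' W P : Type*} [AddCommGroup k] [Module ℂ k]
    [FiniteDimensional ℂ k] [AddCommGroup k'] [Module ℂ k']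
    [AddCommGroup W] [Module ℂ W] [FiniteDimensional ℂ W] [AddCommGroup P] [Module ℂ P]
    {δ : k →ₗ[ℂ] W} {δ' : k' →ₗ[ℂ] W} {D : W →ₗ[ℂ] P} {m : Submodule ℂ k} {m' : Submodule ℂ k'}
    (hδ : Function.Injective δ) (hD : Function.Surjective D)
    (hker : ∀ v, D v = 0 ↔ ∃ X', δ' X' = v)
    (hm : ∀ X, D (δ X) = 0 ↔ X ∈ m) (hm' : ∀ X', X' ∈ m' ↔ ∃ X, δ X = δ' X')
    {a : k →ₗ[ℂ] k} {a' : k' →ₗ[ℂ] k'} {h : W →ₗ[ℂ] W} {p : P →ₗ[ℂ] P}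
    (ha : m ≤ m.comap a) (ha' : m' ≤ m'.comap a')
    (hδa : ∀ X, h (δ X) = δ (a X)) (hδa' : ∀ X', h (δ' X') = δ' (a' X'))
    (hDp : ∀ v, D (h v) = p (D v)) :
    LinearMap.det h * LinearMap.det (m.mapQ m a ha) =
      LinearMap.det p * LinearMap.det (m'.mapQ m' a' ha') * LinearMap.det a := by
  have hR : ∀ v ∈ LinearMap.ker D, h v ∈ LinearMap.ker D := by
    intro v hv
    rw [LinearMap.mem_ker] at *
    rw [hDp, hv, map_zero]
  have h1 : LinearMap.det h = LinearMap.det (h.restrict hR) * LinearMap.det p :=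
    LinearMap.det_eq_mul_of_exact (f := (LinearMap.ker D).subtype) (g := D)
      (Submodule.injective_subtype _) hD
      (fun x => ⟨fun hx => ⟨⟨x, hx⟩, rfl⟩, by rintro ⟨y, rfl⟩; exact y.2⟩)
      (fun x => rfl) hDp
  let ι : m →ₗ[ℂ] LinearMap.ker D :=
    (δ ∘ₗ m.subtype).codRestrict (LinearMap.ker D) fun X => (hm X).2 X.2
  have hιinj : Function.Injective ι := by
    intro X Y hXY
    exact Subtype.ext (hδ (congrArg Subtype.val hXY))
  have hN : LinearMap.range ι ≤ (LinearMap.range ι).comap (h.restrict hR) := by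
    rintro _ ⟨X, rfl⟩
    exact ⟨⟨a X, ha X.2⟩, Subtype.ext (hδa X).symm⟩
  have h2 : LinearMap.det (h.restrict hR) = LinearMap.det (a.restrict (p := m) (q := m) ha) *
      LinearMap.det ((LinearMap.range ι).mapQ _ (h.restrict hR) hN) := by
    refine LinearMap.det_eq_mul_of_exact (f := ι) (g := (LinearMap.range ι).mkQ) hιinj
      (Submodule.mkQ_surjective _) ?_ ?_ ?_
    · intro x
      simp
    · intro X
      exact Subtype.ext (hδa X).symm
    · intro x
      rfl
  let π : k' →ₗ[ℂ] LinearMap.ker D := δ'.codRestrict (LinearMap.ker D) fun X => (hker _).2 ⟨X, rfl⟩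
  have hπ : ∀ X, X ∈ m' ↔ π X ∈ LinearMap.range ι := by
    intro X
    rw [hm']
    constructor
    · rintro ⟨Y, hY⟩
      exact ⟨⟨Y, (hm Y).1 (by rw [hY]; exact (hker _).2 ⟨X, rfl⟩)⟩, Subtype.ext hY⟩
    · rintro ⟨Y, hY⟩
      exact ⟨Y, congrArg Subtype.val hY⟩
  have h3 : LinearMap.det (m'.mapQ m' a' ha') =
      LinearMap.det ((LinearMap.range ι).mapQ _ (h.restrict hR) hN) := by
    refine LinearMap.det_eq_of_bijective
      (f := m'.mapQ (LinearMap.range ι) π fun X hX => (hπ X).1 hX) ⟨?_, ?_⟩ ?_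
    · rw [← LinearMap.ker_eq_bot, LinearMap.ker_eq_bot']
      intro x hx
      obtain ⟨X, rfl⟩ := Submodule.Quotient.mk_surjective _ x
      rw [Submodule.mapQ_apply, Submodule.Quotient.mk_eq_zero] at hx
      rw [Submodule.Quotient.mk_eq_zero]
      exact (hπ X).2 hx
    · intro x
      obtain ⟨⟨v, hv⟩, rfl⟩ := Submodule.Quotient.mk_surjective _ x
      obtain ⟨X, rfl⟩ := (hker v).1 hv
      exact ⟨Submodule.Quotient.mk X, rfl⟩
    · intro x
      obtain ⟨X, rfl⟩ := Submodule.Quotient.mk_surjective _ x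
      simp only [Submodule.mapQ_apply]
      congr 1
      exact Subtype.ext (hδa' X).symm
  have h4 : LinearMap.det a = LinearMap.det (a.restrict (p := m) (q := m) ha) *
      LinearMap.det (m.mapQ m a ha) := LinearMap.det_eq_det_mul_det m a ha
  rw [h1, h2, h3, h4]
  ring

end DeterminantIdentity

/-! ### Regular points over an orbit -/

namespace Member

variable {W : Type} [AddCommGroup W] [Module ℂ W]

/-- The properties of exponentials and of matrix coefficients shared by all the members. -/
structure IsMatrixGroup (M : Member W) : Prop where
  finite : FiniteDimensional ℂ M.A
  continuousSMul : ContinuousSMul ℂ M.A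
  exp_add : ∀ (X : M.A) (s t : ℂ), NormedSpace.exp ((s + t) • X) =
    NormedSpace.exp (s • X) * NormedSpace.exp (t • X)
  continuous_exp : ∀ X : M.A, Continuous fun t : ℝ => NormedSpace.exp ((t : ℂ) • X)
  onW_linear : ∃ ρ σ : M.A →ₗ[ℂ] (W →ₗ[ℂ] W), ∀ k, M.onW k = ρ (M.mat k) + σ (M.mat k⁻¹)

/-- `K_ℂ` preserves bilinear forms on `𝔭^*` and on its Lie algebra that are nondegenerate. -/
structure HasInvariantForms (M : Member W) : Prop where
  onP_mem : ∀ k, ∀ s ∈ M.pStar, M.onP k s ∈ M.pStar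
  onP_form : ∃ B : M.E →ₗ[ℂ] M.E →ₗ[ℂ] ℂ, (∀ k s t, B (M.onP k s) (M.onP k t) = B s t) ∧
    ∀ s ∈ M.pStar, (∀ t ∈ M.pStar, B s t = 0) → s = 0
  Ad_form : ∃ B : M.A →ₗ[ℂ] M.A →ₗ[ℂ] ℂ, (∀ k X Y, B (M.Ad k X) (M.Ad k Y) = B X Y) ∧
    ∀ X ∈ M.lieAlg ⊤, (∀ Y ∈ M.lieAlg ⊤, B X Y = 0) → X = 0

/-- The actions of the members `M`, `M'` on `W` commute, and the moment map of `M` is equivariant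
under `M` and invariant under `M'`. -/
structure IsDualPair (M M' : Member W) : Prop where
  commute : ∀ k k' v, M.onW k (M'.onW k' v) = M'.onW k' (M.onW k v)
  φ_onW : ∀ k v, M.φ (M.onW k v) = M.onP k (M.φ v)
  φ_onW' : ∀ k' v, M.φ (M'.onW k' v) = M.φ v
  φ_zero : M.φ 0 = 0
  φ'_zero : M'.φ 0 = 0

/-- `w` is a regular point of the double fibration `𝔭^* ← W → 𝔭'^*`: the group `K_ℂ` acts freely on
its orbit, every `k' ∈ K'_{x'}` moves `w` inside this orbit, algebraically in `k'`, and the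
infinitesimal counterparts hold. Here `δ X` and `δ' X'` are the velocities of `w` under the
one-parameter groups of `X` and `X'`, and `D` is the differential of `φ` at `w`. -/
structure IsRegularPoint (M M' : Member W) (w : W) : Prop where
  free : ∀ k, M.onW k w = w → k = 1
  lift : ∀ k' ∈ M'.stab (M'.φ w), ∃ k, M.onW k (M'.onW k' w) = w
  lift_linear : ∃ T S : M'.A →ₗ[ℂ] M.A, ∀ k k', M.onW k (M'.onW k' w) = w →
    M.mat k = T (M'.mat k') + S (M'.mat k'⁻¹)
  exp_lift : ∀ X' ∈ M'.lieSet (M'.stab (M'.φ w)), ∃ X : M.A, ∀ t : ℂ, ∃ k : M.K,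
    M.mat k = NormedSpace.exp (t • X) ∧
    ∀ k' : M'.K, M'.mat k' = NormedSpace.exp (t • X') → M.onW k (M'.onW k' w) = w
  infinitesimal : ∃ (δ : M.A →ₗ[ℂ] W) (δ' : M'.A →ₗ[ℂ] W) (D : W →ₗ[ℂ] M.E),
    (∀ v, M.φ (w + v) = M.φ w + D v + M.φ v) ∧
    (∀ s, s ∈ M.pStar ↔ ∃ v, D v = s) ∧
    (∀ v, D v = 0 ↔ ∃ X' ∈ M'.lieAlg ⊤, δ' X' = v) ∧
    (∀ X ∈ M.lieAlg ⊤, δ X = 0 → X = 0) ∧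
    (∀ X ∈ M.lieAlg ⊤, D (δ X) = 0 ↔ X ∈ M.lieAlg (M.stab (M.φ w))) ∧
    (∀ X' ∈ M'.lieAlg ⊤, X' ∈ M'.lieAlg (M'.stab (M'.φ w)) ↔ ∃ X ∈ M.lieAlg ⊤, δ X = δ' X') ∧
    ∀ k k', M.onW k (M'.onW k' w) = w →
      (∀ X, M.onW k (M'.onW k' (δ X)) = δ (M.Ad k X)) ∧
      ∀ X', M.onW k (M'.onW k' (δ' X')) = δ' (M'.Ad k' X')

variable {M M' : Member W}

theorem mat_injective {k l : M.K} (h : M.mat k = M.mat l) : k = l :=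
  Subtype.ext (Units.ext h)

theorem mat_mul (k l : M.K) : M.mat (k * l) = M.mat k * M.mat l := rfl

theorem Ad_mul (k l : M.K) (X : M.A) : M.Ad (k * l) X = M.Ad k (M.Ad l X) := by
  simp [Ad, mat, mul_assoc]

theorem Ad_one (X : M.A) : M.Ad 1 X = X := by
  simp [Ad, mat]

theorem det_onW_mul (k l : M.K) :
    LinearMap.det (M.onW (k * l)) = LinearMap.det (M.onW k) * LinearMap.det (M.onW l) := by
  rw [map_mul]
  exact LinearMap.det_comp _ _

theorem det_onW_mul_inv (k : M.K) :
    LinearMap.det (M.onW k) * LinearMap.det (M.onW k⁻¹) = 1 := by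
  rw [← det_onW_mul]; simp

theorem det_onW_ne_zero (k : M.K) : LinearMap.det (M.onW k) ≠ 0 :=
  left_ne_zero_of_mul_eq_one (det_onW_mul_inv k)

theorem gamma_eq (hfin : FiniteDimensional ℂ M.A) (x : M.E) (k : M.stab x) :
    M.gamma x k * LinearMap.det (M.tangentAct x k) = 1 := by
  rw [gamma, LinearMap.det_dualMap, ← LinearMap.det_comp]
  have h : M.tangentAct x k⁻¹ ∘ₗ M.tangentAct x k = LinearMap.id := by
    refine LinearMap.ext fun y => ?_
    obtain ⟨⟨X, hX⟩, rfl⟩ := Submodule.Quotient.mk_surjective _ y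
    refine congrArg Submodule.Quotient.mk (Subtype.ext ?_)
    change M.Ad _ (M.Ad _ X) = X
    rw [← Ad_mul]
    simp [Ad_one]
  rw [h, LinearMap.det_id]

/-- The comparison of the characters `γ_x` and `γ_{x'}`. The element `k` is required to be a square
because isometries of `𝔨` and `𝔭^*` have determinant `± 1`. -/
theorem IsRegularPoint.gamma_comparison [FiniteDimensional ℂ W] (hfin : FiniteDimensional ℂ M.A)
    (hfin' : FiniteDimensional ℂ M'.A) (hforms : HasInvariantForms M) (hpair : IsDualPair M M')
    {w : W} (hw : IsRegularPoint M M' w) (k : M.stab (M.φ w)) (k' : M'.stab (M'.φ w)) (l : M.K)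
    (hl : (k : M.K) = l * l) (hk : M.onW k (M'.onW k' w) = w) :
    M'.gamma (M'.φ w) k' * LinearMap.det (M'.onW k') * LinearMap.det (M.onW k) =
      M.gamma (M.φ w) k := by
  obtain ⟨δ, δ', D, hφ, hp, hker, hinj, hm, hm', heq⟩ := hw.infinitesimal
  -- `D` is equivariant: expand the equivariance of the quadratic map `φ` at `w + v`
  have hDh : ∀ v, D (M.onW k (M'.onW k' v)) = M.onP k (D v) := by
    intro v
    have h1 := hφ (M.onW k (M'.onW k' v))
    have h2 : w + M.onW k (M'.onW k' v) = M.onW k (M'.onW k' (w + v)) := by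
      rw [map_add, map_add, hk]
    have hkx : M.onP k (M.φ w) = M.φ w := k.2
    rw [h2, hpair.φ_onW, hpair.φ_onW', hpair.φ_onW, hpair.φ_onW', hφ v, map_add, map_add,
      hkx] at h1
    exact (add_left_cancel (add_right_cancel h1)).symm
  have hkp := hforms.onP_mem k
  let P := LinearMap.codRestrict M.pStar D fun v => (hp _).2 ⟨v, rfl⟩
  have key := LinearMap.det_mul_det_mapQ (δ := δ ∘ₗ (M.lieAlg ⊤).subtype)
    (δ' := δ' ∘ₗ (M'.lieAlg ⊤).subtype) (D := P)
    (m := (M.lieAlg (M.stab (M.φ w))).submoduleOf (M.lieAlg ⊤))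
    (m' := (M'.lieAlg (M'.stab (M'.φ w))).submoduleOf (M'.lieAlg ⊤))
    (a := (M.Ad k).restrict (M.Ad_mem ⊤ (Subgroup.mem_top _)))
    (a' := (M'.Ad k').restrict (M'.Ad_mem ⊤ (Subgroup.mem_top _)))
    (h := M.onW k ∘ₗ M'.onW k') (p := (M.onP k).restrict hkp)
    (by
      rw [← LinearMap.ker_eq_bot, LinearMap.ker_eq_bot']
      intro X hX
      exact Subtype.ext (hinj X X.2 hX))
    (by
      rintro ⟨s, hs⟩
      obtain ⟨v, rfl⟩ := (hp s).1 hs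
      exact ⟨v, rfl⟩)
    (by
      intro v
      rw [show P v = 0 ↔ D v = 0 from Subtype.ext_iff, hker]
      exact ⟨fun ⟨X, hX, h⟩ => ⟨⟨X, hX⟩, h⟩, fun ⟨X, h⟩ => ⟨X, X.2, h⟩⟩)
    (by
      intro X
      exact Iff.trans Subtype.ext_iff (hm X X.2))
    (by
      intro X'
      refine (hm' X' X'.2).trans ?_
      exact ⟨fun ⟨X, hX, h⟩ => ⟨⟨X, hX⟩, h⟩, fun ⟨X, h⟩ => ⟨X, X.2, h⟩⟩)
    (fun _ hX => M.Ad_mem (M.stab _) k.2 _ hX)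
    (fun _ hX => M'.Ad_mem (M'.stab _) k'.2 _ hX)
    (fun X => (heq k k' hk).1 X) (fun X => (heq k k' hk).2 X)
    (fun v => Subtype.ext (hDh v))
  change _ * LinearMap.det (M.tangentAct (M.φ w) k) =
    _ * LinearMap.det (M'.tangentAct (M'.φ w) k') * _ at key
  have hP : LinearMap.det ((M.onP k).restrict hkp) = 1 := by
    have : FiniteDimensional ℂ M.pStar := by
      have hs : M.pStar = LinearMap.range D := by
        ext s; exact hp s
      rw [hs]
      infer_instance
    obtain ⟨B, hB, hB0⟩ := hforms.onP_form
    have h1 := LinearMap.det_mul_self_of_isometry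
      (B := B.domRestrict₁₂ M.pStar M.pStar) (u := (M.onP l).restrict (hforms.onP_mem l))
      (fun s hs => Subtype.ext (hB0 s s.2 fun t ht => hs ⟨t, ht⟩)) (fun s t => hB l s t)
    rw [← h1, ← LinearMap.det_comp]
    congr 1
    ext s
    simp [hl]
  have hA : LinearMap.det ((M.Ad k).restrict (M.Ad_mem ⊤ (Subgroup.mem_top (k : M.K)))) = 1 := by
    obtain ⟨B, hB, hB0⟩ := hforms.Ad_form
    have h1 := LinearMap.det_mul_self_of_isometry
      (B := B.domRestrict₁₂ (M.lieAlg ⊤) (M.lieAlg ⊤))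
      (u := (M.Ad l).restrict (M.Ad_mem ⊤ (Subgroup.mem_top l)))
      (fun s hs => Subtype.ext (hB0 s s.2 fun t ht => hs ⟨t, ht⟩)) (fun s t => hB l s t)
    rw [← h1, ← LinearMap.det_comp]
    congr 1
    refine LinearMap.ext fun X => Subtype.ext ?_
    change M.Ad k X = M.Ad l (M.Ad l X)
    rw [← Ad_mul, hl]
  rw [hP, hA, one_mul, mul_one, LinearMap.det_comp] at key
  have g1 := gamma_eq hfin (M.φ w) k
  have g2 := gamma_eq hfin' (M'.φ w) k'
  calc _ = M'.gamma (M'.φ w) k' * (LinearMap.det (M.onW k) * LinearMap.det (M'.onW k')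
        * LinearMap.det (M.tangentAct (M.φ w) k)) * M.gamma (M.φ w) k := by
        linear_combination (-(M'.gamma (M'.φ w) k' * LinearMap.det (M'.onW k') *
          LinearMap.det (M.onW k))) * g1
    _ = M.gamma (M.φ w) k := by
        rw [key]
        linear_combination M.gamma (M.φ w) k * g2

end Member

/-! ### The homomorphism between stabilizers -/

namespace Member

variable {W : Type} [AddCommGroup W] [Module ℂ W] {M M' : Member W}

theorem onW_mul_apply (k l : M.K) (v : W) : M.onW (k * l) v = M.onW k (M.onW l v) := by
  rw [map_mul]; rfl

theorem onW_inv_apply (k : M.K) (v : W) : M.onW k⁻¹ (M.onW k v) = v := by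
  rw [← onW_mul_apply]; simp

theorem eq_onW_inv_iff (k : M.K) (v u : W) : v = M.onW k⁻¹ u ↔ M.onW k v = u := by
  constructor
  · rintro rfl
    rw [← onW_mul_apply]; simp
  · rintro rfl
    rw [onW_inv_apply]

theorem IsDualPair.mem_stab (hpair : IsDualPair M M') {w : W} {k : M.K} {k' : M'.K}
    (h : M.onW k (M'.onW k' w) = w) : k ∈ M.stab (M.φ w) := by
  have h1 := congrArg M.φ h
  rwa [hpair.φ_onW, hpair.φ_onW'] at h1

theorem IsRegularPoint.eq_of_onW (hpair : IsDualPair M M') {w : W} (hw : IsRegularPoint M M' w)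
    {k l : M.K} {k' : M'.K} (hk : M.onW k (M'.onW k' w) = w) (hl : M.onW l (M'.onW k' w) = w) :
    k = l := by
  rw [hpair.commute] at hk hl
  have h1 : M.onW k w = M.onW l w := by
    rw [← onW_inv_apply k' (M.onW k w), ← onW_inv_apply k' (M.onW l w), hk, hl]
  have h2 := hw.free (l⁻¹ * k) (by rw [onW_mul_apply, h1, onW_inv_apply])
  rw [inv_mul_eq_one] at h2
  exact h2.symm

/-- The homomorphism `α : K'_{x'} → K_x` with `k' w = α(k')⁻¹ w`. -/
theorem IsRegularPoint.exists_hom (hpair : IsDualPair M M') {w : W} (hw : IsRegularPoint M M' w) :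
    ∃ α : M'.stab (M'.φ w) →* M.stab (M.φ w), ∀ k', M.onW (α k') (M'.onW k' w) = w := by
  choose f hf using fun k' : M'.stab (M'.φ w) => hw.lift k' k'.2
  refine ⟨MonoidHom.mk' (fun k' => ⟨f k', hpair.mem_stab (hf k')⟩) ?_, hf⟩
  intro a b
  refine Subtype.ext (hw.eq_of_onW hpair (hf _) ?_)
  change M.onW (f a * f b) (M'.onW (a * b) w) = w
  rw [onW_mul_apply, onW_mul_apply, hpair.commute (f b), hf b, hf a]

/-! ### The metaplectic double covers -/

theorem exists_base_eq {x : M.E} (k : M.stab x) : ∃ g : M.coverStab x, base g = k := by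
  obtain ⟨z, hz⟩ := IsAlgClosed.exists_pow_nat_eq (LinearMap.det (M.onW k)) (n := 2) two_pos
  have hz0 : z ≠ 0 := by
    rintro rfl
    exact det_onW_ne_zero (k : M.K) (by rw [← hz]; simp)
  exact ⟨⟨(k, Units.mk0 z hz0), k.2, hz⟩, rfl⟩

/-- The nontrivial element `(1, -1)` of the kernel of `K̃_x → K_x`. -/
def coverNeg (x : M.E) : M.coverStab x :=
  ⟨(1, -1), Subgroup.one_mem _, by simp⟩

theorem eq_or_eq_mul_coverNeg {x : M.E} {g h : M.coverStab x} (hgh : base g = base h) :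
    g = h ∨ g = h * coverNeg x := by
  have h1 : g.1.1 = h.1.1 := congrArg Subtype.val hgh
  have h2 : (g.1.2 : ℂ) ^ 2 = (h.1.2 : ℂ) ^ 2 := by
    rw [g.2.2, h.2.2, h1]
  rcases sq_eq_sq_iff_eq_or_eq_neg.1 h2 with h3 | h3
  · exact Or.inl (Subtype.ext (Prod.ext h1 (Units.ext h3)))
  · refine Or.inr (Subtype.ext (Prod.ext ?_ (Units.ext ?_)))
    · simp [coverNeg, h1]
    · simp [coverNeg, h3]

theorem varsigma_mul {x : M.E} (g h : M.coverStab x) :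
    varsigma (g * h) = varsigma g * varsigma h := by
  simp [varsigma, mul_comm]

theorem varsigma_one {x : M.E} : varsigma (1 : M.coverStab x) = 1 := by
  simp [varsigma]

section

variable {V : Type*} [AddCommGroup V] [Module ℂ V]

/-- A genuine representation tensored with `ς` depends on the image in `K_x` only. -/
theorem IsGenuine.varsigma_smul_eq {x : M.E} {χ : Representation ℂ (M.coverStab x) V}
    (hχ : IsGenuine χ) {g h : M.coverStab x} (hgh : base g = base h) :
    varsigma g • χ g = varsigma h • χ h := by
  rcases eq_or_eq_mul_coverNeg hgh with rfl | rfl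
  · rfl
  · rw [map_mul, hχ (coverNeg x) rfl, varsigma_mul]
    simp [varsigma, coverNeg]

/-- The representation `ς ⊗ (ς ⊗ χ) ∘ α` of `K̃'_{x'}` attached to a homomorphism
`α : K'_{x'} → K_x`. -/
theorem IsGenuine.exists_lift {x : M.E} {χ : Representation ℂ (M.coverStab x) V}
    (hχ : IsGenuine χ) {x' : M'.E} (α : M'.stab x' →* M.stab x) :
    ∃ χ' : Representation ℂ (M'.coverStab x') V,
      ∀ (g' : M'.coverStab x') (g : M.coverStab x), base g = α (base g') →
        χ' g' = varsigma g' • (varsigma g • χ g) := by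
  choose s hs using fun k : M.stab x => exists_base_eq k
  refine ⟨
    { toFun := fun g' => varsigma g' • (varsigma (s (α (base g'))) • χ (s (α (base g'))))
      map_one' := ?_
      map_mul' := ?_ }, ?_⟩
  · have h1 : base (s (α (base (1 : M'.coverStab x')))) = base (1 : M.coverStab x) := by
      rw [hs]; exact map_one α
    rw [hχ.varsigma_smul_eq h1, varsigma_one, varsigma_one, map_one, one_smul, one_smul]
  · intro a b
    have h1 : base (s (α (base (a * b)))) = base (s (α (base a)) * s (α (base b))) := by
      rw [hs]
      refine (map_mul α (base a) (base b)).trans ?_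
      nth_rewrite 1 [← hs (α (base a)), ← hs (α (base b))]
      rfl
    rw [hχ.varsigma_smul_eq h1, varsigma_mul, varsigma_mul, map_mul]
    simp only [Module.End.mul_eq_comp, LinearMap.smul_comp, LinearMap.comp_smul, smul_smul]
    congr 1
    ring
  · intro g' g hg
    change varsigma g' • (varsigma (s (α (base g'))) • χ (s (α (base g')))) = _
    rw [hχ.varsigma_smul_eq ((hs _).trans hg.symm)]

/-! ### Regular functions -/

/-- The functions on `K_x` generated by the matrix coordinates of `k` and `k⁻¹`. -/
def matrixFunctions (x : M.E) : Subalgebra ℂ (M.stab x → ℂ) :=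
  Algebra.adjoin ℂ
    ({f | ∃ l : Module.Dual ℂ M.A, f = fun k : M.stab x => l (M.mat k)} ∪
     {f | ∃ l : Module.Dual ℂ M.A, f = fun k : M.stab x => l (M.mat (k⁻¹ : M.stab x))})

theorem matrixFunctions.comp_inv {x : M.E} {f : M.stab x → ℂ} (hf : f ∈ matrixFunctions x) :
    (fun k => f k⁻¹) ∈ matrixFunctions x := by
  induction hf using Algebra.adjoin_induction with
  | mem f hf =>
    rcases hf with ⟨l, rfl⟩ | ⟨l, rfl⟩
    · exact Algebra.subset_adjoin (Or.inr ⟨l, rfl⟩)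
    · refine Algebra.subset_adjoin (Or.inl ⟨l, ?_⟩)
      simp
  | algebraMap r => exact Subalgebra.algebraMap_mem _ r
  | add f g _ _ hf hg => exact add_mem hf hg
  | mul f g _ _ hf hg => exact mul_mem hf hg

theorem IsMatrixGroup.det_onW_mem [FiniteDimensional ℂ W] (hM : IsMatrixGroup M) (x : M.E) :
    (fun k : M.stab x => LinearMap.det (M.onW k)) ∈ matrixFunctions x := by
  obtain ⟨ρ, σ, h⟩ := hM.onW_linear
  let b := Module.finBasis ℂ W
  have h1 : (fun k : M.stab x => LinearMap.det (M.onW k)) =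
      ∑ τ : Equiv.Perm (Fin (Module.finrank ℂ W)), (((Equiv.Perm.sign τ : ℤ) : ℂ)) •
        ∏ i, fun k : M.stab x => LinearMap.toMatrix b b (M.onW k) (τ i) i := by
    funext k
    rw [← LinearMap.det_toMatrix b, Matrix.det_apply']
    simp
  rw [h1]
  refine Subalgebra.sum_mem _ fun τ _ => Subalgebra.smul_mem _
    (Subalgebra.prod_mem _ fun i _ => ?_) _
  have h2 : (fun k : M.stab x => LinearMap.toMatrix b b (M.onW k) (τ i) i) =
      (fun k : M.stab x => (b.coord (τ i) ∘ₗ (LinearMap.applyₗ (b i)) ∘ₗ ρ) (M.mat k)) +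
      (fun k : M.stab x => (b.coord (τ i) ∘ₗ (LinearMap.applyₗ (b i)) ∘ₗ σ)
        (M.mat (k⁻¹ : M.stab x))) := by
    funext k
    simp [LinearMap.toMatrix_apply, h]
  rw [h2]
  exact add_mem (Algebra.subset_adjoin (Or.inl ⟨_, rfl⟩)) (Algebra.subset_adjoin (Or.inr ⟨_, rfl⟩))

/-- A regular function on `K̃_x` is `p + z q` with regular functions `p`, `q` on `K_x`. -/
theorem IsMatrixGroup.exists_decomposition [FiniteDimensional ℂ W] (hM : IsMatrixGroup M) {x : M.E}
    {f : M.coverStab x → ℂ} (hf : f ∈ regularFunctions x) :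
    ∃ p ∈ matrixFunctions x, ∃ q ∈ matrixFunctions x,
      ∀ g, f g = p (base g) + (g.1.2 : ℂ) * q (base g) := by
  have hd := hM.det_onW_mem x
  have hdi := matrixFunctions.comp_inv hd
  have hz : ∀ g : M.coverStab x, (g.1.2 : ℂ) ^ 2 = LinearMap.det (M.onW (base g)) :=
    fun g => g.2.2
  induction hf using Algebra.adjoin_induction with
  | mem f hf =>
    rcases hf with (⟨l, rfl⟩ | ⟨l, rfl⟩) | rfl | rfl
    · exact ⟨fun k => l (M.mat k), Algebra.subset_adjoin (Or.inl ⟨l, rfl⟩), 0, zero_mem _, by simp⟩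
    · exact ⟨fun k => l (M.mat (k⁻¹ : M.stab x)), Algebra.subset_adjoin (Or.inr ⟨l, rfl⟩), 0,
        zero_mem _, by simp⟩
    · exact ⟨0, zero_mem _, 1, one_mem _, by simp⟩
    · refine ⟨0, zero_mem _, _, hdi, fun g => ?_⟩
      have h1 := det_onW_mul_inv ((base g : M.stab x) : M.K)
      rw [← hz g] at h1
      have h2 : (g.1.2 : ℂ) * ((g.1.2⁻¹ : ℂˣ) : ℂ) = 1 := by simp
      simp only [Pi.zero_apply, zero_add]
      change _ = (g.1.2 : ℂ) * LinearMap.det (M.onW (base g : M.K)⁻¹)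
      linear_combination (-((g.1.2⁻¹ : ℂˣ) : ℂ)) * h1 +
        ((g.1.2 : ℂ) * LinearMap.det (M.onW (base g : M.K)⁻¹)) * h2
  | algebraMap r => exact ⟨_, Subalgebra.algebraMap_mem _ r, 0, zero_mem _, by simp⟩
  | add f g _ _ hf hg =>
    obtain ⟨p, hp, q, hq, h⟩ := hf
    obtain ⟨p', hp', q', hq', h'⟩ := hg
    refine ⟨p + p', add_mem hp hp', q + q', add_mem hq hq', fun g => ?_⟩
    simp only [Pi.add_apply, h, h']
    ring
  | mul f g _ _ hf hg =>
    obtain ⟨p, hp, q, hq, h⟩ := hf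
    obtain ⟨p', hp', q', hq', h'⟩ := hg
    refine ⟨p * p' + (fun k : M.stab x => LinearMap.det (M.onW k)) * (q * q'),
      add_mem (mul_mem hp hp') (mul_mem hd (mul_mem hq hq')), p * q' + q * p',
      add_mem (mul_mem hp hq') (mul_mem hq hp'), fun g => ?_⟩
    simp only [Pi.add_apply, Pi.mul_apply, h, h', ← hz]
    ring

/-- For genuine `χ`, the matrix coefficients of `ς ⊗ χ` are regular functions on `K_x`: those of `χ`
are odd in `z`. -/
theorem IsRational.exists_matrixFunction [FiniteDimensional ℂ W] (hM : IsMatrixGroup M) {x : M.E}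
    {χ : Representation ℂ (M.coverStab x) V} (hχ : IsRational χ) (hgen : IsGenuine χ)
    (v : V) (l : Module.Dual ℂ V) :
    ∃ q ∈ matrixFunctions x, ∀ g, varsigma g * l (χ g v) = q (base g) := by
  obtain ⟨p, hp, q, hq, h⟩ := hM.exists_decomposition (hχ v l)
  refine ⟨q, hq, fun g => ?_⟩
  have h1 := h g
  have h2 := h (g * coverNeg x)
  have hb : base (g * coverNeg x) = base g := Subtype.ext (mul_one _)
  have hz : ((g * coverNeg x).1.2 : ℂ) = -(g.1.2 : ℂ) := by simp [coverNeg]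
  rw [map_mul, hgen (coverNeg x) rfl, hb, hz] at h2
  simp only [mul_neg, mul_one, LinearMap.neg_apply, map_neg] at h2
  have h3 : l (χ g v) = (g.1.2 : ℂ) * q (base g) := by
    linear_combination (1 / 2 : ℂ) * h1 - (1 / 2 : ℂ) * h2
  rw [h3, varsigma, inv_mul_cancel_left₀ (Units.ne_zero _)]

theorem matrixFunctions.comp_hom {x : M.E} {x' : M'.E} {α : M'.stab x' →* M.stab x}
    {T S : M'.A →ₗ[ℂ] M.A}
    (hT : ∀ k', M.mat (α k') = T (M'.mat k') + S (M'.mat (k'⁻¹ : M'.stab x')))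
    {q : M.stab x → ℂ} (hq : q ∈ matrixFunctions x) :
    (fun g' : M'.coverStab x' => q (α (base g'))) ∈ regularFunctions x' := by
  have hl : ∀ l : Module.Dual ℂ M'.A, (fun g => l (M'.mat (base g))) ∈ regularFunctions x' :=
    fun l => Algebra.subset_adjoin (Or.inl (Or.inl ⟨l, rfl⟩))
  have hli : ∀ l : Module.Dual ℂ M'.A,
      (fun g => l (M'.mat ((base g)⁻¹ : M'.stab x'))) ∈ regularFunctions x' :=
    fun l => Algebra.subset_adjoin (Or.inl (Or.inr ⟨l, rfl⟩))
  induction hq using Algebra.adjoin_induction with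
  | mem f hf =>
    rcases hf with ⟨l, rfl⟩ | ⟨l, rfl⟩
    · have h := add_mem (hl (l ∘ₗ T)) (hli (l ∘ₗ S))
      convert h using 1
      funext g
      simp [hT]
    · have h := add_mem (hli (l ∘ₗ T)) (hl (l ∘ₗ S))
      convert h using 1
      funext g
      change l (M.mat ((α (base g))⁻¹ : M.stab x)) = _
      rw [← map_inv, hT]
      simp
  | algebraMap r => exact Subalgebra.algebraMap_mem _ r
  | add f g _ _ hf hg => exact add_mem hf hg
  | mul f g _ _ hf hg => exact mul_mem hf hg

theorem IsRational.lift [FiniteDimensional ℂ W] (hM : IsMatrixGroup M) {x : M.E}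
    {χ : Representation ℂ (M.coverStab x) V} (hχ : IsRational χ) (hgen : IsGenuine χ)
    {x' : M'.E} {α : M'.stab x' →* M.stab x}
    {T S : M'.A →ₗ[ℂ] M.A}
    (hT : ∀ k', M.mat (α k') = T (M'.mat k') + S (M'.mat (k'⁻¹ : M'.stab x')))
    {χ' : Representation ℂ (M'.coverStab x') V}
    (hχ' : ∀ (g' : M'.coverStab x') (g : M.coverStab x), base g = α (base g') →
        χ' g' = varsigma g' • (varsigma g • χ g)) : IsRational χ' := by
  intro v l
  obtain ⟨q, hq, h⟩ := hχ.exists_matrixFunction hM hgen v l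
  have h1 : (fun g' => l (χ' g' v)) =
      (fun g' : M'.coverStab x' => ((g'.1.2⁻¹ : ℂˣ) : ℂ)) * fun g' => q (α (base g')) := by
    funext g'
    obtain ⟨g, hg⟩ := exists_base_eq (α (base g'))
    rw [hχ' g' g hg]
    simp only [Pi.mul_apply, ← hg, ← h g]
    simp [varsigma]
  rw [h1]
  exact mul_mem (Algebra.subset_adjoin (Or.inr (Or.inr rfl))) (matrixFunctions.comp_hom hT hq)

theorem IsGenuine.lift {x : M.E} {χ : Representation ℂ (M.coverStab x) V}
    {x' : M'.E} {α : M'.stab x' →* M.stab x} {χ' : Representation ℂ (M'.coverStab x') V}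
    (hχ' : ∀ (g' : M'.coverStab x') (g : M.coverStab x), base g = α (base g') →
        χ' g' = varsigma g' • (varsigma g • χ g)) : IsGenuine χ' := by
  intro g' hg'
  have hb : base g' = 1 := Subtype.ext (congrArg Prod.fst hg')
  rw [hχ' g' 1 (by rw [hb, map_one]; rfl)]
  simp [varsigma, hg']

end

end Member

/-! ### Admissibility of the lift -/

namespace Member

variable {W : Type} [AddCommGroup W] [Module ℂ W] {M M' : Member W}

/-- A one-parameter subgroup of `H` with generator `X`. -/
theorem IsMatrixGroup.exists_oneParameter (hM : IsMatrixGroup M) {H : Subgroup M.K} {X : M.A}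
    (hX : X ∈ M.lieSet H) :
    ∃ κ : ℂ → H, (∀ t, M.mat (κ t) = NormedSpace.exp (t • X)) ∧ (∀ s t, κ (s + t) = κ s * κ t) ∧
      κ 0 = 1 := by
  choose κ hκH hκ using hX
  have hadd : ∀ s t, κ (s + t) = κ s * κ t := fun s t =>
    mat_injective (by rw [mat_mul, hκ, hκ, hκ, hM.exp_add])
  refine ⟨fun t => ⟨κ t, hκH t⟩, hκ, fun s t => Subtype.ext (hadd s t), Subtype.ext ?_⟩
  have h := hadd 0 0
  rw [add_zero] at h
  exact (left_eq_mul.1 h)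

theorem IsMatrixGroup.continuous_matrixFunction (hM : IsMatrixGroup M) {x : M.E} {X : M.A}
    {κ : ℂ → M.stab x} (hκ : ∀ t, M.mat (κ t) = NormedSpace.exp (t • X))
    (hadd : ∀ s t, κ (s + t) = κ s * κ t) (h0 : κ 0 = 1)
    {f : M.stab x → ℂ} (hf : f ∈ matrixFunctions x) :
    Continuous fun t : ℝ => f (κ t) := by
  have := hM.finite
  have := hM.continuousSMul
  induction hf using Algebra.adjoin_induction with
  | mem f hf =>
    rcases hf with ⟨l, rfl⟩ | ⟨l, rfl⟩
    · simp only [hκ]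
      exact (LinearMap.continuous_of_finiteDimensional l).comp (hM.continuous_exp X)
    · have hinv : ∀ t : ℝ, (κ t)⁻¹ = κ ((-t : ℝ) : ℂ) := by
        intro t
        rw [inv_eq_iff_mul_eq_one, ← hadd]
        simp [h0]
      simp only [hinv, hκ]
      exact (LinearMap.continuous_of_finiteDimensional l).comp
        ((hM.continuous_exp X).comp continuous_neg)
  | algebraMap r => exact continuous_const
  | add f g _ _ hf hg => exact hf.add hg
  | mul f g _ _ hf hg => exact hf.mul hg

theorem det_onW_half {x : M.E} {κ : ℂ → M.stab x} (hadd : ∀ s t, κ (s + t) = κ s * κ t) (t : ℝ) :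
    LinearMap.det (M.onW (κ ((t / 2 : ℝ) : ℂ))) ^ 2 = LinearMap.det (M.onW (κ t)) := by
  rw [sq, ← det_onW_mul, ← Subgroup.coe_mul, ← hadd]
  congr 5
  push_cast
  ring

theorem IsMatrixGroup.continuous_det_half [FiniteDimensional ℂ W] (hM : IsMatrixGroup M) {x : M.E}
    {X : M.A} {κ : ℂ → M.stab x} (hκ : ∀ t, M.mat (κ t) = NormedSpace.exp (t • X))
    (hadd : ∀ s t, κ (s + t) = κ s * κ t) (h0 : κ 0 = 1) :
    Continuous fun t : ℝ => LinearMap.det (M.onW (κ ((t / 2 : ℝ) : ℂ))) :=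
  (hM.continuous_matrixFunction hκ hadd h0 (hM.det_onW_mem x)).comp (continuous_id.div_const 2)

/-- `exp X` in `K̃_x` has second coordinate `det (exp (X / 2) | W)`. -/
theorem IsMatrixGroup.snd_of_isCoverExp [FiniteDimensional ℂ W] (hM : IsMatrixGroup M) {x : M.E}
    {X : M.A} {κ : ℂ → M.stab x} (hκ : ∀ t, M.mat (κ t) = NormedSpace.exp (t • X))
    (hadd : ∀ s t, κ (s + t) = κ s * κ t) (h0 : κ 0 = 1) {g : M.coverStab x}
    (hg : IsCoverExp X g) :
    base g = κ 1 ∧ (g.1.2 : ℂ) = LinearMap.det (M.onW (κ (1 / 2))) := by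
  obtain ⟨c, hc, hcont, hc0, rfl⟩ := hg
  have hb : ∀ t : ℝ, base (c t) = κ t := fun t =>
    Subtype.ext (mat_injective ((hc t).trans (hκ t).symm))
  have h := isPreconnected_univ.eq_of_sq_eq hcont.continuousOn
    (hM.continuous_det_half hκ hadd h0).continuousOn
    (fun t _ => by
      change ((c t).1.2 : ℂ) ^ 2 = LinearMap.det (M.onW (κ ((t / 2 : ℝ) : ℂ))) ^ 2
      rw [det_onW_half hadd, ← hb t]
      exact (c t).2.2)
    (fun _ => det_onW_ne_zero _) (Set.mem_univ 0) (by simp [hc0, h0])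
  refine ⟨by simpa using hb 1, ?_⟩
  simpa using h (Set.mem_univ 1)

theorem IsMatrixGroup.exists_isCoverExp [FiniteDimensional ℂ W] (hM : IsMatrixGroup M) {x : M.E}
    {X : M.A} {κ : ℂ → M.stab x} (hκ : ∀ t, M.mat (κ t) = NormedSpace.exp (t • X))
    (hadd : ∀ s t, κ (s + t) = κ s * κ t) (h0 : κ 0 = 1) :
    ∃ g : M.coverStab x, IsCoverExp X g := by
  refine ⟨_, fun t => ⟨(κ t, Units.mk0 _ (det_onW_ne_zero (κ ((t / 2 : ℝ) : ℂ) : M.K))),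
    (κ t).2, det_onW_half hadd t⟩, fun t => hκ t, hM.continuous_det_half hκ hadd h0, ?_, rfl⟩
  refine Subtype.ext (Prod.ext ?_ (Units.ext ?_)) <;> simp [h0]

section

variable {V : Type*} [AddCommGroup V] [Module ℂ V]

/-- The scalar `γ_x (α(k'))` by which `χ` acts is turned into `γ_{x'} (k')` by the two factors `ς`. -/
theorem IsAdmissible.lift [FiniteDimensional ℂ W] (hM : IsMatrixGroup M) (hM' : IsMatrixGroup M')
    (hforms : HasInvariantForms M) (hpair : IsDualPair M M') {w : W}
    (hw : IsRegularPoint M M' w) {χ : Representation ℂ (M.coverStab (M.φ w)) V}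
    (hχ : IsAdmissible χ) {α : M'.stab (M'.φ w) →* M.stab (M.φ w)}
    (hα : ∀ k', M.onW (α k') (M'.onW k' w) = w)
    {χ' : Representation ℂ (M'.coverStab (M'.φ w)) V}
    (hχ' : ∀ (g' : M'.coverStab (M'.φ w)) (g : M.coverStab (M.φ w)), base g = α (base g') →
        χ' g' = varsigma g' • (varsigma g • χ g)) : IsAdmissible χ' := by
  intro X' hX' g' hg' k' hk'
  obtain ⟨κ', hκ', hadd', h0'⟩ := hM'.exists_oneParameter hX'
  obtain ⟨X, hX⟩ := hw.exp_lift X' hX'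
  have hακ : ∀ t, M.mat (α (κ' t)) = NormedSpace.exp (t • X) := by
    intro t
    obtain ⟨k, hk, hkw⟩ := hX t
    rw [← hk, hw.eq_of_onW hpair (hα (κ' t)) (hkw _ (hκ' t))]
  have hXs : X ∈ M.lieSet (M.stab (M.φ w)) := fun t => ⟨α (κ' t), (α (κ' t)).2, hακ t⟩
  have hadd : ∀ s t, α (κ' (s + t)) = α (κ' s) * α (κ' t) := fun s t => by rw [hadd', map_mul]
  have h0 : α (κ' 0) = 1 := by rw [h0', map_one]
  obtain ⟨hb', hz'⟩ := hM'.snd_of_isCoverExp hκ' hadd' h0' hg'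
  obtain ⟨g, hg⟩ := hM.exists_isCoverExp (κ := fun t => α (κ' t)) hακ hadd h0
  obtain ⟨hb, hz⟩ := hM.snd_of_isCoverExp (κ := fun t => α (κ' t)) hακ hadd h0 hg
  have hkk : k' = κ' (1 / 2) := Subtype.ext (mat_injective (hk'.trans (hκ' _).symm))
  -- `k' = exp (X' / 2)` is the square of `exp (X' / 4)`
  have hcmp := hw.gamma_comparison hM.finite hM'.finite hforms hpair (α k') k'
    (α (κ' (1 / 4))) (by
      rw [← Subgroup.coe_mul, ← hadd, hkk]
      norm_num) (hα k')
  rw [hχ' g' g (by rw [hb, hb']), hχ X hXs g hg (α k') (by rw [hkk]; exact hακ _), smul_smul,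
    smul_smul, ← hcmp, varsigma, varsigma, hz, hz', ← hkk]
  have h1 := det_onW_ne_zero (k' : M'.K)
  have h2 := det_onW_ne_zero (α k' : M.K)
  congr 1
  field_simp

/-- The theta lift of an admissible orbit datum through a regular point. -/
theorem IsRegularPoint.thetaLift [FiniteDimensional ℂ W] (hM : IsMatrixGroup M)
    (hM' : IsMatrixGroup M') (hforms : HasInvariantForms M) (hpair : IsDualPair M M')
    {w : W} (hw : IsRegularPoint M M' w) {O : Set M.E}
    {χ : Representation ℂ (M.coverStab (M.φ w)) V} (hχ : IsAdmissibleOrbitDatum O (M.φ w) χ)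
    {O' : Set M'.E} (hO' : IsThetaLiftOrbit O O') (hx' : M'.φ w ∈ O') :
    (∃! χ' : Representation ℂ (M'.coverStab (M'.φ w)) V,
        IsThetaLift w O (M.φ w) χ O' (M'.φ w) χ') ∧
      ∀ χ' : Representation ℂ (M'.coverStab (M'.φ w)) V,
        IsThetaLift w O (M.φ w) χ O' (M'.φ w) χ' → IsAdmissibleOrbitDatum O' (M'.φ w) χ' := by
  obtain ⟨α, hα⟩ := hw.exists_hom hpair
  have hspec : ∀ χ' : Representation ℂ (M'.coverStab (M'.φ w)) V,
      IsThetaLift w O (M.φ w) χ O' (M'.φ w) χ' ↔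
        ∀ (g' : M'.coverStab (M'.φ w)) (g : M.coverStab (M.φ w)), base g = α (base g') →
          χ' g' = varsigma g' • (varsigma g • χ g) := by
    intro χ'
    constructor
    · -- the homomorphism is determined by its defining property
      rintro ⟨-, -, -, -, -, β, hβ, h⟩
      have hβα : β = α := MonoidHom.ext fun k' => Subtype.ext
        (hw.eq_of_onW hpair ((eq_onW_inv_iff _ _ _).1 (hβ k')) (hα k'))
      rwa [hβα] at h
    · intro h
      exact ⟨hO', hχ.mem, hx', rfl, rfl, α, fun k' => (eq_onW_inv_iff _ _ _).2 (hα k'), h⟩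
  obtain ⟨χ₀, hχ₀⟩ := hχ.genuine.exists_lift α
  refine ⟨⟨χ₀, (hspec χ₀).2 hχ₀, fun χ' h => ?_⟩, fun χ' h => ?_⟩
  · refine MonoidHom.ext fun g' => ?_
    obtain ⟨g, hg⟩ := exists_base_eq (α (base g'))
    rw [(hspec χ').1 h g' g hg, hχ₀ g' g hg]
  · have h' := (hspec χ').1 h
    obtain ⟨T, S, hT⟩ := hw.lift_linear
    have hnil : M'.IsNilpotentOrbit O' := by
      refine ⟨hO'.1, ?_⟩
      rw [hO'.2]
      refine ⟨0, ?_, hpair.φ'_zero⟩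
      change M.φ 0 ∈ zariskiClosure O
      rw [hpair.φ_zero]
      exact hχ.nilpotent.2
    exact
      { nilpotent := hnil
        mem := hx'
        finite := hχ.finite
        rational := hχ.rational.lift hM hχ.genuine (T := T) (S := S) (fun k' => hT _ _ (hα k')) h'
        genuine := IsGenuine.lift h'
        admissible := hχ.admissible.lift hM hM' hforms hpair hw hα h' }

end

/-! ### Points over the theta lift of an orbit -/

/-- A polynomial on `𝔭'^*` that is nonzero at one point of `φ' (φ⁻¹ x)` is nonzero somewhere on the
orbit `θ(O)`: the first set lies in the closure of the second. -/
theorem IsThetaLiftOrbit.exists_ne_zero {O : Set M.E} {O' : Set M'.E}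
    (hO' : IsThetaLiftOrbit O O') {w w₁ : W} (hw : M.φ w ∈ O) (hw' : M'.φ w ∈ O')
    (h₁ : M.φ w₁ = M.φ w) {f : M'.E → ℂ}
    (hf : f ∈ Algebra.adjoin ℂ (Set.range fun (l : Module.Dual ℂ M'.E) (e : M'.E) => l e))
    (hne : f (M'.φ w₁) ≠ 0) : ∃ k', f (M'.onP k' (M'.φ w)) ≠ 0 := by
  by_contra! hcon
  have hmem : M'.φ w₁ ∈ zariskiClosure O' := by
    rw [hO'.2]
    refine ⟨w₁, ?_, rfl⟩
    change M.φ w₁ ∈ zariskiClosure O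
    rw [h₁]
    exact fun g _ hg => hg _ hw
  refine hne (hmem f hf fun s hs => ?_)
  obtain ⟨⟨x₀, -, rfl⟩, -⟩ := hO'
  obtain ⟨k, rfl⟩ := hs
  obtain ⟨l, hl⟩ := hw'
  have := hcon (k * l⁻¹)
  rw [← hl, ← Module.End.mul_apply, ← map_mul] at this
  simpa using this

end Member

/-- Determinants of a square matrix that depends linearly on a point are polynomial functions. -/
theorem det_linear_mem_adjoin {E : Type} [AddCommGroup E] [Module ℂ E] {n : Type} [Fintype n]
    [DecidableEq n] (L : E →ₗ[ℂ] Matrix n n ℂ) :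
    (fun e => (L e).det) ∈
      Algebra.adjoin ℂ (Set.range fun (l : Module.Dual ℂ E) (e : E) => l e) := by
  have h1 : (fun e => (L e).det) = ∑ τ : Equiv.Perm n, (((Equiv.Perm.sign τ : ℤ) : ℂ)) •
        ∏ i, fun e : E => L e (τ i) i := by
    funext e
    rw [Matrix.det_apply']
    simp
  rw [h1]
  refine Subalgebra.sum_mem _ fun τ _ => Subalgebra.smul_mem _
      (Subalgebra.prod_mem _ fun i _ => ?_) _
  let l : Module.Dual ℂ E :=
    { toFun := fun e => L e (τ i) i
      map_add' := by intro a b; simp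
      map_smul' := by intro c a; simp }
  exact Algebra.subset_adjoin ⟨l, rfl⟩

/-! ### Lie algebras of matrix groups -/

namespace Member

variable {W : Type} [AddCommGroup W] [Module ℂ W] {M : Member W}

/-- The exponential `exp X` as a unit, with inverse `exp (-X)`. -/
noncomputable def IsMatrixGroup.expUnit (hM : IsMatrixGroup M) (X : M.A) : M.Aˣ :=
  have h : ∀ Y : M.A, NormedSpace.exp Y * NormedSpace.exp (-Y) = 1 := fun Y => by
    have h1 := hM.exp_add Y 1 (-1)
    rw [add_neg_cancel, zero_smul, NormedSpace.exp_zero, one_smul, neg_one_smul] at h1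
    exact h1.symm
  ⟨NormedSpace.exp X, NormedSpace.exp (-X), h X, by simpa using h (-X)⟩

theorem IsMatrixGroup.mem_lieSet_iff (hM : IsMatrixGroup M) {H : Subgroup M.K} {X : M.A} :
    X ∈ M.lieSet H ↔ ∀ t : ℂ, ∃ h : hM.expUnit (t • X) ∈ M.K, ⟨hM.expUnit (t • X), h⟩ ∈ H := by
  refine forall_congr' fun t => ?_
  constructor
  · rintro ⟨⟨u, hu⟩, hk, h⟩
    obtain rfl : u = hM.expUnit (t • X) := Units.ext h
    exact ⟨hu, hk⟩
  · rintro ⟨h, hH⟩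
    exact ⟨_, hH, rfl⟩

/-- If the set `lieSet H` is closed under addition, then it is the Lie algebra of `H`: it is closed
under scalars by definition. -/
theorem mem_lieAlg_iff {H : Subgroup M.K}
    (hadd : ∀ X ∈ M.lieSet H, ∀ Y ∈ M.lieSet H, X + Y ∈ M.lieSet H) {X : M.A} :
    X ∈ M.lieAlg H ↔ X ∈ M.lieSet H := by
  let S : Submodule ℂ M.A :=
    { carrier := M.lieSet H
      add_mem' := fun {a b} ha hb => hadd a ha b hb
      zero_mem' := fun t => ⟨1, H.one_mem, by simp [mat, NormedSpace.exp_zero]⟩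
      smul_mem' := fun c X hX t => by
        rw [smul_smul]
        exact hX _ }
  change X ∈ Submodule.span ℂ (S : Set M.A) ↔ X ∈ S
  rw [Submodule.span_eq]

end Member

/-! ### Intertwining matrices -/

section MatrixLemmas

variable {l m n : Type} [Fintype l] [Fintype m] [Fintype n]

theorem Matrix.forall_exp_fix_iff [DecidableEq m] [DecidableEq n] {a : Matrix m m ℂ}
    {b : Matrix n n ℂ} {y : Matrix m n ℂ} :
    (∀ t : ℂ, NormedSpace.exp (t • a) * y * NormedSpace.exp (t • b) = y) ↔
      a * y = -(y * b) := by
  rw [← Matrix.mul_neg, ← Matrix.forall_exp_smul_mul_eq_iff]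
  refine forall_congr' fun t => ?_
  rw [smul_neg]
  constructor
  · intro h
    nth_rewrite 2 [← h]
    rw [Matrix.mul_assoc _ (NormedSpace.exp _) (NormedSpace.exp _), Matrix.exp_mul_exp_neg,
      Matrix.mul_one]
  · intro h
    rw [h, Matrix.mul_assoc, Matrix.exp_neg_mul_exp, Matrix.mul_one]

theorem Matrix.exp_smul_transpose [DecidableEq m] (t : ℂ) (a : Matrix m m ℂ) :
    (NormedSpace.exp (t • a))ᵀ = NormedSpace.exp (t • aᵀ) := by
  rw [← Matrix.transpose_smul, Matrix.exp_transpose]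

theorem Matrix.exp_neg_smul [DecidableEq m] (t : ℂ) (a : Matrix m m ℂ) :
    NormedSpace.exp (-(t • a)) = NormedSpace.exp (t • -a) := by
  rw [smul_neg]

/-- Two endomorphisms intertwined by a product `A B` are both intertwined with an endomorphism of
the middle space, if `A` is injective and `B` is surjective. -/
theorem Matrix.exists_intertwining [DecidableEq n] {a : Matrix l l ℂ} {b : Matrix m m ℂ}
    {A : Matrix l n ℂ} {B : Matrix n m ℂ} {L : Matrix n l ℂ} {R : Matrix m n ℂ} (hL : L * A = 1)
    (hR : B * R = 1) (h : a * (A * B) = A * B * b) : a * A = A * (L * a * A) ∧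
      L * a * A * B = B * b := by
  have h1 : a * A = A * (B * b * R) := by
    calc a * A = a * (A * B) * R := by
          rw [Matrix.mul_assoc a, Matrix.mul_assoc A, hR, Matrix.mul_one]
      _ = A * (B * b * R) := by rw [h]; simp only [Matrix.mul_assoc]
  have h2 : L * a * A = B * b * R := by
    rw [Matrix.mul_assoc, h1, ← Matrix.mul_assoc, hL, Matrix.one_mul]
  refine ⟨by rw [h2, h1], ?_⟩
  calc L * a * A * B = L * (a * (A * B)) := by simp only [Matrix.mul_assoc]
    _ = L * A * (B * b) := by rw [h]; simp only [Matrix.mul_assoc]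
    _ = B * b := by rw [hL, Matrix.one_mul]

/-- The group version of `Matrix.exists_intertwining`. -/
theorem Matrix.exists_intertwining_unit [DecidableEq l] [DecidableEq m] [DecidableEq n]
    {a a' : Matrix l l ℂ} {b b' : Matrix m m ℂ} {A : Matrix l n ℂ} {B : Matrix n m ℂ}
    {L : Matrix n l ℂ} {R : Matrix m n ℂ} (hL : L * A = 1) (hR : B * R = 1) (ha : a' * a = 1)
    (hb : b * b' = 1) (h : a * (A * B) = A * B * b) :
    ∃ z : (Matrix n n ℂ)ˣ, a * A = A * z.val ∧ z.val * B = B * b := by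
  have h' : a' * (A * B) = A * B * b' := by
    calc a' * (A * B) = a' * (A * B * b) * b' := by
          rw [Matrix.mul_assoc a', Matrix.mul_assoc _ b, hb, Matrix.mul_one]
      _ = A * B * b' := by rw [← h, ← Matrix.mul_assoc a', ha, Matrix.one_mul]
  obtain ⟨e1, e2⟩ := Matrix.exists_intertwining hL hR h
  obtain ⟨e3, -⟩ := Matrix.exists_intertwining hL hR h'
  have hz : L * a' * A * (L * a * A) = 1 := by
    rw [Matrix.mul_assoc (L * a'), ← e1, Matrix.mul_assoc L, ← Matrix.mul_assoc a', ha,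
      Matrix.one_mul, hL]
  exact ⟨⟨_, _, mul_eq_one_comm.1 hz, hz⟩, e1, e2⟩

end MatrixLemmas

/-! ### The groups `GL_n` and the products of isometry groups -/

section Pairs

variable {n a b : Type} [Fintype n] [DecidableEq n] [Fintype a] [DecidableEq a] [Fintype b]
  [DecidableEq b] {F : Matrix a a ℂ} {F' : Matrix b b ℂ} {p : Submodule ℂ (Matrix n n ℂ)}

theorem Matrix.exp_prod_add_smul (X : Matrix a a ℂ × Matrix b b ℂ) (s t : ℂ) :
    NormedSpace.exp ((s + t) • X) = NormedSpace.exp (s • X) * NormedSpace.exp (t • X) := by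
  rw [Matrix.exp_prod, Matrix.exp_prod, Matrix.exp_prod]
  exact Prod.ext (Matrix.exp_add_smul _ _ _) (Matrix.exp_add_smul _ _ _)

theorem Matrix.continuous_exp_prod_smul (X : Matrix a a ℂ × Matrix b b ℂ) :
    Continuous fun t : ℝ => NormedSpace.exp ((t : ℂ) • X) := by
  simp only [Matrix.exp_prod]
  exact (Matrix.continuous_exp_smul X.1).prodMk (Matrix.continuous_exp_smul X.2)

theorem glMember_isMatrixGroup : (glMember n a b F F' p).IsMatrixGroup where
  finite := inferInstanceAs (FiniteDimensional ℂ (Matrix n n ℂ))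
  continuousSMul := inferInstanceAs (ContinuousSMul ℂ (Matrix n n ℂ))
  exp_add := Matrix.exp_add_smul
  continuous_exp := Matrix.continuous_exp_smul
  onW_linear := by
    let ρ : Matrix n n ℂ →ₗ[ℂ] (Matrix a n ℂ × Matrix b n ℂ →ₗ[ℂ] Matrix a n ℂ × Matrix b n ℂ) :=
      LinearMap.mk₂ ℂ (fun k w => (0, w.2 * kᵀ)) (by intro k l w; simp [Matrix.mul_add])
        (by intro c k w; simp) (by intro k w v; simp [Matrix.add_mul]) (by intro c k w; simp)
    let σ : Matrix n n ℂ →ₗ[ℂ] (Matrix a n ℂ × Matrix b n ℂ →ₗ[ℂ] Matrix a n ℂ × Matrix b n ℂ) :=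
      LinearMap.mk₂ ℂ (fun k w => (w.1 * k, 0)) (by intro k l w; simp [Matrix.mul_add])
        (by intro c k w; simp) (by intro k w v; simp [Matrix.add_mul]) (by intro c k w; simp)
    exact ⟨ρ, σ, fun k => LinearMap.ext fun w => Prod.ext (zero_add _).symm (add_zero _).symm⟩

theorem isoMember_isMatrixGroup : (isoMember n a b F F').IsMatrixGroup where
  finite := inferInstanceAs (FiniteDimensional ℂ (Matrix a a ℂ × Matrix b b ℂ))
  continuousSMul := inferInstanceAs (ContinuousSMul ℂ (Matrix a a ℂ × Matrix b b ℂ))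
  exp_add := Matrix.exp_prod_add_smul
  continuous_exp := Matrix.continuous_exp_prod_smul
  onW_linear := by
    let ρ : Matrix a a ℂ × Matrix b b ℂ →ₗ[ℂ]
        (Matrix a n ℂ × Matrix b n ℂ →ₗ[ℂ] Matrix a n ℂ × Matrix b n ℂ) :=
      LinearMap.mk₂ ℂ (fun k w => (k.1 * w.1, k.2 * w.2))
        (by intro k l w; simp [Matrix.add_mul]) (by intro c k w; simp)
        (by intro k w v; simp [Matrix.mul_add]) (by intro c k w; simp)
    exact ⟨ρ, 0, fun k => LinearMap.ext fun w => (add_zero _).symm⟩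

theorem glMember_mem_lieSet_stab {s : Matrix n n ℂ × Matrix n n ℂ} {X : Matrix n n ℂ} :
    X ∈ (glMember n a b F F' p).lieSet ((glMember n a b F F' p).stab s) ↔
      Xᵀ * s.1 = -(s.1 * X) ∧ X * s.2 = -(s.2 * Xᵀ) := by
  have h : (∀ t : ℂ, ((NormedSpace.exp (-(t • X)))ᵀ * s.1 * NormedSpace.exp (-(t • X)),
      NormedSpace.exp (t • X) * s.2 * (NormedSpace.exp (t • X))ᵀ) = s) ↔
      Xᵀ * s.1 = -(s.1 * X) ∧ X * s.2 = -(s.2 * Xᵀ) := by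
    simp only [Prod.ext_iff, Matrix.exp_neg_smul, Matrix.exp_smul_transpose, forall_and,
      Matrix.forall_exp_fix_iff]
    simp [neg_eq_iff_eq_neg]
  refine Iff.trans (glMember_isMatrixGroup.mem_lieSet_iff.trans ?_) h
  exact forall_congr' fun t => ⟨fun ⟨_, h⟩ => h, fun h => ⟨trivial, h⟩⟩

theorem glMember_mem_lieAlg_top (X : Matrix n n ℂ) :
    X ∈ (glMember n a b F F' p).lieAlg ⊤ :=
  Submodule.subset_span (glMember_isMatrixGroup.mem_lieSet_iff.2 fun _ => ⟨trivial, trivial⟩)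

theorem glMember_mem_lieAlg_stab {s : Matrix n n ℂ × Matrix n n ℂ} {X : Matrix n n ℂ} :
    X ∈ (glMember n a b F F' p).lieAlg ((glMember n a b F F' p).stab s) ↔
      Xᵀ * s.1 = -(s.1 * X) ∧ X * s.2 = -(s.2 * Xᵀ) := by
  have hadd : ∀ X Y : Matrix n n ℂ, (Xᵀ * s.1 = -(s.1 * X) ∧ X * s.2 = -(s.2 * Xᵀ)) →
      (Yᵀ * s.1 = -(s.1 * Y) ∧ Y * s.2 = -(s.2 * Yᵀ)) →
      (X + Y)ᵀ * s.1 = -(s.1 * (X + Y)) ∧ (X + Y) * s.2 = -(s.2 * (X + Y)ᵀ) := by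
    intro X Y hX hY
    simp [Matrix.add_mul, Matrix.mul_add, hX, hY, add_comm]
  exact (Member.mem_lieAlg_iff fun X hX Y hY => glMember_mem_lieSet_stab.2
    (hadd X Y (glMember_mem_lieSet_stab.1 hX) (glMember_mem_lieSet_stab.1 hY))).trans
    glMember_mem_lieSet_stab

theorem isoMember_mem_lieSet_stab {y : Matrix a b ℂ} {X : Matrix a a ℂ × Matrix b b ℂ} :
    X ∈ (isoMember n a b F F').lieSet ((isoMember n a b F F').stab y) ↔
      (X.1ᵀ * F = -(F * X.1) ∧ X.2ᵀ * F' = -(F' * X.2)) ∧ X.1 * y = -(y * X.2ᵀ) := by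
  have h : (∀ t : ℂ, (((NormedSpace.exp (t • X)).1ᵀ * F * (NormedSpace.exp (t • X)).1 = F) ∧
      ((NormedSpace.exp (t • X)).2ᵀ * F' * (NormedSpace.exp (t • X)).2 = F')) ∧
      (NormedSpace.exp (t • X)).1 * y * (NormedSpace.exp (t • X)).2ᵀ = y) ↔
      (X.1ᵀ * F = -(F * X.1) ∧ X.2ᵀ * F' = -(F' * X.2)) ∧ X.1 * y = -(y * X.2ᵀ) := by
    simp only [Matrix.exp_prod, Prod.smul_fst, Prod.smul_snd, Matrix.exp_smul_transpose, forall_and,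
      Matrix.forall_exp_fix_iff]
  refine Iff.trans (isoMember_isMatrixGroup.mem_lieSet_iff.trans ?_) h
  exact forall_congr' fun t => ⟨fun ⟨h1, h2⟩ => ⟨h1, h2⟩, fun h => ⟨h.1, h.2⟩⟩

theorem isoMember_mem_lieAlg_stab {y : Matrix a b ℂ} {X : Matrix a a ℂ × Matrix b b ℂ} :
    X ∈ (isoMember n a b F F').lieAlg ((isoMember n a b F F').stab y) ↔
      (X.1ᵀ * F = -(F * X.1) ∧ X.2ᵀ * F' = -(F' * X.2)) ∧ X.1 * y = -(y * X.2ᵀ) := by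
  have hadd : ∀ X Y : Matrix a a ℂ × Matrix b b ℂ,
      ((X.1ᵀ * F = -(F * X.1) ∧ X.2ᵀ * F' = -(F' * X.2)) ∧ X.1 * y = -(y * X.2ᵀ)) →
      ((Y.1ᵀ * F = -(F * Y.1) ∧ Y.2ᵀ * F' = -(F' * Y.2)) ∧ Y.1 * y = -(y * Y.2ᵀ)) →
      (((X + Y).1ᵀ * F = -(F * (X + Y).1) ∧ (X + Y).2ᵀ * F' = -(F' * (X + Y).2)) ∧
        (X + Y).1 * y = -(y * (X + Y).2ᵀ)) := by
    intro X Y hX hY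
    simp [Matrix.add_mul, Matrix.mul_add, hX, hY, add_comm]
  exact (Member.mem_lieAlg_iff fun X hX Y hY => isoMember_mem_lieSet_stab.2
    (hadd X Y (isoMember_mem_lieSet_stab.1 hX) (isoMember_mem_lieSet_stab.1 hY))).trans
    isoMember_mem_lieSet_stab

/-- The Lie algebra of the whole group is that of the stabilizer of `0`. -/
theorem isoMember_mem_lieAlg_top {X : Matrix a a ℂ × Matrix b b ℂ} :
    X ∈ (isoMember n a b F F').lieAlg ⊤ ↔
      X.1ᵀ * F = -(F * X.1) ∧ X.2ᵀ * F' = -(F' * X.2) := by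
  have h0 : (isoMember n a b F F').stab (0 : Matrix a b ℂ) = ⊤ :=
    eq_top_iff.2 fun k _ => map_zero ((isoMember n a b F F').onP k)
  have h := isoMember_mem_lieAlg_stab (n := n) (F := F) (F' := F') (y := 0) (X := X)
  simpa only [h0, Matrix.mul_zero, Matrix.zero_mul, neg_zero, and_true] using h

end Pairs

/-! ### Symmetric and alternating forms -/

section Forms

variable {m n a : Type} [Fintype m] [DecidableEq m] [Fintype n] [DecidableEq n] [Fintype a]
  [DecidableEq a]

/-- `F` is the matrix of an `ε`-symmetric bilinear form, normalized as the identity matrix and the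
matrix `J` are: it is real with `F² = ε`. -/
structure IsSignedForm (ε : ℂ) (F : Matrix a a ℂ) : Prop where
  sign : ε * ε = 1
  transpose : Fᵀ = ε • F
  conjTranspose : Fᴴ = ε • F
  mul_self : F * F = ε • 1

theorem isSignedForm_one : IsSignedForm 1 (1 : Matrix a a ℂ) := by
  constructor <;> simp

theorem isSignedForm_Jmat (n : ℕ) : IsSignedForm (-1) (Jmat n) := by
  constructor
  · norm_num
  · simp [Jmat, Matrix.fromBlocks_transpose, Matrix.fromBlocks_neg]
  · simp [Jmat, Matrix.fromBlocks_conjTranspose, Matrix.fromBlocks_neg]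
  · simp [Jmat, Matrix.fromBlocks_multiply, ← Matrix.fromBlocks_one, Matrix.fromBlocks_neg]

namespace IsSignedForm

variable {ε : ℂ} {F : Matrix a a ℂ}

theorem mul_mul_self (hF : IsSignedForm ε F) (x : Matrix a m ℂ) : F * (F * x) = ε • x := by
  rw [← Matrix.mul_assoc, hF.mul_self, Matrix.smul_mul, Matrix.one_mul]

theorem inv_mul (hF : IsSignedForm ε F) : ε • F * F = 1 := by
  rw [Matrix.smul_mul, hF.mul_self, smul_smul, hF.sign, one_smul]

theorem mul_inv (hF : IsSignedForm ε F) : F * (ε • F) = 1 := by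
  rw [Matrix.mul_smul, hF.mul_self, smul_smul, hF.sign, one_smul]

/-- The differential of `A ↦ Aᵀ F A` at an injective `A` is surjective. -/
theorem exists_tangent (hF : IsSignedForm ε F) {A : Matrix a n ℂ} {L : Matrix n a ℂ}
    (hL : L * A = 1) {S : Matrix n n ℂ} :
    Sᵀ = ε • S ↔ ∃ v : Matrix a n ℂ, vᵀ * F * A + Aᵀ * F * v = S := by
  have hL' : Aᵀ * Lᵀ = 1 := by rw [← Matrix.transpose_mul, hL, Matrix.transpose_one]
  constructor
  · intro hS
    have h1 : Aᵀ * F * ((ε / 2) • (F * (Lᵀ * S))) = (1 / 2 : ℂ) • S := by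
      rw [Matrix.mul_smul, Matrix.mul_assoc, hF.mul_mul_self, Matrix.mul_smul, ← Matrix.mul_assoc,
        hL', Matrix.one_mul, smul_smul]
      congr 1
      linear_combination (1 / 2 : ℂ) * hF.sign
    have h2 : ((ε / 2) • (F * (Lᵀ * S)))ᵀ * F * A = (1 / 2 : ℂ) • S := by
      have h3 := congrArg Matrix.transpose h1
      rw [Matrix.transpose_mul, Matrix.transpose_mul, hF.transpose, Matrix.transpose_transpose,
        Matrix.transpose_smul (1 / 2 : ℂ), hS, Matrix.smul_mul, Matrix.mul_smul,
        ← Matrix.mul_assoc] at h3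
      have h4 := congrArg (fun x => ε • x) h3
      simp only [smul_smul, hF.sign, one_smul] at h4
      rw [h4]
      congr 1
      linear_combination (1 / 2 : ℂ) * hF.sign
    refine ⟨_, (congrArg₂ (· + ·) h2 h1).trans ?_⟩
    rw [← add_smul]
    norm_num
  · rintro ⟨v, rfl⟩
    simp only [Matrix.transpose_add, Matrix.transpose_mul, Matrix.transpose_transpose, hF.transpose,
      Matrix.mul_smul, Matrix.smul_mul, smul_add, Matrix.mul_assoc]
    rw [add_comm]

/-- At an injective `A`, the kernel of the differential of `A ↦ Aᵀ F A` consists of the velocities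
of `A` under the Lie algebra of the isometry group of `F`. -/
theorem exists_skew_mul_eq (hF : IsSignedForm ε F) {A : Matrix a n ℂ} {L : Matrix n a ℂ}
    (hL : L * A = 1) {v : Matrix a n ℂ} :
    vᵀ * F * A + Aᵀ * F * v = 0 ↔ ∃ X : Matrix a a ℂ, Xᵀ * F = -(F * X) ∧ X * A = v := by
  have hL' : Aᵀ * Lᵀ = 1 := by rw [← Matrix.transpose_mul, hL, Matrix.transpose_one]
  constructor
  · intro h
    -- the candidate for `F X` is a matrix `Z` with `Zᵀ = -ε Z` and `Z A = F v`
    set c := F * v with hc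
    have hcA : cᵀ * A = -(ε • (Aᵀ * c)) := by
      rw [hc, Matrix.transpose_mul, hF.transpose, Matrix.mul_smul, Matrix.smul_mul, ← smul_neg,
        eq_neg_of_add_eq_zero_left h, Matrix.mul_assoc]
    let Z := c * L - ε • (Lᵀ * cᵀ) + ε • (Lᵀ * (cᵀ * A) * L)
    have hZA : Z * A = c := by
      simp only [Z, Matrix.add_mul, Matrix.sub_mul, Matrix.smul_mul, Matrix.mul_assoc, hL,
        Matrix.mul_one]
      abel
    have hZt : Zᵀ = -(ε • Z) := by
      simp only [Z, Matrix.transpose_add, Matrix.transpose_sub, Matrix.transpose_smul,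
        Matrix.transpose_mul, Matrix.transpose_transpose]
      have h1 : Aᵀ * c = -(ε • (cᵀ * A)) := by
        rw [hcA, smul_neg, smul_smul, hF.sign, one_smul, neg_neg]
      rw [h1]
      simp only [smul_add, smul_sub, smul_smul, hF.sign, one_smul, Matrix.mul_neg, Matrix.neg_mul,
        Matrix.mul_smul, Matrix.smul_mul, smul_neg, Matrix.mul_assoc]
      abel
    refine ⟨ε • (F * Z), ?_, ?_⟩
    · rw [Matrix.transpose_smul, Matrix.transpose_mul, hF.transpose, hZt, Matrix.mul_smul F,
        hF.mul_mul_self]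
      simp only [Matrix.smul_mul, Matrix.neg_mul, Matrix.mul_smul, Matrix.mul_assoc, hF.mul_self,
        smul_smul, smul_neg, hF.sign, one_smul, Matrix.mul_one]
    · rw [Matrix.smul_mul, Matrix.mul_assoc, hZA, hc, hF.mul_mul_self, smul_smul, hF.sign, one_smul]
  · rintro ⟨X, hX, rfl⟩
    rw [Matrix.transpose_mul, Matrix.mul_assoc Aᵀ, hX]
    simp [Matrix.mul_assoc]

/-- An isometry of the form `Aᵀ F A` induced from a surjection `A` comes from an isometry of `F`. -/
theorem exists_isometry (hF : IsSignedForm ε F) {A : Matrix a n ℂ} {R : Matrix n a ℂ}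
    (hR : A * R = 1) {k k' : Matrix n n ℂ} (hkk' : k' * k = 1)
    (h : kᵀ * (Aᵀ * F * A) = Aᵀ * F * A * k') :
    ∃ g : Matrix a a ℂ, gᵀ * F * g = F ∧ g * A = A * k := by
  have hR' : Rᵀ * Aᵀ = 1 := by rw [← Matrix.transpose_mul, hR, Matrix.transpose_one]
  have hFA : F * A * (R * (ε • F)) = 1 := by
    rw [Matrix.mul_assoc, ← Matrix.mul_assoc A, hR, Matrix.one_mul, hF.mul_inv]
  obtain ⟨h1, h2⟩ := Matrix.exists_intertwining hR' hFA (a := kᵀ) (b := k')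
    (by rw [← Matrix.mul_assoc Aᵀ]; exact h)
  set Z := Rᵀ * kᵀ * Aᵀ
  have h3 : Zᵀ * A = A * k := by
    have := congrArg Matrix.transpose h1
    simpa [Matrix.transpose_mul] using this.symm
  refine ⟨Zᵀ, ?_, h3⟩
  have h4 : Zᵀᵀ * F * Zᵀ * A = F * A := by
    rw [Matrix.transpose_transpose, Matrix.mul_assoc, h3, ← Matrix.mul_assoc, Matrix.mul_assoc Z,
        h2,
      Matrix.mul_assoc _ k', hkk', Matrix.mul_one]
  have h5 := congrArg (fun x => x * R) h4
  simpa [Matrix.mul_assoc, hR] using h5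

/-- The Lie algebra version of `IsSignedForm.exists_isometry`. -/
theorem exists_skew (hF : IsSignedForm ε F) {A : Matrix a n ℂ} {R : Matrix n a ℂ}
    (hR : A * R = 1) {X : Matrix n n ℂ} :
    Xᵀ * (Aᵀ * F * A) = -(Aᵀ * F * A * X) ↔
    ∃ Y : Matrix a a ℂ, Yᵀ * F = -(F * Y) ∧ Y * A = A * X := by
  have hR' : Rᵀ * Aᵀ = 1 := by rw [← Matrix.transpose_mul, hR, Matrix.transpose_one]
  have hFA : F * A * (R * (ε • F)) = 1 := by
    rw [Matrix.mul_assoc, ← Matrix.mul_assoc A, hR, Matrix.one_mul, hF.mul_inv]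
  constructor
  · intro h
    obtain ⟨h1, h2⟩ := Matrix.exists_intertwining hR' hFA (a := Xᵀ) (b := -X)
      (by rw [← Matrix.mul_assoc Aᵀ, Matrix.mul_neg]; exact h)
    set Z := Rᵀ * Xᵀ * Aᵀ
    have h3 : Zᵀ * A = A * X := by
      have := congrArg Matrix.transpose h1
      simpa [Matrix.transpose_mul] using this.symm
    refine ⟨Zᵀ, ?_, h3⟩
    rw [Matrix.transpose_transpose]
    have h4 : Z * F * A = -(F * Zᵀ) * A := by
      rw [Matrix.mul_assoc, h2, Matrix.neg_mul, Matrix.mul_assoc F Zᵀ, h3]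
      simp [Matrix.mul_assoc]
    have h5 := congrArg (fun x => x * R) h4
    simpa [Matrix.mul_assoc, hR] using h5
  · rintro ⟨Y, hY, h⟩
    have h1 : Xᵀ * Aᵀ = Aᵀ * Yᵀ := by rw [← Matrix.transpose_mul, ← h, Matrix.transpose_mul]
    calc Xᵀ * (Aᵀ * F * A) = Xᵀ * Aᵀ * F * A := by simp only [Matrix.mul_assoc]
      _ = Aᵀ * (Yᵀ * F) * A := by rw [h1]; simp only [Matrix.mul_assoc]
      _ = -(Aᵀ * F * (Y * A)) := by rw [hY]; simp [Matrix.mul_assoc]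
      _ = _ := by rw [h]; simp only [Matrix.mul_assoc]

theorem mul_eq_one_of_isometry (hF : IsSignedForm ε F) {g : Matrix a a ℂ} (hg : gᵀ * F * g = F) :
    (ε • (F * gᵀ * F)) * g = 1 := by
  rw [Matrix.smul_mul, Matrix.mul_assoc, Matrix.mul_assoc, ← Matrix.mul_assoc gᵀ, hg, hF.mul_self,
    smul_smul, hF.sign, one_smul]

/-- An isometry of `F` as a unit, with inverse `F⁻¹ gᵀ F`, where `F⁻¹ = ε F`. -/
def unitOfIsometry (hF : IsSignedForm ε F) {g : Matrix a a ℂ} (hg : gᵀ * F * g = F) :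
    (Matrix a a ℂ)ˣ :=
  ⟨g, ε • (F * gᵀ * F), mul_eq_one_comm.1 (hF.mul_eq_one_of_isometry hg),
    hF.mul_eq_one_of_isometry hg⟩

/-- Given a hyperbolic subspace `U, U'` of dimension `2 |n|`, every `ε`-symmetric `S` is `Aᵀ F A` for
an injective `A`. -/
theorem exists_gram_eq (hF : IsSignedForm ε F) {U U' : Matrix a n ℂ} (hU : Uᵀ * F * U = 0)
    (hU' : U'ᵀ * F * U' = 0) (hUU' : Uᵀ * F * U' = 1) {S : Matrix n n ℂ} (hS : Sᵀ = ε • S) :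
    ∃ (A : Matrix a n ℂ) (L : Matrix n a ℂ), L * A = 1 ∧ Aᵀ * F * A = S := by
  have hU'U : U'ᵀ * F * U = ε • 1 := by
    have h := congrArg Matrix.transpose hUU'
    rw [Matrix.transpose_mul, Matrix.transpose_mul, Matrix.transpose_transpose, hF.transpose,
      Matrix.transpose_one, Matrix.smul_mul, Matrix.mul_smul, ← Matrix.mul_assoc] at h
    rw [← h, smul_smul, hF.sign, one_smul]
  refine ⟨U + U' * ((1 / 2 : ℂ) • S), ε • (U'ᵀ * F), ?_, ?_⟩
  · rw [Matrix.smul_mul, Matrix.mul_add, hU'U, ← Matrix.mul_assoc, hU', Matrix.zero_mul, add_zero,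
      smul_smul, hF.sign, one_smul]
  · rw [Matrix.transpose_add, Matrix.transpose_mul, Matrix.transpose_smul, hS]
    simp only [Matrix.add_mul, Matrix.mul_add, ← Matrix.mul_assoc, hU, hUU']
    rw [Matrix.mul_assoc _ U'ᵀ F, Matrix.mul_assoc _ (U'ᵀ * F), hU'U,
      Matrix.mul_assoc _ (U'ᵀ * F) U', hU']
    simp only [Matrix.one_mul, zero_add, Matrix.zero_mul, Matrix.mul_zero, Matrix.mul_smul,
        Matrix.mul_one,
      smul_smul, smul_zero, add_zero]
    rw [← add_smul]
    have h : ε * (1 / 2 * ε) + 1 / 2 = 1 := by linear_combination (1 / 2 : ℂ) * hF.sign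
    rw [h, one_smul]

end IsSignedForm

/-- `A X = -a` and `X B = b` have a common solution as soon as they are compatible, if `A` is
surjective and `B` is injective. -/
theorem Matrix.exists_simultaneous_solution {l : Type} [Fintype l] [DecidableEq l]
    {A a : Matrix m n ℂ} {B b : Matrix n l ℂ}
    {R : Matrix n m ℂ} {L : Matrix l n ℂ} (hR : A * R = 1) (hL : L * B = 1) :
    a * B + A * b = 0 ↔ ∃ X : Matrix n n ℂ, -(A * X) = a ∧ X * B = b := by
  constructor
  · intro h
    refine ⟨-(R * a) + (b * L - R * A * b * L), ?_, ?_⟩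
    · simp only [Matrix.mul_add, Matrix.mul_sub, Matrix.mul_neg, ← Matrix.mul_assoc, hR,
        Matrix.one_mul, sub_self, add_zero, neg_neg]
    · simp only [Matrix.add_mul, Matrix.sub_mul, Matrix.neg_mul, Matrix.mul_assoc, hL,
        Matrix.mul_one]
      rw [eq_neg_of_add_eq_zero_left h]
      simp
  · rintro ⟨X, rfl, rfl⟩
    simp [Matrix.mul_assoc]

/-- Coordinate embeddings: columns of the identity matrix. -/
theorem Matrix.exists_coordinate_embedding {c : Type} [Fintype c] [DecidableEq c]
    (f : m ⊕ n ↪ c) :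
    ∃ (P : Matrix c m ℂ) (Q : Matrix c n ℂ),
      Pᵀ * P = 1 ∧ Qᵀ * Q = 1 ∧ Pᵀ * Q = 0 ∧ Qᵀ * P = 0 := by
  refine ⟨(1 : Matrix c c ℂ).submatrix id (f ∘ Sum.inl),
    (1 : Matrix c c ℂ).submatrix id (f ∘ Sum.inr), ?_, ?_, ?_, ?_⟩ <;>
  · simp only [Matrix.transpose_submatrix, Matrix.transpose_one]
    rw [← Matrix.submatrix_mul _ _ _ _ _ Function.bijective_id, Matrix.one_mul]
    ext i j
    simp [Matrix.one_apply]

end Forms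

/-! ### Duality of `GL_n` with products of isometry groups -/

section Pairs

variable {n a b : Type} [Fintype n] [DecidableEq n] [Fintype a] [DecidableEq a] [Fintype b]
  [DecidableEq b] {F : Matrix a a ℂ} {F' : Matrix b b ℂ} {p : Submodule ℂ (Matrix n n ℂ)}

theorem glMember_isoMember_isDualPair :
    (glMember n a b F F' p).IsDualPair (isoMember n a b F F') where
  commute k k' v := Prod.ext (Matrix.mul_assoc _ _ _) (Matrix.mul_assoc _ _ _)
  φ_onW k v := by
    have h : ∀ k ki : Matrix n n ℂ, ((v.1 * ki)ᵀ * F * (v.1 * ki), (v.2 * kᵀ)ᵀ * F' * (v.2 * kᵀ)) =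
        (kiᵀ * (v.1ᵀ * F * v.1) * ki, k * (v.2ᵀ * F' * v.2) * kᵀ) := by
      intro k ki
      simp [Matrix.transpose_mul, Matrix.mul_assoc]
    exact h _ _
  φ_onW' k v := by
    have h : ∀ (k₁ : Matrix a a ℂ) (k₂ : Matrix b b ℂ), k₁ᵀ * F * k₁ = F → k₂ᵀ * F' * k₂ = F' →
        ((k₁ * v.1)ᵀ * F * (k₁ * v.1), (k₂ * v.2)ᵀ * F' * (k₂ * v.2)) =
        (v.1ᵀ * F * v.1, v.2ᵀ * F' * v.2) := by
      intro k₁ k₂ h₁ h₂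
      nth_rewrite 2 [← h₁]
      nth_rewrite 2 [← h₂]
      simp [Matrix.transpose_mul, Matrix.mul_assoc]
    exact h _ _ k.2.1 k.2.2
  φ_zero := by
    have h : ((0 : Matrix a n ℂ)ᵀ * F * (0 : Matrix a n ℂ), (0 : Matrix b n ℂ)ᵀ * F' *
        (0 : Matrix b n ℂ)) = 0 := by
      simp
    exact h
  φ'_zero := Matrix.zero_mul _

theorem isoMember_glMember_isDualPair :
    (isoMember n a b F F').IsDualPair (glMember n a b F F' p) where
  commute k k' v := Prod.ext (Matrix.mul_assoc _ _ _).symm (Matrix.mul_assoc _ _ _).symm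
  φ_onW k v := by
    have h : ∀ (k₁ : Matrix a a ℂ) (k₂ : Matrix b b ℂ),
        (k₁ * v.1) * (k₂ * v.2)ᵀ = k₁ * (v.1 * v.2ᵀ) * k₂ᵀ := by
      intro k₁ k₂
      simp [Matrix.transpose_mul, Matrix.mul_assoc]
    exact h _ _
  φ_onW' k v := by
    have h : ∀ k ki : Matrix n n ℂ, ki * k = 1 →
        (v.1 * ki) * (v.2 * kᵀ)ᵀ = v.1 * v.2ᵀ := by
      intro k ki hk
      rw [Matrix.transpose_mul, Matrix.transpose_transpose, Matrix.mul_assoc, ← Matrix.mul_assoc ki,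
        hk, Matrix.one_mul]
    exact h _ _ k.1.inv_val
  φ_zero := Matrix.zero_mul _
  φ'_zero := by
    have h : ((0 : Matrix a n ℂ)ᵀ * F * (0 : Matrix a n ℂ), (0 : Matrix b n ℂ)ᵀ * F' *
        (0 : Matrix b n ℂ)) = 0 := by
      simp
    exact h

/-- The velocity of `w = (A, B)` under `X` in the Lie algebra of `GL_n`. -/
def glVelocity (w : Matrix a n ℂ × Matrix b n ℂ) :
    Matrix n n ℂ →ₗ[ℂ] Matrix a n ℂ × Matrix b n ℂ where
  toFun X := (-(w.1 * X), w.2 * Xᵀ)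
  map_add' X Y := by simp [Matrix.mul_add, add_comm]
  map_smul' c X := by simp

/-- The velocity of `w = (A, B)` under `(X₁, X₂)` in the Lie algebra of the isometries. -/
def isoVelocity (w : Matrix a n ℂ × Matrix b n ℂ) :
    Matrix a a ℂ × Matrix b b ℂ →ₗ[ℂ] Matrix a n ℂ × Matrix b n ℂ where
  toFun X := (X.1 * w.1, X.2 * w.2)
  map_add' X Y := by simp [Matrix.add_mul]
  map_smul' c X := by simp

/-- The equivariance of the velocities under an element `(k, k')` that fixes `w = (A, B)`. -/
theorem glVelocity_isoVelocity_equivariant {w : Matrix a n ℂ × Matrix b n ℂ} {k ki : Matrix n n ℂ}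
    (hk : ki * k = 1) {k₁ k₁i : Matrix a a ℂ} {k₂ k₂i : Matrix b b ℂ}
    (h₁' : k₁i * k₁ = 1) (h₂' : k₂i * k₂ = 1)
    (h : (k₁ * w.1 * ki, k₂ * w.2 * kᵀ) = w) :
    (∀ X : Matrix n n ℂ, (k₁ * (glVelocity w X).1 * ki, k₂ * (glVelocity w X).2 * kᵀ) =
      glVelocity w (k * (X * ki))) ∧
    (∀ X : Matrix a a ℂ × Matrix b b ℂ,
      (k₁ * (isoVelocity w X).1 * ki, k₂ * (isoVelocity w X).2 * kᵀ) =
      isoVelocity w (k₁ * (X.1 * k₁i), k₂ * (X.2 * k₂i))) := by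
  obtain ⟨A, B⟩ := w
  obtain ⟨h₁, h₂⟩ := Prod.ext_iff.1 h
  simp only at h₁ h₂
  have hk' : k * ki = 1 := mul_eq_one_comm.1 hk
  have e1 : k₁ * A = A * k := by
    nth_rewrite 2 [← h₁]
    rw [Matrix.mul_assoc _ ki k, hk, Matrix.mul_one]
  have e2 : k₂ * B = B * kiᵀ := by
    nth_rewrite 2 [← h₂]
    rw [Matrix.mul_assoc _ kᵀ, ← Matrix.transpose_mul, hk, Matrix.transpose_one, Matrix.mul_one]
  have e3 : k₁i * A = A * ki := by
    nth_rewrite 1 [← h₁]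
    rw [← Matrix.mul_assoc, ← Matrix.mul_assoc, h₁', Matrix.one_mul]
  have e4 : k₂i * B = B * kᵀ := by
    nth_rewrite 1 [← h₂]
    rw [← Matrix.mul_assoc, ← Matrix.mul_assoc, h₂', Matrix.one_mul]
  constructor
  · intro X
    refine Prod.ext ?_ ?_
    · simp only [glVelocity, LinearMap.coe_mk, AddHom.coe_mk, Matrix.mul_neg, Matrix.neg_mul]
      rw [← Matrix.mul_assoc, e1]
      simp only [Matrix.mul_assoc]
    · simp only [glVelocity, LinearMap.coe_mk, AddHom.coe_mk]
      rw [← Matrix.mul_assoc, e2]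
      simp only [Matrix.mul_assoc, Matrix.transpose_mul]
  · intro X
    refine Prod.ext ?_ ?_
    · simp only [isoVelocity, LinearMap.coe_mk, AddHom.coe_mk, Matrix.mul_assoc, e3]
    · simp only [isoVelocity, LinearMap.coe_mk, AddHom.coe_mk, Matrix.mul_assoc, e4]

/-- Over `GL_n`, the points `(A, B)` with `A` and `B` injective are regular. -/
theorem glMember_isRegularPoint {ε : ℂ} (hF : IsSignedForm ε F) (hF' : IsSignedForm ε F')
    (hp : ∀ S, S ∈ p ↔ Sᵀ = ε • S) {w : Matrix a n ℂ × Matrix b n ℂ} {L : Matrix n a ℂ}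
    {L' : Matrix n b ℂ} (hL : L * w.1 = 1) (hL' : L' * w.2 = 1) :
    (glMember n a b F F' p).IsRegularPoint (isoMember n a b F F') w := by
  obtain ⟨A, B⟩ := w
  simp only at hL hL'
  have hR' : Bᵀ * L'ᵀ = 1 := by rw [← Matrix.transpose_mul, hL', Matrix.transpose_one]
  let T : Matrix a a ℂ × Matrix b b ℂ →ₗ[ℂ] Matrix n n ℂ :=
    { toFun := fun k => L * k.1 * A
      map_add' := by intro k l; simp [Matrix.mul_add, Matrix.add_mul]
      map_smul' := by intro c k; simp }
  let D : Matrix a n ℂ × Matrix b n ℂ →ₗ[ℂ] Matrix n n ℂ × Matrix n n ℂ :=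
    { toFun := fun v => (v.1ᵀ * F * A + Aᵀ * F * v.1, v.2ᵀ * F' * B + Bᵀ * F' * v.2)
      map_add' := by
        intro u v
        simp only [Prod.fst_add, Prod.snd_add, Matrix.transpose_add, Matrix.add_mul, Matrix.mul_add]
        exact Prod.ext (add_add_add_comm _ _ _ _) (add_add_add_comm _ _ _ _)
      map_smul' := by intro c v; simp }
  have hfree : ∀ k ki : Matrix n n ℂ, k * ki = 1 → (A * ki, B * kᵀ) = (A, B) → k = 1 := by
    intro k ki hk h
    have h1 := congrArg (fun v => L * v.1) h
    simp only [← Matrix.mul_assoc, hL, Matrix.one_mul] at h1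
    rwa [h1, Matrix.mul_one] at hk
  have hlift : ∀ (k₁ k₁i : Matrix a a ℂ) (k₂ k₂i : Matrix b b ℂ), k₁i * k₁ = 1 →
      k₂i * k₂ = 1 → k₁ * (A * Bᵀ) * k₂ᵀ = A * Bᵀ →
      ∃ u : (Matrix n n ℂ)ˣ, (k₁ * A * u⁻¹.val, k₂ * B * u.valᵀ) = (A, B) := by
    intro k₁ k₁i k₂ k₂i h₁ h₂ h
    have h₂t : k₂ᵀ * k₂iᵀ = 1 := by rw [← Matrix.transpose_mul, h₂, Matrix.transpose_one]
    obtain ⟨u, e1, e2⟩ := Matrix.exists_intertwining_unit hL hR' h₁ (mul_eq_one_comm.1 h₂t) (by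
      nth_rewrite 2 [← h]
      rw [Matrix.mul_assoc _ k₂ᵀ, h₂t, Matrix.mul_one])
    refine ⟨u, Prod.ext ?_ ?_⟩
    · simp only
      rw [e1, Matrix.mul_assoc A, u.mul_inv, Matrix.mul_one]
    · simp only
      have e3 : B * u.valᵀ = k₂i * B := by
        simpa [Matrix.transpose_mul] using congrArg Matrix.transpose e2
      rw [Matrix.mul_assoc, e3, ← Matrix.mul_assoc, mul_eq_one_comm.1 h₂, Matrix.one_mul]
  have hinf : ∀ (X : Matrix a a ℂ × Matrix b b ℂ), X.1 * (A * Bᵀ) = -(A * Bᵀ * X.2ᵀ) ↔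
      ∃ Z : Matrix n n ℂ, X.1 * A = A * Z ∧ X.2 * B = -(B * Zᵀ) := by
    intro X
    constructor
    · intro h
      obtain ⟨e1, e2⟩ := Matrix.exists_intertwining hL hR' (a := X.1) (b := -X.2ᵀ)
        (by rw [h, Matrix.mul_neg])
      refine ⟨_, e1, ?_⟩
      have e3 : B * (L * X.1 * A)ᵀ = -(X.2 * B) := by
        rw [← Matrix.transpose_transpose (X.2 * B), Matrix.transpose_mul X.2,
            ← Matrix.transpose_neg,
          ← Matrix.mul_neg, ← e2, Matrix.transpose_mul _ Bᵀ, Matrix.transpose_transpose]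
      rw [e3, neg_neg]
    · rintro ⟨Z, h1, h2⟩
      rw [← Matrix.mul_assoc, h1, Matrix.mul_assoc A Bᵀ, ← Matrix.transpose_mul, h2]
      simp [Matrix.mul_assoc]
  have hexp : ∀ (X : Matrix a a ℂ × Matrix b b ℂ) (Z : Matrix n n ℂ), X.1 * A = A * Z →
      X.2 * B = -(B * Zᵀ) → ∀ t : ℂ, ((NormedSpace.exp (t • X)).1 * A * NormedSpace.exp (-(t • Z)),
        (NormedSpace.exp (t • X)).2 * B * (NormedSpace.exp (t • Z))ᵀ) = (A, B) := by
    intro X Z h1 h2 t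
    rw [Matrix.exp_prod, Matrix.exp_smul_transpose, Matrix.exp_neg_smul]
    exact Prod.ext (Matrix.forall_exp_fix_iff.2 (show X.1 * A = -(A * -Z) by rw [h1]; simp) t)
      (Matrix.forall_exp_fix_iff.2 h2 t)
  refine ⟨?_, ?_, ?_, ?_, ?_⟩
  · intro k hk
    exact Subtype.ext (Units.ext (hfree _ _ k.1.val_inv hk))
  · intro k' hk'
    obtain ⟨u, hu⟩ := hlift k'.1.val.1 k'.1⁻¹.val.1 k'.1.val.2 k'.1⁻¹.val.2
      (congrArg Prod.fst k'.1.inv_val) (congrArg Prod.snd k'.1.inv_val) hk'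
    exact ⟨⟨u, trivial⟩, hu⟩
  · refine ⟨T, 0, fun k k' h => ?_⟩
    have hT : ∀ (k ki : Matrix n n ℂ) (k₁ : Matrix a a ℂ) (k₂ : Matrix b b ℂ), ki * k = 1 →
        (k₁ * A * ki, k₂ * B * kᵀ) = (A, B) → k = L * k₁ * A := by
      intro k ki k₁ k₂ hk h
      have h1 : k₁ * A * ki = A := congrArg Prod.fst h
      rw [Matrix.mul_assoc, ← Matrix.mul_one (k₁ * A), ← hk, ← Matrix.mul_assoc (k₁ * A) ki, h1,
        ← Matrix.mul_assoc, hL, Matrix.one_mul]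
    exact (hT _ _ _ _ k.1.inv_val h).trans (add_zero _).symm
  · intro X hX
    obtain ⟨Z, h1, h2⟩ := (hinf X).1 (isoMember_mem_lieSet_stab.1 hX).2
    have h : ∀ t : ℂ, ∀ k : Matrix a a ℂ × Matrix b b ℂ, k = NormedSpace.exp (t • X) →
        (k.1 * A * NormedSpace.exp (-(t • Z)), k.2 * B * (NormedSpace.exp (t • Z))ᵀ) = (A, B) := by
      rintro t _ rfl
      exact hexp X Z h1 h2 t
    exact ⟨Z, fun t => ⟨⟨glMember_isMatrixGroup.expUnit (t • Z), trivial⟩, rfl,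
      fun k' hk' => h t _ hk'⟩⟩
  · refine ⟨glVelocity (A, B), isoVelocity (A, B), D, ?_, ?_, ?_, ?_, ?_, ?_, ?_⟩
    · intro v
      have h : ∀ v : Matrix a n ℂ × Matrix b n ℂ, ((A + v.1)ᵀ * F * (A + v.1),
          (B + v.2)ᵀ * F' * (B + v.2)) = ((Aᵀ * F * A, Bᵀ * F' * B) : Matrix n n ℂ × Matrix n n ℂ) +
          D v + (v.1ᵀ * F * v.1, v.2ᵀ * F' * v.2) := by
        intro v
        simp only [D, LinearMap.coe_mk, AddHom.coe_mk, Matrix.transpose_add, Matrix.add_mul,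
          Matrix.mul_add, Prod.mk_add_mk]
        refine Prod.ext ?_ ?_ <;> · simp only; abel
      exact h v
    · intro s
      have h : ∀ s : Matrix n n ℂ × Matrix n n ℂ, (s.1 ∈ p ∧ s.2 ∈ p) ↔ ∃ v, D v = s := by
        intro s
        rw [hp, hp, hF.exists_tangent hL, hF'.exists_tangent hL']
        exact ⟨fun ⟨⟨v, hv⟩, ⟨v', hv'⟩⟩ => ⟨(v, v'), Prod.ext hv hv'⟩,
          fun ⟨v, hv⟩ => ⟨⟨v.1, congrArg Prod.fst hv⟩, ⟨v.2, congrArg Prod.snd hv⟩⟩⟩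
      exact h s
    · intro v
      have h : D v = 0 ↔ ∃ X : Matrix a a ℂ × Matrix b b ℂ,
          (X.1ᵀ * F = -(F * X.1) ∧ X.2ᵀ * F' = -(F' * X.2)) ∧ isoVelocity (A, B) X = v := by
        refine Prod.ext_iff.trans ((and_congr (hF.exists_skew_mul_eq hL)
          (hF'.exists_skew_mul_eq hL')).trans ?_)
        exact ⟨fun ⟨⟨X, hX, h⟩, ⟨X', hX', h'⟩⟩ => ⟨(X, X'), ⟨hX, hX'⟩, Prod.ext h h'⟩,
          fun ⟨X, hX, h⟩ => ⟨⟨X.1, hX.1, congrArg Prod.fst h⟩, ⟨X.2, hX.2, congrArg Prod.snd h⟩⟩⟩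
      exact h.trans (exists_congr fun X => and_congr_left' isoMember_mem_lieAlg_top.symm)
    · intro X _ hX
      have h : ∀ X : Matrix n n ℂ, -(A * X) = 0 → X = 0 := by
        intro X hX
        rw [← Matrix.one_mul X, ← hL, Matrix.mul_assoc, neg_eq_zero.1 hX, Matrix.mul_zero]
      exact h X (congrArg Prod.fst hX)
    · intro X _
      refine Iff.trans ?_ glMember_mem_lieAlg_stab.symm
      have h : ∀ X : Matrix n n ℂ, D (-(A * X), B * Xᵀ) = 0 ↔
          Xᵀ * (Aᵀ * F * A) = -(Aᵀ * F * A * X) ∧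
          X * (Bᵀ * F' * B) = -(Bᵀ * F' * B * Xᵀ) := by
        intro X
        rw [eq_neg_iff_add_eq_zero, eq_neg_iff_add_eq_zero, Prod.ext_iff]
        refine and_congr ?_ ?_
        · rw [← neg_eq_zero]
          simp [D, Matrix.mul_assoc, Matrix.transpose_mul, add_comm]
        · simp [D, Matrix.mul_assoc, Matrix.transpose_mul]
      exact h X
    · intro X hX
      have hX := isoMember_mem_lieAlg_top.1 hX
      refine isoMember_mem_lieAlg_stab.trans ?_
      have h : ∀ X : Matrix a a ℂ × Matrix b b ℂ, X.1 * (A * Bᵀ) = -(A * Bᵀ * X.2ᵀ) ↔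
          ∃ Z : Matrix n n ℂ, glVelocity (A, B) Z = isoVelocity (A, B) X := by
        intro X
        rw [hinf]
        constructor
        · rintro ⟨Z, h1, h2⟩
          refine ⟨-Z, Prod.ext ?_ ?_⟩
          · simp [glVelocity, isoVelocity, h1]
          · simp [glVelocity, isoVelocity, h2]
        · rintro ⟨Z, h⟩
          refine ⟨-Z, ?_, ?_⟩
          · simpa [glVelocity, isoVelocity] using (congrArg Prod.fst h).symm
          · simpa [glVelocity, isoVelocity] using (congrArg Prod.snd h).symm
      exact ⟨fun h' => ((h X).1 h'.2).imp fun Z hZ => ⟨glMember_mem_lieAlg_top Z, hZ⟩,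
        fun ⟨Z, _, hZ⟩ => ⟨hX, (h X).2 ⟨Z, hZ⟩⟩⟩
    · intro k k' hk
      exact glVelocity_isoVelocity_equivariant k.1.inv_val (congrArg Prod.fst k'.1.inv_val)
        (congrArg Prod.snd k'.1.inv_val) hk

end Pairs

section Pairs

variable {n a b : Type} [Fintype n] [DecidableEq n] [Fintype a] [DecidableEq a] [Fintype b]
  [DecidableEq b] {F : Matrix a a ℂ} {F' : Matrix b b ℂ} {p : Submodule ℂ (Matrix n n ℂ)}

/-- Over the isometry groups, the points `(A, B)` with `A` and `B` surjective are regular. -/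
theorem isoMember_isRegularPoint {ε : ℂ} (hF : IsSignedForm ε F) (hF' : IsSignedForm ε F')
    {w : Matrix a n ℂ × Matrix b n ℂ} {R : Matrix n a ℂ}
    {R' : Matrix n b ℂ} (hR : w.1 * R = 1) (hR' : w.2 * R' = 1) :
    (isoMember n a b F F').IsRegularPoint (glMember n a b F F' p) w := by
  obtain ⟨A, B⟩ := w
  simp only at hR hR'
  have hL : R'ᵀ * Bᵀ = 1 := by rw [← Matrix.transpose_mul, hR', Matrix.transpose_one]
  let T : Matrix n n ℂ →ₗ[ℂ] Matrix a a ℂ × Matrix b b ℂ :=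
    { toFun := fun k => (A * k * R, 0)
      map_add' := by intro k l; simp [Matrix.mul_add, Matrix.add_mul]
      map_smul' := by intro c k; simp }
  let S : Matrix n n ℂ →ₗ[ℂ] Matrix a a ℂ × Matrix b b ℂ :=
    { toFun := fun k => (0, B * kᵀ * R')
      map_add' := by intro k l; simp [Matrix.mul_add, Matrix.add_mul]
      map_smul' := by intro c k; simp }
  let D : Matrix a n ℂ × Matrix b n ℂ →ₗ[ℂ] Matrix a b ℂ :=
    { toFun := fun v => v.1 * Bᵀ + A * v.2ᵀ
      map_add' := by
        intro u v
        simp only [Prod.fst_add, Prod.snd_add, Matrix.transpose_add, Matrix.add_mul, Matrix.mul_add]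
        exact add_add_add_comm _ _ _ _
      map_smul' := by intro c v; simp }
  have hcancel : ∀ X Y : Matrix a a ℂ, X * A = Y * A → X = Y := by
    intro X Y h
    simpa [Matrix.mul_assoc, hR] using congrArg (fun x => x * R) h
  have hcancel' : ∀ X Y : Matrix b b ℂ, X * B = Y * B → X = Y := by
    intro X Y h
    simpa [Matrix.mul_assoc, hR'] using congrArg (fun x => x * R') h
  have hfree : ∀ k : Matrix a a ℂ × Matrix b b ℂ, (k.1 * A, k.2 * B) = (A, B) → k = 1 := by
    intro k h
    refine Prod.ext (hcancel _ _ ?_) (hcancel' _ _ ?_)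
    · simpa using congrArg Prod.fst h
    · simpa using congrArg Prod.snd h
  have hlift : ∀ k ki : Matrix n n ℂ, ki * k = 1 →
      (kiᵀ * (Aᵀ * F * A) * ki, k * (Bᵀ * F' * B) * kᵀ) = (Aᵀ * F * A, Bᵀ * F' * B) →
      ∃ (g : Matrix a a ℂ) (g' : Matrix b b ℂ), gᵀ * F * g = F ∧ g'ᵀ * F' * g' = F' ∧
        (g * (A * ki), g' * (B * kᵀ)) = (A, B) := by
    intro k ki hk h
    have hki := mul_eq_one_comm.1 hk
    have hkt : kᵀ * kiᵀ = 1 := by rw [← Matrix.transpose_mul, hk, Matrix.transpose_one]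
    have h1 : kiᵀ * (Aᵀ * F * A) * ki = Aᵀ * F * A := congrArg Prod.fst h
    have h2 : k * (Bᵀ * F' * B) * kᵀ = Bᵀ * F' * B := congrArg Prod.snd h
    obtain ⟨g, hg, e⟩ := hF.exists_isometry hR hk (by
      nth_rewrite 1 [← h1]
      rw [← Matrix.mul_assoc, ← Matrix.mul_assoc, hkt, Matrix.one_mul])
    obtain ⟨g', hg', e'⟩ := hF'.exists_isometry hR' (k := kiᵀ) (k' := kᵀ) hkt (by
      nth_rewrite 1 [← h2]
      rw [Matrix.transpose_transpose, ← Matrix.mul_assoc, ← Matrix.mul_assoc, hk, Matrix.one_mul])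
    refine ⟨g, g', hg, hg', Prod.ext ?_ ?_⟩
    · simp only
      rw [← Matrix.mul_assoc, e, Matrix.mul_assoc, hki, Matrix.mul_one]
    · simp only
      rw [← Matrix.mul_assoc, e', Matrix.mul_assoc, mul_eq_one_comm.1 hkt, Matrix.mul_one]
  have hinf : ∀ X : Matrix n n ℂ, (Xᵀ * (Aᵀ * F * A) = -(Aᵀ * F * A * X) ∧
      X * (Bᵀ * F' * B) = -(Bᵀ * F' * B * Xᵀ)) ↔ ∃ Y : Matrix a a ℂ × Matrix b b ℂ,
        (Y.1ᵀ * F = -(F * Y.1) ∧ Y.2ᵀ * F' = -(F' * Y.2)) ∧ Y.1 * A = A * X ∧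
          Y.2 * B = -(B * Xᵀ) := by
    intro X
    have h := hF'.exists_skew hR' (X := -Xᵀ)
    simp only [Matrix.transpose_neg, Matrix.transpose_transpose, Matrix.neg_mul, Matrix.mul_neg,
      neg_inj] at h
    rw [hF.exists_skew hR, h]
    exact ⟨fun ⟨⟨Y, hY, h⟩, ⟨Y', hY', h'⟩⟩ => ⟨(Y, Y'), ⟨hY, hY'⟩, h, h'⟩,
      fun ⟨Y, hY, h, h'⟩ => ⟨⟨Y.1, hY.1, h⟩, ⟨Y.2, hY.2, h'⟩⟩⟩
  have hexp : ∀ (X : Matrix a a ℂ × Matrix b b ℂ) (Z : Matrix n n ℂ), X.1 * A = A * Z →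
      X.2 * B = -(B * Zᵀ) → ∀ t : ℂ, ∀ k : (Matrix n n ℂ)ˣ, k.val = NormedSpace.exp (t • Z) →
        ((NormedSpace.exp (t • X)).1 * (A * k⁻¹.val),
        (NormedSpace.exp (t • X)).2 * (B * k.valᵀ)) = (A, B) := by
    intro X Z h1 h2 t k hk
    have hki : k⁻¹.val = NormedSpace.exp (-(t • Z)) := by
      rw [Units.inv_eq_of_mul_eq_one_right]
      rw [hk, Matrix.exp_mul_exp_neg]
    rw [hki, hk, Matrix.exp_prod, Matrix.exp_smul_transpose, Matrix.exp_neg_smul,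
      ← Matrix.mul_assoc, ← Matrix.mul_assoc]
    exact Prod.ext (Matrix.forall_exp_fix_iff.2 (show X.1 * A = -(A * -Z) by rw [h1]; simp) t)
      (Matrix.forall_exp_fix_iff.2 h2 t)
  refine ⟨?_, ?_, ?_, ?_, ?_⟩
  · intro k hk
    exact Subtype.ext (Units.ext (hfree _ hk))
  · intro k' hk'
    obtain ⟨g, g', hg, hg', h⟩ := hlift _ _ k'.1.inv_val hk'
    exact ⟨⟨MulEquiv.prodUnits.symm (hF.unitOfIsometry hg, hF'.unitOfIsometry hg'), hg, hg'⟩, h⟩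
  · refine ⟨T, S, fun k k' h => ?_⟩
    have hT : ∀ (k ki : Matrix n n ℂ) (l : Matrix a a ℂ × Matrix b b ℂ), ki * k = 1 →
        (l.1 * (A * ki), l.2 * (B * kᵀ)) = (A, B) → l = T k + S ki := by
      intro k ki l hk h
      have h1 : l.1 * (A * ki) = A := congrArg Prod.fst h
      have h2 : l.2 * (B * kᵀ) = B := congrArg Prod.snd h
      have hkt : kᵀ * kiᵀ = 1 := by rw [← Matrix.transpose_mul, hk, Matrix.transpose_one]
      have e1 : l.1 * A = A * k := by
        nth_rewrite 2 [← h1]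
        rw [Matrix.mul_assoc, Matrix.mul_assoc A, hk, Matrix.mul_one]
      have e2 : l.2 * B = B * kiᵀ := by
        nth_rewrite 2 [← h2]
        rw [Matrix.mul_assoc, Matrix.mul_assoc B, hkt, Matrix.mul_one]
      refine Prod.ext ?_ ?_
      · simp only [T, S, LinearMap.coe_mk, AddHom.coe_mk, Prod.mk_add_mk, add_zero]
        rw [← e1, Matrix.mul_assoc, hR, Matrix.mul_one]
      · simp only [T, S, LinearMap.coe_mk, AddHom.coe_mk, Prod.mk_add_mk, zero_add]
        rw [← e2, Matrix.mul_assoc, hR', Matrix.mul_one]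
    exact hT _ _ _ k'.1.inv_val h
  · intro X hX
    obtain ⟨Y, hY, h1, h2⟩ := (hinf X).1 (glMember_mem_lieSet_stab.1 hX)
    have hYl := isoMember_isMatrixGroup.mem_lieSet_iff.1
      ((isoMember_mem_lieSet_stab (n := n) (F := F) (F' := F') (y := 0) (X := Y)).2
        ⟨hY, by simp⟩)
    exact ⟨Y, fun t => ⟨⟨isoMember_isMatrixGroup.expUnit _, (hYl t).1⟩, rfl,
      fun k' hk' => hexp Y X h1 h2 t k'.1 hk'⟩⟩
  · refine ⟨isoVelocity (A, B), glVelocity (A, B), D, ?_, ?_, ?_, ?_, ?_, ?_, ?_⟩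
    · have h : ∀ v : Matrix a n ℂ × Matrix b n ℂ,
          (A + v.1) * (B + v.2)ᵀ = A * Bᵀ + D v + v.1 * v.2ᵀ := by
        intro v
        simp only [D, LinearMap.coe_mk, AddHom.coe_mk, Matrix.transpose_add, Matrix.add_mul,
          Matrix.mul_add]
        abel
      exact h
    · intro s
      have h : ∀ s : Matrix a b ℂ, ∃ v, D v = s := fun s =>
        ⟨(s * R'ᵀ, 0), by simp [D, Matrix.mul_assoc, hL]⟩
      exact ⟨fun _ => h s, fun _ => trivial⟩
    · intro v
      have h : D v = 0 ↔ ∃ X : Matrix n n ℂ, glVelocity (A, B) X = v := by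
        refine (Matrix.exists_simultaneous_solution hR hL).trans (exists_congr fun X => ?_)
        rw [Prod.ext_iff]
        refine and_congr_right' ?_
        rw [← Matrix.transpose_inj, Matrix.transpose_mul, Matrix.transpose_transpose,
          Matrix.transpose_transpose]
        rfl
      exact h.trans ⟨fun ⟨X, hX⟩ => ⟨X, glMember_mem_lieAlg_top X, hX⟩, fun ⟨X, _, hX⟩ => ⟨X, hX⟩⟩
    · intro X _ hX
      have h : ∀ X : Matrix a a ℂ × Matrix b b ℂ, (X.1 * A, X.2 * B) = 0 → X = 0 := by
        intro X h
        refine Prod.ext (hcancel _ _ ?_) (hcancel' _ _ ?_)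
        · simpa using congrArg Prod.fst h
        · simpa using congrArg Prod.snd h
      exact h X hX
    · intro X hX
      refine Iff.trans ?_ isoMember_mem_lieAlg_stab.symm
      have h : ∀ X : Matrix a a ℂ × Matrix b b ℂ, D (X.1 * A, X.2 * B) = 0 ↔
          X.1 * (A * Bᵀ) = -(A * Bᵀ * X.2ᵀ) := by
        intro X
        rw [eq_neg_iff_add_eq_zero]
        simp [D, Matrix.mul_assoc, Matrix.transpose_mul]
      exact (h X).trans ⟨fun h => ⟨isoMember_mem_lieAlg_top.1 hX, h⟩, fun h => h.2⟩
    · intro X _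
      refine glMember_mem_lieAlg_stab.trans ((hinf X).trans ?_)
      have h : ∀ (X : Matrix n n ℂ) (Y : Matrix a a ℂ × Matrix b b ℂ),
          (Y.1 * A = A * X ∧ Y.2 * B = -(B * Xᵀ)) ↔
          isoVelocity (A, B) (-Y) = glVelocity (A, B) X := by
        intro X Y
        rw [Prod.ext_iff]
        simp [isoVelocity, glVelocity, neg_eq_iff_eq_neg]
      have hneg : ∀ Y : Matrix a a ℂ × Matrix b b ℂ,
          Y ∈ (isoMember n a b F F').lieAlg ⊤ → -Y ∈ (isoMember n a b F F').lieAlg ⊤ :=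
        fun Y hY => Submodule.neg_mem _ hY
      constructor
      · rintro ⟨Y, hY, e⟩
        exact ⟨_, hneg Y (isoMember_mem_lieAlg_top.2 hY), (h X Y).1 e⟩
      · rintro ⟨Y, hY, e⟩
        have h' : ∀ (X : Matrix n n ℂ) (Y : Matrix a a ℂ × Matrix b b ℂ),
            isoVelocity (A, B) Y = glVelocity (A, B) X →
            ((-Y).1 * A = A * X ∧ (-Y).2 * B = -(B * Xᵀ)) :=
          fun X Y e => (h X (-Y)).2 (by rwa [neg_neg])
        exact ⟨_, isoMember_mem_lieAlg_top.1 (hneg Y hY), h' X Y e⟩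
    · intro k k' hk
      have h : ∀ (k ki : Matrix n n ℂ) (l li : Matrix a a ℂ × Matrix b b ℂ), ki * k = 1 →
          li.1 * l.1 = 1 → li.2 * l.2 = 1 → (l.1 * (A * ki), l.2 * (B * kᵀ)) = (A, B) →
          (∀ X : Matrix a a ℂ × Matrix b b ℂ,
            (l.1 * ((isoVelocity (A, B) X).1 * ki),
              l.2 * ((isoVelocity (A, B) X).2 * kᵀ)) =
            isoVelocity (A, B) (l.1 * (X.1 * li.1), l.2 * (X.2 * li.2))) ∧
          (∀ X : Matrix n n ℂ, (l.1 * ((glVelocity (A, B) X).1 * ki),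
              l.2 * ((glVelocity (A, B) X).2 * kᵀ)) =
            glVelocity (A, B) (k * (X * ki))) := by
        intro k ki l li hk h1 h2 h
        simp only [← Matrix.mul_assoc] at h ⊢
        have h3 := glVelocity_isoVelocity_equivariant (w := (A, B)) hk h1 h2 h
        simp only [← Matrix.mul_assoc] at h3
        exact ⟨h3.2, h3.1⟩
      exact h k'.1.val k'.1.inv k.1.val k.1.inv k'.1.inv_val (congrArg Prod.fst k.1.inv_val)
        (congrArg Prod.snd k.1.inv_val) hk

end Pairs

/-! ### Invariant forms -/

section TraceForms

variable {l m n : Type} [Fintype l] [Fintype m] [Fintype n]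

/-- A nonvanishing minor of `A B` of the size of the middle dimension makes `A` injective and `B`
surjective. -/
theorem Matrix.exists_inverses_of_det_ne_zero [DecidableEq n] {P : Matrix n l ℂ} {A : Matrix l n ℂ}
    {B : Matrix n m ℂ} {Q : Matrix m n ℂ} (h : (P * (A * B) * Q).det ≠ 0) :
    (∃ L : Matrix n l ℂ, L * A = 1) ∧ ∃ R : Matrix m n ℂ, B * R = 1 := by
  have e : P * (A * B) * Q = P * A * (B * Q) := by simp only [Matrix.mul_assoc]
  rw [e, Matrix.det_mul] at h
  have h1 : IsUnit (P * A).det := (left_ne_zero_of_mul h).isUnit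
  have h2 : IsUnit (B * Q).det := (right_ne_zero_of_mul h).isUnit
  exact ⟨⟨(P * A)⁻¹ * P, by rw [Matrix.mul_assoc, Matrix.nonsing_inv_mul _ h1]⟩,
    ⟨Q * (B * Q)⁻¹, by rw [← Matrix.mul_assoc, Matrix.mul_nonsing_inv _ h2]⟩⟩

/-- The trace form `(x, y) ↦ tr (x y)`. -/
def Matrix.traceBilin (m n : Type) [Fintype m] [Fintype n] :
    Matrix m n ℂ →ₗ[ℂ] Matrix n m ℂ →ₗ[ℂ] ℂ :=
  LinearMap.mk₂ ℂ (fun x y => (x * y).trace) (by intro x y z; simp [Matrix.add_mul])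
    (by intro c x y; simp) (by intro x y z; simp [Matrix.mul_add]) (by intro c x y; simp)

open scoped ComplexOrder in
/-- The Hermitian form `tr (x xᴴ)` is definite. Hence the bilinear trace form is nondegenerate on
spaces of matrices that are closed under the conjugate transpose. -/
theorem Matrix.eq_zero_of_trace {x : Matrix m n ℂ} (h : (x * xᴴ).trace = 0) : x = 0 :=
  Matrix.trace_mul_conjTranspose_self_eq_zero_iff.1 h

namespace IsSignedForm

variable [DecidableEq m] {ε : ℂ} {F : Matrix m m ℂ}

theorem star_sign (hF : IsSignedForm ε F) : star ε = ε := by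
  rcases mul_self_eq_one_iff.1 hF.sign with h | h <;> simp [h]

theorem det_ne_zero (hF : IsSignedForm ε F) : F.det ≠ 0 := by
  intro h
  have h1 := congrArg Matrix.det hF.inv_mul
  rw [Matrix.det_mul, h, mul_zero, Matrix.det_one] at h1
  exact zero_ne_one h1

/-- The Lie algebra of the isometry group is closed under the conjugate transpose. -/
theorem skew_conjTranspose (hF : IsSignedForm ε F) {X : Matrix m m ℂ} (hX : Xᵀ * F = -(F * X)) :
    Xᴴᵀ * F = -(F * Xᴴ) := by
  have h1 := congrArg Matrix.conjTranspose hX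
  rw [Matrix.conjTranspose_mul, Matrix.conjTranspose_neg, Matrix.conjTranspose_mul,
    hF.conjTranspose] at h1
  simp only [Matrix.smul_mul, Matrix.mul_smul, ← smul_neg] at h1
  have h2 : F * Xᴴᵀ = -(Xᴴ * F) := by
    have h3 := congrArg (fun x => ε • x) h1
    simp only [smul_smul, hF.sign, one_smul] at h3
    exact h3
  have h4 := congrArg (fun x => ε • (F * x * F)) h2
  simp only [Matrix.mul_neg, Matrix.neg_mul, smul_neg] at h4
  rw [hF.mul_mul_self, Matrix.smul_mul, smul_smul, hF.sign, one_smul, Matrix.mul_assoc F,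
    Matrix.mul_assoc Xᴴ, hF.mul_self, Matrix.mul_smul, Matrix.mul_smul, smul_smul, hF.sign,
    one_smul, Matrix.mul_one] at h4
  exact h4

end IsSignedForm

end TraceForms

section Pairs

variable {n a b : Type} [Fintype n] [DecidableEq n] [Fintype a] [DecidableEq a] [Fintype b]
  [DecidableEq b] {F : Matrix a a ℂ} {F' : Matrix b b ℂ} {p : Submodule ℂ (Matrix n n ℂ)}

/-- The trace form is invariant under conjugation. -/
theorem Matrix.trace_conj_mul {k ki : Matrix n n ℂ} (hk : ki * k = 1) (X Y : Matrix n n ℂ) :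
    (k * (X * ki) * (k * (Y * ki))).trace = (X * Y).trace := by
  have e : k * (X * ki) * (k * (Y * ki)) = k * (X * (ki * k) * Y * ki) := by
    simp only [Matrix.mul_assoc]
  rw [e, hk, Matrix.mul_one, Matrix.trace_mul_comm, Matrix.mul_assoc, hk, Matrix.mul_one]

theorem glMember_hasInvariantForms {ε : ℂ} (hF : IsSignedForm ε F)
    (hp : ∀ S, S ∈ p ↔ Sᵀ = ε • S) : (glMember n a b F F' p).HasInvariantForms where
  onP_mem k s hs := by
    have h : ∀ (g : Matrix n n ℂ) (S : Matrix n n ℂ), S ∈ p → gᵀ * S * g ∈ p := by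
      intro g S hS
      rw [hp] at *
      rw [Matrix.transpose_mul, Matrix.transpose_mul, Matrix.transpose_transpose, hS]
      simp [Matrix.mul_assoc]
    have h' : ∀ (g : Matrix n n ℂ) (S : Matrix n n ℂ), S ∈ p → g * S * gᵀ ∈ p := by
      intro g S hS
      simpa using h gᵀ S hS
    exact ⟨h _ _ hs.1, h' _ _ hs.2⟩
  onP_form := by
    let B : (Matrix n n ℂ × Matrix n n ℂ) →ₗ[ℂ] (Matrix n n ℂ × Matrix n n ℂ) →ₗ[ℂ] ℂ :=
      (Matrix.traceBilin n n).compl₁₂ (LinearMap.fst ℂ _ _) (LinearMap.snd ℂ _ _) +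
      (Matrix.traceBilin n n).compl₁₂ (LinearMap.snd ℂ _ _) (LinearMap.fst ℂ _ _)
    have hB : ∀ s t, B s t = (s.1 * t.2).trace + (s.2 * t.1).trace := fun s t => rfl
    have hinv : ∀ (k ki : Matrix n n ℂ), ki * k = 1 → ∀ s t : Matrix n n ℂ × Matrix n n ℂ,
        B (kiᵀ * s.1 * ki, k * s.2 * kᵀ) (kiᵀ * t.1 * ki, k * t.2 * kᵀ) = B s t := by
      intro k ki hk s t
      have hkt : kᵀ * kiᵀ = 1 := by rw [← Matrix.transpose_mul, hk, Matrix.transpose_one]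
      rw [hB, hB]
      congr 1
      · have e : kiᵀ * s.1 * ki * (k * t.2 * kᵀ) = kiᵀ * (s.1 * (ki * k) * t.2 * kᵀ) := by
          simp only [Matrix.mul_assoc]
        simp only [e]
        rw [hk, Matrix.mul_one, Matrix.trace_mul_comm, Matrix.mul_assoc, hkt, Matrix.mul_one]
      · have e : k * s.2 * kᵀ * (kiᵀ * t.1 * ki) = k * (s.2 * (kᵀ * kiᵀ) * t.1 * ki) := by
          simp only [Matrix.mul_assoc]
        simp only [e]
        rw [hkt, Matrix.mul_one, Matrix.trace_mul_comm, Matrix.mul_assoc, hk, Matrix.mul_one]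
    have hnd : ∀ s : Matrix n n ℂ × Matrix n n ℂ, s.1 ∈ p ∧ s.2 ∈ p →
        (∀ t : Matrix n n ℂ × Matrix n n ℂ, t.1 ∈ p ∧ t.2 ∈ p → B s t = 0) → s = 0 := by
      intro s hs h
      have hc : ∀ S, S ∈ p → Sᴴ ∈ p := by
        intro S hS
        rw [hp] at *
        have h1 := congrArg Matrix.conjTranspose hS
        rw [Matrix.conjTranspose_smul, hF.star_sign] at h1
        exact h1
      refine Prod.ext (Matrix.eq_zero_of_trace ?_) (Matrix.eq_zero_of_trace ?_)
      · simpa [hB] using h (0, s.1ᴴ) ⟨p.zero_mem, hc _ hs.1⟩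
      · simpa [hB] using h (s.2ᴴ, 0) ⟨hc _ hs.2, p.zero_mem⟩
    exact ⟨B, fun k => hinv _ _ k.1.inv_val, hnd⟩
  Ad_form := by
    have hnd : ∀ X : Matrix n n ℂ, (∀ Y, Matrix.traceBilin n n X Y = 0) → X = 0 :=
      fun X h => Matrix.eq_zero_of_trace (h Xᴴ)
    exact ⟨Matrix.traceBilin n n, fun k => Matrix.trace_conj_mul k.1.inv_val,
      fun X _ h => hnd X fun Y => h Y (glMember_mem_lieAlg_top Y)⟩

theorem isoMember_hasInvariantForms {ε : ℂ} (hF : IsSignedForm ε F) (hF' : IsSignedForm ε F') :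
    (isoMember n a b F F').HasInvariantForms where
  onP_mem _ _ _ := trivial
  onP_form := by
    let tr : Matrix a b ℂ →ₗ[ℂ] Matrix a b ℂ →ₗ[ℂ] ℂ :=
      LinearMap.mk₂ ℂ (fun y z => (yᵀ * F * z * F').trace)
        (by intro x y z; simp [Matrix.add_mul]) (by intro c x y; simp)
        (by intro x y z; simp [Matrix.mul_add, Matrix.add_mul]) (by intro c x y; simp)
    have htr : ∀ y z, tr y z = (yᵀ * F * z * F').trace := fun y z => rfl
    have hinv : ∀ (k : Matrix a a ℂ) (l : Matrix b b ℂ), kᵀ * F * k = F → lᵀ * F' * l = F' →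
        ∀ y z : Matrix a b ℂ, tr (k * y * lᵀ) (k * z * lᵀ) = tr y z := by
      intro k l hk hl y z
      have e : (k * y * lᵀ)ᵀ * F * (k * z * lᵀ) * F' = l * (yᵀ * (kᵀ * F * k) * z * (lᵀ * F')) := by
        simp only [Matrix.transpose_mul, Matrix.transpose_transpose, Matrix.mul_assoc]
      rw [htr, htr, e, hk, Matrix.trace_mul_comm, Matrix.mul_assoc, hl]
    have hnd : ∀ y : Matrix a b ℂ, (∀ z, tr y z = 0) → y = 0 := by
      intro y h
      -- with this choice of the second argument the form takes the value `tr (y yᴴ)`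
      have h1 := h (F * yᴴᵀ * F')
      have e : yᵀ * F * (F * yᴴᵀ * F') * F' = (yᴴ * y)ᵀ := by
        have e1 : yᵀ * F * (F * yᴴᵀ * F') * F' = yᵀ * (F * F) * yᴴᵀ * (F' * F') := by
          simp only [Matrix.mul_assoc]
        rw [e1, hF.mul_self, hF'.mul_self]
        simp [Matrix.transpose_mul, smul_smul, hF.sign]
      rw [htr, e, Matrix.trace_transpose] at h1
      rw [Matrix.trace_mul_comm] at h1
      exact Matrix.eq_zero_of_trace h1
    exact ⟨tr, fun k => hinv _ _ k.2.1 k.2.2, fun y _ h => hnd y fun z => h z trivial⟩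
  Ad_form := by
    let B : (Matrix a a ℂ × Matrix b b ℂ) →ₗ[ℂ] (Matrix a a ℂ × Matrix b b ℂ) →ₗ[ℂ] ℂ :=
      (Matrix.traceBilin a a).compl₁₂ (LinearMap.fst ℂ _ _) (LinearMap.fst ℂ _ _) +
      (Matrix.traceBilin b b).compl₁₂ (LinearMap.snd ℂ _ _) (LinearMap.snd ℂ _ _)
    have hB : ∀ s t, B s t = (s.1 * t.1).trace + (s.2 * t.2).trace := fun s t => rfl
    have hinv : ∀ k ki : Matrix a a ℂ × Matrix b b ℂ, ki.1 * k.1 = 1 → ki.2 * k.2 = 1 →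
        ∀ X Y : Matrix a a ℂ × Matrix b b ℂ, B (k.1 * (X.1 * ki.1), k.2 * (X.2 * ki.2))
          (k.1 * (Y.1 * ki.1), k.2 * (Y.2 * ki.2)) = B X Y := by
      intro k ki h1 h2 X Y
      rw [hB, hB, Matrix.trace_conj_mul h1, Matrix.trace_conj_mul h2]
    have hnd : ∀ X : Matrix a a ℂ × Matrix b b ℂ,
        X.1ᵀ * F = -(F * X.1) ∧ X.2ᵀ * F' = -(F' * X.2) →
        (∀ Y : Matrix a a ℂ × Matrix b b ℂ,
          Y.1ᵀ * F = -(F * Y.1) ∧ Y.2ᵀ * F' = -(F' * Y.2) → B X Y = 0) → X = 0 := by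
      intro X hX h
      refine Prod.ext (Matrix.eq_zero_of_trace ?_) (Matrix.eq_zero_of_trace ?_)
      · simpa [hB] using h (X.1ᴴ, 0) ⟨hF.skew_conjTranspose hX.1, by simp⟩
      · simpa [hB] using h (0, X.2ᴴ) ⟨by simp, hF'.skew_conjTranspose hX.2⟩
    exact ⟨B, fun k => hinv k.1.val k.1.inv (congrArg Prod.fst k.1.inv_val)
      (congrArg Prod.snd k.1.inv_val),
      fun X hX h => hnd X (isoMember_mem_lieAlg_top.1 hX)
        fun Y hY => h Y (isoMember_mem_lieAlg_top.2 hY)⟩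

/-! ### Full rank over the theta lift -/

/-- The form `F` has a hyperbolic subspace of dimension `2 |n|`: the columns of `U` and of `U'` span
totally isotropic subspaces that are dual to each other. -/
def HasHyperbolicSubspace (n : Type) [Fintype n] [DecidableEq n] (F : Matrix a a ℂ) : Prop :=
  ∃ U U' : Matrix a n ℂ, Uᵀ * F * U = 0 ∧ U'ᵀ * F * U' = 0 ∧ Uᵀ * F * U' = 1

/-- Over `ℂ`, orthonormal vectors `u`, `v` give the isotropic vectors `u ± i v`. -/
theorem hasHyperbolicSubspace_one (f : n ⊕ n ↪ a) : HasHyperbolicSubspace n (1 : Matrix a a ℂ) := by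
  obtain ⟨P, Q, hP, hQ, hPQ, hQP⟩ := Matrix.exists_coordinate_embedding f
  refine ⟨P + Complex.I • Q, (1 / 2 : ℂ) • (P - Complex.I • Q), ?_, ?_, ?_⟩ <;>
  · simp only [Matrix.transpose_add, Matrix.transpose_sub, Matrix.transpose_smul, Matrix.mul_one,
      Matrix.add_mul, Matrix.mul_add, Matrix.sub_mul, Matrix.mul_sub, Matrix.smul_mul,
      Matrix.mul_smul, hP, hQ, hPQ, hQP, smul_smul]
    match_scalars
    all_goals ring_nf
    all_goals norm_num [Complex.I_sq]

theorem hasHyperbolicSubspace_Jmat {m : ℕ} (f : n ↪ Fin m) : HasHyperbolicSubspace n (Jmat m) := by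
  have hP : ((1 : Matrix (Fin m) (Fin m) ℂ).submatrix id f)ᵀ *
      (1 : Matrix (Fin m) (Fin m) ℂ).submatrix id f = 1 := by
    rw [Matrix.transpose_submatrix, Matrix.transpose_one,
      ← Matrix.submatrix_mul _ _ _ _ _ Function.bijective_id, Matrix.one_mul]
    exact Matrix.submatrix_one _ f.injective
  set P := (1 : Matrix (Fin m) (Fin m) ℂ).submatrix id f
  refine ⟨Matrix.fromRows P 0, Matrix.fromRows 0 P, ?_, ?_, ?_⟩ <;>
  · simp [Jmat, Matrix.transpose_fromRows, Matrix.fromCols_mul_fromBlocks,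
      Matrix.fromCols_mul_fromRows, hP]

/-- If `φ w ∈ O` and `φ' w ∈ θ(O)`, then both matrices of `w` are injective: the fibre of `φ` through
`w` contains a pair `(A, B)` of injective matrices, for which `A Bᵀ` has the maximal rank `|n|`, and
a minor of this size does not vanish identically on `θ(O)`. -/
theorem glMember_exists_left_inverses {ε : ℂ} (hF : IsSignedForm ε F) (hF' : IsSignedForm ε F')
    (hU : HasHyperbolicSubspace n F) (hU' : HasHyperbolicSubspace n F')
    {O : Set (Matrix n n ℂ × Matrix n n ℂ)} {O' : Set (Matrix a b ℂ)}
    (hO' : Member.IsThetaLiftOrbit (M := glMember n a b F F' p) (M' := isoMember n a b F F') O O')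
    {w : Matrix a n ℂ × Matrix b n ℂ} (hw : (glMember n a b F F' p).φ w ∈ O)
    (hw' : (isoMember n a b F F').φ w ∈ O') :
    (∃ L : Matrix n a ℂ, L * w.1 = 1) ∧ ∃ L : Matrix n b ℂ, L * w.2 = 1 := by
  have hsymm : ∀ {c : Type} [Fintype c] [DecidableEq c] {G : Matrix c c ℂ} (_ : IsSignedForm ε G)
      (A : Matrix c n ℂ), (Aᵀ * G * A)ᵀ = ε • (Aᵀ * G * A) := by
    intro c _ _ G hG A
    simp [Matrix.transpose_mul, hG.transpose, Matrix.mul_assoc]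
  obtain ⟨U, V, h1, h2, h3⟩ := hU
  obtain ⟨U', V', h1', h2', h3'⟩ := hU'
  obtain ⟨A, L, hL, hA⟩ := hF.exists_gram_eq h1 h2 h3 (hsymm hF w.1)
  obtain ⟨B, L', hL', hB⟩ := hF'.exists_gram_eq h1' h2' h3' (hsymm hF' w.2)
  let ℓ : Matrix a b ℂ →ₗ[ℂ] Matrix n n ℂ :=
    { toFun := fun y => L * y * L'ᵀ
      map_add' := by intro x y; simp [Matrix.mul_add, Matrix.add_mul]
      map_smul' := by intro c x; simp }
  have hne : (ℓ (A * Bᵀ)).det ≠ 0 := by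
    have e : ℓ (A * Bᵀ) = L * A * (L' * B)ᵀ := by
      simp [ℓ, Matrix.transpose_mul, Matrix.mul_assoc]
    rw [e, hL, hL']
    simp
  obtain ⟨k, hk⟩ := hO'.exists_ne_zero (w₁ := (A, B)) hw hw' (Prod.ext hA hB)
    (det_linear_mem_adjoin ℓ) hne
  have h : ∀ k : Matrix a a ℂ × Matrix b b ℂ, (L * (k.1 * (w.1 * w.2ᵀ) * k.2ᵀ) * L'ᵀ).det ≠ 0 →
      (∃ L : Matrix n a ℂ, L * w.1 = 1) ∧ ∃ L : Matrix n b ℂ, L * w.2 = 1 := by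
    intro k hk
    have e : L * (k.1 * (w.1 * w.2ᵀ) * k.2ᵀ) * L'ᵀ = L * k.1 * (w.1 * w.2ᵀ) * (k.2ᵀ * L'ᵀ) := by
      simp only [Matrix.mul_assoc]
    rw [e] at hk
    obtain ⟨hl, R, hR⟩ := Matrix.exists_inverses_of_det_ne_zero hk
    refine ⟨hl, Rᵀ, ?_⟩
    rw [← Matrix.transpose_transpose w.2, ← Matrix.transpose_mul, hR, Matrix.transpose_one]
  exact h k.1.val hk

/-- If `φ w ∈ O` and `φ' w ∈ θ(O)`, then both matrices of `w` are surjective: the fibre of `φ` through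
`w` contains a pair `(A, B)` of surjective matrices, obtained from coordinate embeddings, for which
`Aᵀ F A` and `Bᵀ F' B` have maximal rank. -/
theorem isoMember_exists_right_inverses {ε : ℂ} (hF : IsSignedForm ε F) (hF' : IsSignedForm ε F')
    (f : a ⊕ b ↪ n)
    {O : Set (Matrix a b ℂ)} {O' : Set (Matrix n n ℂ × Matrix n n ℂ)}
    (hO' : Member.IsThetaLiftOrbit (M := isoMember n a b F F') (M' := glMember n a b F F' p) O O')
    {w : Matrix a n ℂ × Matrix b n ℂ} (hw : (isoMember n a b F F').φ w ∈ O)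
    (hw' : (glMember n a b F F' p).φ w ∈ O') :
    (∃ R : Matrix n a ℂ, w.1 * R = 1) ∧ ∃ R : Matrix n b ℂ, w.2 * R = 1 := by
  obtain ⟨P, Q, hP, hQ, hPQ, hQP⟩ := Matrix.exists_coordinate_embedding f
  have key : ∀ {c : Type} [Fintype c] [DecidableEq c] {G : Matrix c c ℂ} (hG : IsSignedForm ε G)
      (C : Matrix c n ℂ) (k : Matrix n c ℂ) (_ : (kᵀ * (Cᵀ * G * C) * k).det ≠ 0),
      ∃ R : Matrix n c ℂ, C * R = 1 := by
    intro c _ _ G hG C k hk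
    rw [Matrix.mul_assoc Cᵀ] at hk
    obtain ⟨⟨L, hL⟩, -⟩ := Matrix.exists_inverses_of_det_ne_zero hk
    refine ⟨Lᵀ, ?_⟩
    rw [← Matrix.transpose_transpose C, ← Matrix.transpose_mul, hL, Matrix.transpose_one]
  let A : Matrix a n ℂ := Pᵀ
  let B : Matrix b n ℂ := (w.1 * w.2ᵀ)ᵀ * Pᵀ + Qᵀ
  have hAB : A * Bᵀ = w.1 * w.2ᵀ := by
    simp only [A, B, Matrix.transpose_add, Matrix.transpose_mul, Matrix.transpose_transpose,
      Matrix.mul_add, hPQ, add_zero]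
    rw [← Matrix.mul_assoc, hP, Matrix.one_mul]
  have hA : A * P = 1 := hP
  have hB : B * Q = 1 := by
    simp only [B, Matrix.add_mul, hQ, Matrix.mul_assoc, hPQ, Matrix.mul_zero, zero_add]
  let ℓ : (Matrix n n ℂ × Matrix n n ℂ) →ₗ[ℂ] Matrix a a ℂ :=
    { toFun := fun y => Pᵀ * y.1 * P
      map_add' := by intro x y; simp [Matrix.mul_add, Matrix.add_mul]
      map_smul' := by intro c x; simp }
  let ℓ' : (Matrix n n ℂ × Matrix n n ℂ) →ₗ[ℂ] Matrix b b ℂ :=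
    { toFun := fun y => Qᵀ * y.2 * Q
      map_add' := by intro x y; simp [Matrix.mul_add, Matrix.add_mul]
      map_smul' := by intro c x; simp }
  have hne : (ℓ (Aᵀ * F * A, Bᵀ * F' * B)).det ≠ 0 := by
    have e : ℓ (Aᵀ * F * A, Bᵀ * F' * B) = (A * P)ᵀ * F * (A * P) := by
      simp [ℓ, Matrix.transpose_mul, Matrix.mul_assoc]
    rw [e, hA]
    simpa using hF.det_ne_zero
  have hne' : (ℓ' (Aᵀ * F * A, Bᵀ * F' * B)).det ≠ 0 := by
    have e : ℓ' (Aᵀ * F * A, Bᵀ * F' * B) = (B * Q)ᵀ * F' * (B * Q) := by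
      simp [ℓ', Matrix.transpose_mul, Matrix.mul_assoc]
    rw [e, hB]
    simpa using hF'.det_ne_zero
  obtain ⟨k, hk⟩ := hO'.exists_ne_zero (w₁ := (A, B)) hw hw' hAB (det_linear_mem_adjoin ℓ) hne
  obtain ⟨k', hk'⟩ := hO'.exists_ne_zero (w₁ := (A, B)) hw hw' hAB (det_linear_mem_adjoin ℓ') hne'
  have h : ∀ ki : Matrix n n ℂ, (Pᵀ * (kiᵀ * (w.1ᵀ * F * w.1) * ki) * P).det ≠ 0 →
      ∃ R : Matrix n a ℂ, w.1 * R = 1 := by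
    intro ki hk
    refine key hF w.1 (ki * P) ?_
    convert hk using 2
    simp only [Matrix.transpose_mul, Matrix.mul_assoc]
  have h' : ∀ k : Matrix n n ℂ, (Qᵀ * (k * (w.2ᵀ * F' * w.2) * kᵀ) * Q).det ≠ 0 →
      ∃ R : Matrix n b ℂ, w.2 * R = 1 := by
    intro k hk
    refine key hF' w.2 (kᵀ * Q) ?_
    convert hk using 2
    simp only [Matrix.transpose_mul, Matrix.transpose_transpose, Matrix.mul_assoc]
  exact ⟨h _ hk, h' _ hk'⟩

end Pairs

/-! ### The pairs of unitary groups -/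

/-- If `A` is fixed by `(k', k)`, then `A Y` and `Y A` are transformed by conjugating `Y`. -/
theorem Matrix.conj_of_fix {m n : Type} [Fintype m] [DecidableEq m] [Fintype n] [DecidableEq n]
    {k' k'i : Matrix m m ℂ} {k ki : Matrix n n ℂ} {A : Matrix m n ℂ} (hk : ki * k = 1)
    (hk' : k'i * k' = 1) (h : k' * A * ki = A) :
    (∀ Y : Matrix n n ℂ, k' * (A * Y) * ki = A * (k * Y * ki)) ∧
      ∀ Y : Matrix m m ℂ, k' * (Y * A) * ki = k' * Y * k'i * A := by
  have e1 : k' * A = A * k := by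
    nth_rewrite 2 [← h]
    rw [Matrix.mul_assoc _ ki k, hk, Matrix.mul_one]
  have e2 : A * ki = k'i * A := by
    nth_rewrite 2 [← h]
    rw [← Matrix.mul_assoc, ← Matrix.mul_assoc, hk', Matrix.one_mul]
  refine ⟨fun Y => ?_, fun Y => ?_⟩
  · rw [← Matrix.mul_assoc, e1]
    simp only [Matrix.mul_assoc]
  · simp only [Matrix.mul_assoc, e2]

section Unitary

variable {n₁ n₂ p q : ℕ}

theorem uSmall_isMatrixGroup : (uSmall n₁ n₂ p q).IsMatrixGroup where
  finite := inferInstanceAs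
    (FiniteDimensional ℂ (Matrix (Fin n₁) (Fin n₁) ℂ × Matrix (Fin n₂) (Fin n₂) ℂ))
  continuousSMul := inferInstanceAs
    (ContinuousSMul ℂ (Matrix (Fin n₁) (Fin n₁) ℂ × Matrix (Fin n₂) (Fin n₂) ℂ))
  exp_add := Matrix.exp_prod_add_smul
  continuous_exp := Matrix.continuous_exp_prod_smul
  onW_linear := by
    let ρ : Matrix (Fin n₁) (Fin n₁) ℂ × Matrix (Fin n₂) (Fin n₂) ℂ →ₗ[ℂ]
        (UnitaryW n₁ n₂ p q →ₗ[ℂ] UnitaryW n₁ n₂ p q) :=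
      LinearMap.mk₂ ℂ (fun k w => (0, w.2.1 * k.2ᵀ, w.2.2.1 * k.1ᵀ, 0))
        (by intro k l w; simp [Matrix.mul_add]) (by intro c k w; simp)
        (by intro k w v; simp [Matrix.add_mul]) (by intro c k w; simp)
    let σ : Matrix (Fin n₁) (Fin n₁) ℂ × Matrix (Fin n₂) (Fin n₂) ℂ →ₗ[ℂ]
        (UnitaryW n₁ n₂ p q →ₗ[ℂ] UnitaryW n₁ n₂ p q) :=
      LinearMap.mk₂ ℂ (fun k w => (w.1 * k.1, 0, 0, w.2.2.2 * k.2))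
        (by intro k l w; simp [Matrix.mul_add]) (by intro c k w; simp)
        (by intro k w v; simp [Matrix.add_mul]) (by intro c k w; simp)
    exact ⟨ρ, σ, fun k => LinearMap.ext fun w => Prod.ext (zero_add _).symm
      (Prod.ext (add_zero _).symm (Prod.ext (add_zero _).symm (zero_add _).symm))⟩

theorem uLarge_isMatrixGroup : (uLarge n₁ n₂ p q).IsMatrixGroup where
  finite := inferInstanceAs
    (FiniteDimensional ℂ (Matrix (Fin p) (Fin p) ℂ × Matrix (Fin q) (Fin q) ℂ))
  continuousSMul := inferInstanceAs
    (ContinuousSMul ℂ (Matrix (Fin p) (Fin p) ℂ × Matrix (Fin q) (Fin q) ℂ))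
  exp_add := Matrix.exp_prod_add_smul
  continuous_exp := Matrix.continuous_exp_prod_smul
  onW_linear := by
    let ρ : Matrix (Fin p) (Fin p) ℂ × Matrix (Fin q) (Fin q) ℂ →ₗ[ℂ]
        (UnitaryW n₁ n₂ p q →ₗ[ℂ] UnitaryW n₁ n₂ p q) :=
      LinearMap.mk₂ ℂ (fun k w => (k.1 * w.1, 0, 0, k.2 * w.2.2.2))
        (by intro k l w; simp [Matrix.add_mul]) (by intro c k w; simp)
        (by intro k w v; simp [Matrix.mul_add]) (by intro c k w; simp)
    let σ : Matrix (Fin p) (Fin p) ℂ × Matrix (Fin q) (Fin q) ℂ →ₗ[ℂ]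
        (UnitaryW n₁ n₂ p q →ₗ[ℂ] UnitaryW n₁ n₂ p q) :=
      LinearMap.mk₂ ℂ (fun k w => (0, k.1ᵀ * w.2.1, k.2ᵀ * w.2.2.1, 0))
        (by intro k l w; simp [Matrix.add_mul]) (by intro c k w; simp)
        (by intro k w v; simp [Matrix.mul_add]) (by intro c k w; simp)
    exact ⟨ρ, σ, fun k => LinearMap.ext fun w => Prod.ext (add_zero _).symm
      (Prod.ext (zero_add _).symm (Prod.ext (zero_add _).symm (add_zero _).symm))⟩

theorem uSmall_mem_lieAlg_top
    (X : Matrix (Fin n₁) (Fin n₁) ℂ × Matrix (Fin n₂) (Fin n₂) ℂ) :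
    X ∈ (uSmall n₁ n₂ p q).lieAlg ⊤ :=
  Submodule.subset_span (uSmall_isMatrixGroup.mem_lieSet_iff.2 fun _ => ⟨trivial, trivial⟩)

theorem uLarge_mem_lieAlg_top
    (X : Matrix (Fin p) (Fin p) ℂ × Matrix (Fin q) (Fin q) ℂ) :
    X ∈ (uLarge n₁ n₂ p q).lieAlg ⊤ :=
  Submodule.subset_span (uLarge_isMatrixGroup.mem_lieSet_iff.2 fun _ => ⟨trivial, trivial⟩)

theorem uSmall_mem_lieSet_stab {s : Matrix (Fin n₁) (Fin n₂) ℂ × Matrix (Fin n₂) (Fin n₁) ℂ}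
    {X : Matrix (Fin n₁) (Fin n₁) ℂ × Matrix (Fin n₂) (Fin n₂) ℂ} :
    X ∈ (uSmall n₁ n₂ p q).lieSet ((uSmall n₁ n₂ p q).stab s) ↔
      X.1ᵀ * s.1 = s.1 * X.2ᵀ ∧ X.2ᵀ * s.2 = s.2 * X.1ᵀ := by
  have h : (∀ t : ℂ,
      ((NormedSpace.exp (-(t • X))).1ᵀ * s.1 * (NormedSpace.exp (t • X)).2ᵀ,
        (NormedSpace.exp (-(t • X))).2ᵀ * s.2 * (NormedSpace.exp (t • X)).1ᵀ) = s) ↔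
      X.1ᵀ * s.1 = s.1 * X.2ᵀ ∧ X.2ᵀ * s.2 = s.2 * X.1ᵀ := by
    simp only [Prod.ext_iff, Matrix.exp_prod, Prod.fst_neg, Prod.snd_neg, Prod.smul_fst,
      Prod.smul_snd, Matrix.exp_neg_smul, Matrix.exp_smul_transpose, forall_and,
      Matrix.forall_exp_fix_iff]
    simp
  refine Iff.trans (uSmall_isMatrixGroup.mem_lieSet_iff.trans ?_) h
  exact forall_congr' fun t => ⟨fun ⟨_, h⟩ => h, fun h => ⟨trivial, h⟩⟩

theorem uLarge_mem_lieSet_stab {y : Matrix (Fin p) (Fin q) ℂ × Matrix (Fin q) (Fin p) ℂ}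
    {X : Matrix (Fin p) (Fin p) ℂ × Matrix (Fin q) (Fin q) ℂ} :
    X ∈ (uLarge n₁ n₂ p q).lieSet ((uLarge n₁ n₂ p q).stab y) ↔
      X.1 * y.1 = y.1 * X.2 ∧ X.2 * y.2 = y.2 * X.1 := by
  have h : (∀ t : ℂ,
      ((NormedSpace.exp (t • X)).1 * y.1 * (NormedSpace.exp (-(t • X))).2,
        (NormedSpace.exp (t • X)).2 * y.2 * (NormedSpace.exp (-(t • X))).1) = y) ↔
      X.1 * y.1 = y.1 * X.2 ∧ X.2 * y.2 = y.2 * X.1 := by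
    simp only [Prod.ext_iff, Matrix.exp_prod, Prod.fst_neg, Prod.snd_neg, Prod.smul_fst,
      Prod.smul_snd, Matrix.exp_neg_smul, forall_and, Matrix.forall_exp_fix_iff]
    simp
  refine Iff.trans (uLarge_isMatrixGroup.mem_lieSet_iff.trans ?_) h
  exact forall_congr' fun t => ⟨fun ⟨_, h⟩ => h, fun h => ⟨trivial, h⟩⟩

theorem uSmall_mem_lieAlg_stab {s : Matrix (Fin n₁) (Fin n₂) ℂ × Matrix (Fin n₂) (Fin n₁) ℂ}
    {X : Matrix (Fin n₁) (Fin n₁) ℂ × Matrix (Fin n₂) (Fin n₂) ℂ} :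
    X ∈ (uSmall n₁ n₂ p q).lieAlg ((uSmall n₁ n₂ p q).stab s) ↔
      X.1ᵀ * s.1 = s.1 * X.2ᵀ ∧ X.2ᵀ * s.2 = s.2 * X.1ᵀ := by
  have hadd : ∀ X Y : Matrix (Fin n₁) (Fin n₁) ℂ × Matrix (Fin n₂) (Fin n₂) ℂ,
      (X.1ᵀ * s.1 = s.1 * X.2ᵀ ∧ X.2ᵀ * s.2 = s.2 * X.1ᵀ) →
      (Y.1ᵀ * s.1 = s.1 * Y.2ᵀ ∧ Y.2ᵀ * s.2 = s.2 * Y.1ᵀ) →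
      (X + Y).1ᵀ * s.1 = s.1 * (X + Y).2ᵀ ∧ (X + Y).2ᵀ * s.2 = s.2 * (X + Y).1ᵀ := by
    intro X Y hX hY
    simp [Matrix.add_mul, Matrix.mul_add, hX, hY]
  exact (Member.mem_lieAlg_iff fun X hX Y hY => uSmall_mem_lieSet_stab.2
    (hadd X Y (uSmall_mem_lieSet_stab.1 hX) (uSmall_mem_lieSet_stab.1 hY))).trans
    uSmall_mem_lieSet_stab

theorem uLarge_mem_lieAlg_stab {y : Matrix (Fin p) (Fin q) ℂ × Matrix (Fin q) (Fin p) ℂ}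
    {X : Matrix (Fin p) (Fin p) ℂ × Matrix (Fin q) (Fin q) ℂ} :
    X ∈ (uLarge n₁ n₂ p q).lieAlg ((uLarge n₁ n₂ p q).stab y) ↔
      X.1 * y.1 = y.1 * X.2 ∧ X.2 * y.2 = y.2 * X.1 := by
  have hadd : ∀ X Y : Matrix (Fin p) (Fin p) ℂ × Matrix (Fin q) (Fin q) ℂ,
      (X.1 * y.1 = y.1 * X.2 ∧ X.2 * y.2 = y.2 * X.1) →
      (Y.1 * y.1 = y.1 * Y.2 ∧ Y.2 * y.2 = y.2 * Y.1) →
      (X + Y).1 * y.1 = y.1 * (X + Y).2 ∧ (X + Y).2 * y.2 = y.2 * (X + Y).1 := by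
    intro X Y hX hY
    simp [Matrix.add_mul, Matrix.mul_add, hX, hY]
  exact (Member.mem_lieAlg_iff fun X hX Y hY => uLarge_mem_lieSet_stab.2
    (hadd X Y (uLarge_mem_lieSet_stab.1 hX) (uLarge_mem_lieSet_stab.1 hY))).trans
    uLarge_mem_lieSet_stab

theorem uSmall_hasInvariantForms : (uSmall n₁ n₂ p q).HasInvariantForms where
  onP_mem _ _ _ := trivial
  onP_form := by
    let B : (Matrix (Fin n₁) (Fin n₂) ℂ × Matrix (Fin n₂) (Fin n₁) ℂ) →ₗ[ℂ]
        (Matrix (Fin n₁) (Fin n₂) ℂ × Matrix (Fin n₂) (Fin n₁) ℂ) →ₗ[ℂ] ℂ :=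
      (Matrix.traceBilin (Fin n₁) (Fin n₂)).compl₁₂ (LinearMap.fst ℂ _ _) (LinearMap.snd ℂ _ _) +
      (Matrix.traceBilin (Fin n₂) (Fin n₁)).compl₁₂ (LinearMap.snd ℂ _ _) (LinearMap.fst ℂ _ _)
    have hB : ∀ s t, B s t = (s.1 * t.2).trace + (s.2 * t.1).trace := fun s t => rfl
    have hinv : ∀ k ki : Matrix (Fin n₁) (Fin n₁) ℂ × Matrix (Fin n₂) (Fin n₂) ℂ,
        ki.1 * k.1 = 1 → ki.2 * k.2 = 1 →
        ∀ s t : Matrix (Fin n₁) (Fin n₂) ℂ × Matrix (Fin n₂) (Fin n₁) ℂ,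
        B (ki.1ᵀ * s.1 * k.2ᵀ, ki.2ᵀ * s.2 * k.1ᵀ) (ki.1ᵀ * t.1 * k.2ᵀ, ki.2ᵀ * t.2 * k.1ᵀ) =
          B s t := by
      intro k ki h1 h2 s t
      have h1t : k.1ᵀ * ki.1ᵀ = 1 := by rw [← Matrix.transpose_mul, h1, Matrix.transpose_one]
      have h2t : k.2ᵀ * ki.2ᵀ = 1 := by rw [← Matrix.transpose_mul, h2, Matrix.transpose_one]
      rw [hB, hB]
      congr 1
      · have e : ki.1ᵀ * s.1 * k.2ᵀ * (ki.2ᵀ * t.2 * k.1ᵀ) =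
            ki.1ᵀ * (s.1 * (k.2ᵀ * ki.2ᵀ) * t.2 * k.1ᵀ) := by
          simp only [Matrix.mul_assoc]
        simp only [e]
        rw [h2t, Matrix.mul_one, Matrix.trace_mul_comm, Matrix.mul_assoc, h1t, Matrix.mul_one]
      · have e : ki.2ᵀ * s.2 * k.1ᵀ * (ki.1ᵀ * t.1 * k.2ᵀ) =
            ki.2ᵀ * (s.2 * (k.1ᵀ * ki.1ᵀ) * t.1 * k.2ᵀ) := by
          simp only [Matrix.mul_assoc]
        simp only [e]
        rw [h1t, Matrix.mul_one, Matrix.trace_mul_comm, Matrix.mul_assoc, h2t, Matrix.mul_one]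
    have hnd : ∀ s : Matrix (Fin n₁) (Fin n₂) ℂ × Matrix (Fin n₂) (Fin n₁) ℂ,
        (∀ t, B s t = 0) → s = 0 := by
      intro s h
      refine Prod.ext (Matrix.eq_zero_of_trace ?_) (Matrix.eq_zero_of_trace ?_)
      · simpa [hB] using h (0, s.1ᴴ)
      · simpa [hB] using h (s.2ᴴ, 0)
    exact ⟨B, fun k => hinv k.1.val k.1.inv (congrArg Prod.fst k.1.inv_val)
      (congrArg Prod.snd k.1.inv_val), fun s _ h => hnd s fun t => h t trivial⟩
  Ad_form := by
    let B : (Matrix (Fin n₁) (Fin n₁) ℂ × Matrix (Fin n₂) (Fin n₂) ℂ) →ₗ[ℂ]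
        (Matrix (Fin n₁) (Fin n₁) ℂ × Matrix (Fin n₂) (Fin n₂) ℂ) →ₗ[ℂ] ℂ :=
      (Matrix.traceBilin (Fin n₁) (Fin n₁)).compl₁₂ (LinearMap.fst ℂ _ _) (LinearMap.fst ℂ _ _) +
      (Matrix.traceBilin (Fin n₂) (Fin n₂)).compl₁₂ (LinearMap.snd ℂ _ _) (LinearMap.snd ℂ _ _)
    have hB : ∀ s t, B s t = (s.1 * t.1).trace + (s.2 * t.2).trace := fun s t => rfl
    have hinv : ∀ k ki : Matrix (Fin n₁) (Fin n₁) ℂ × Matrix (Fin n₂) (Fin n₂) ℂ,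
        ki.1 * k.1 = 1 → ki.2 * k.2 = 1 →
        ∀ X Y : Matrix (Fin n₁) (Fin n₁) ℂ × Matrix (Fin n₂) (Fin n₂) ℂ,
        B (k.1 * (X.1 * ki.1), k.2 * (X.2 * ki.2)) (k.1 * (Y.1 * ki.1), k.2 * (Y.2 * ki.2)) =
          B X Y := by
      intro k ki h1 h2 X Y
      rw [hB, hB, Matrix.trace_conj_mul h1, Matrix.trace_conj_mul h2]
    have hnd : ∀ X : Matrix (Fin n₁) (Fin n₁) ℂ × Matrix (Fin n₂) (Fin n₂) ℂ,
        (∀ Y, B X Y = 0) → X = 0 := by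
      intro X h
      refine Prod.ext (Matrix.eq_zero_of_trace ?_) (Matrix.eq_zero_of_trace ?_)
      · simpa [hB] using h (X.1ᴴ, 0)
      · simpa [hB] using h (0, X.2ᴴ)
    exact ⟨B, fun k => hinv k.1.val k.1.inv (congrArg Prod.fst k.1.inv_val)
      (congrArg Prod.snd k.1.inv_val), fun X _ h => hnd X fun Y => h Y (uSmall_mem_lieAlg_top Y)⟩

theorem uSmall_uLarge_isDualPair : (uSmall n₁ n₂ p q).IsDualPair (uLarge n₁ n₂ p q) where
  commute k k' v := Prod.ext (Matrix.mul_assoc _ _ _) (Prod.ext (Matrix.mul_assoc _ _ _)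
    (Prod.ext (Matrix.mul_assoc _ _ _) (Matrix.mul_assoc _ _ _)))
  φ_onW k v := by
    have h : ∀ k ki : Matrix (Fin n₁) (Fin n₁) ℂ × Matrix (Fin n₂) (Fin n₂) ℂ,
        ((v.1 * ki.1)ᵀ * (v.2.1 * k.2ᵀ), (v.2.2.2 * ki.2)ᵀ * (v.2.2.1 * k.1ᵀ)) =
        (ki.1ᵀ * (v.1ᵀ * v.2.1) * k.2ᵀ, ki.2ᵀ * (v.2.2.2ᵀ * v.2.2.1) * k.1ᵀ) := by
      intro k ki
      simp [Matrix.transpose_mul, Matrix.mul_assoc]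
    exact h _ _
  φ_onW' k v := by
    have h : ∀ k ki : Matrix (Fin p) (Fin p) ℂ × Matrix (Fin q) (Fin q) ℂ,
        ki.1 * k.1 = 1 → ki.2 * k.2 = 1 →
        ((k.1 * v.1)ᵀ * (ki.1ᵀ * v.2.1), (k.2 * v.2.2.2)ᵀ * (ki.2ᵀ * v.2.2.1)) =
        (v.1ᵀ * v.2.1, v.2.2.2ᵀ * v.2.2.1) := by
      intro k ki h1 h2
      have h1t : k.1ᵀ * ki.1ᵀ = 1 := by rw [← Matrix.transpose_mul, h1, Matrix.transpose_one]
      have h2t : k.2ᵀ * ki.2ᵀ = 1 := by rw [← Matrix.transpose_mul, h2, Matrix.transpose_one]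
      rw [Matrix.transpose_mul, Matrix.transpose_mul, Matrix.mul_assoc, Matrix.mul_assoc,
        ← Matrix.mul_assoc k.1ᵀ, ← Matrix.mul_assoc k.2ᵀ, h1t, h2t, Matrix.one_mul, Matrix.one_mul]
    exact h k.1.val k.1.inv (congrArg Prod.fst k.1.inv_val) (congrArg Prod.snd k.1.inv_val)
  φ_zero := Prod.ext (Matrix.mul_zero _) (Matrix.mul_zero _)
  φ'_zero := Prod.ext (Matrix.zero_mul _) (Matrix.zero_mul _)

/-- The velocity of `w = (A, B, C, D)` under `X` in the Lie algebra of `GL_{n₁} × GL_{n₂}`. -/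
def uSmallVelocity (w : UnitaryW n₁ n₂ p q) :
    Matrix (Fin n₁) (Fin n₁) ℂ × Matrix (Fin n₂) (Fin n₂) ℂ →ₗ[ℂ] UnitaryW n₁ n₂ p q where
  toFun X := (-(w.1 * X.1), w.2.1 * X.2ᵀ, w.2.2.1 * X.1ᵀ, -(w.2.2.2 * X.2))
  map_add' X Y := by simp [Matrix.mul_add, add_comm]
  map_smul' c X := by simp

/-- The velocity of `w = (A, B, C, D)` under `X` in the Lie algebra of `GL_p × GL_q`. -/
def uLargeVelocity (w : UnitaryW n₁ n₂ p q) :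
    Matrix (Fin p) (Fin p) ℂ × Matrix (Fin q) (Fin q) ℂ →ₗ[ℂ] UnitaryW n₁ n₂ p q where
  toFun X := (X.1 * w.1, -(X.1ᵀ * w.2.1), -(X.2ᵀ * w.2.2.1), X.2 * w.2.2.2)
  map_add' X Y := by simp [Matrix.add_mul, add_comm]
  map_smul' c X := by simp

/-- The equivariance of the velocities under an element that fixes `w`. -/
theorem uSmallVelocity_uLargeVelocity_equivariant {w : UnitaryW n₁ n₂ p q}
    {k ki : Matrix (Fin n₁) (Fin n₁) ℂ × Matrix (Fin n₂) (Fin n₂) ℂ}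
    {l li : Matrix (Fin p) (Fin p) ℂ × Matrix (Fin q) (Fin q) ℂ}
    (hk₁ : ki.1 * k.1 = 1) (hk₂ : ki.2 * k.2 = 1) (hl₁ : li.1 * l.1 = 1) (hl₂ : li.2 * l.2 = 1)
    (h : (l.1 * w.1 * ki.1, li.1ᵀ * w.2.1 * k.2ᵀ, li.2ᵀ * w.2.2.1 * k.1ᵀ, l.2 * w.2.2.2 * ki.2) =
      w) :
    (∀ X, (l.1 * (uSmallVelocity w X).1 * ki.1, li.1ᵀ * (uSmallVelocity w X).2.1 * k.2ᵀ,
        li.2ᵀ * (uSmallVelocity w X).2.2.1 * k.1ᵀ, l.2 * (uSmallVelocity w X).2.2.2 * ki.2) =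
      uSmallVelocity w (k.1 * (X.1 * ki.1), k.2 * (X.2 * ki.2))) ∧
    ∀ X, (l.1 * (uLargeVelocity w X).1 * ki.1, li.1ᵀ * (uLargeVelocity w X).2.1 * k.2ᵀ,
        li.2ᵀ * (uLargeVelocity w X).2.2.1 * k.1ᵀ, l.2 * (uLargeVelocity w X).2.2.2 * ki.2) =
      uLargeVelocity w (l.1 * (X.1 * li.1), l.2 * (X.2 * li.2)) := by
  have ht : ∀ {n : ℕ} {x y : Matrix (Fin n) (Fin n) ℂ}, x * y = 1 → xᵀ * yᵀ = 1 := by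
    intro n x y h
    rw [← Matrix.transpose_mul, mul_eq_one_comm.1 h, Matrix.transpose_one]
  obtain ⟨a1, a2⟩ := Matrix.conj_of_fix hk₁ hl₁ (congrArg (fun w => w.1) h)
  obtain ⟨b1, b2⟩ := Matrix.conj_of_fix (ht (mul_eq_one_comm.1 hk₂)) (ht (mul_eq_one_comm.1 hl₁))
    (congrArg (fun w => w.2.1) h)
  obtain ⟨c1, c2⟩ := Matrix.conj_of_fix (ht (mul_eq_one_comm.1 hk₁)) (ht (mul_eq_one_comm.1 hl₂))
    (congrArg (fun w => w.2.2.1) h)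
  obtain ⟨d1, d2⟩ := Matrix.conj_of_fix hk₂ hl₂ (congrArg (fun w => w.2.2.2) h)
  constructor
  · intro X
    refine Prod.ext ?_ (Prod.ext ?_ (Prod.ext ?_ ?_))
    · simp [uSmallVelocity, a1, Matrix.mul_assoc]
    · simp [uSmallVelocity, b1, Matrix.mul_assoc, Matrix.transpose_mul]
    · simp [uSmallVelocity, c1, Matrix.mul_assoc, Matrix.transpose_mul]
    · simp [uSmallVelocity, d1, Matrix.mul_assoc]
  · intro X
    refine Prod.ext ?_ (Prod.ext ?_ (Prod.ext ?_ ?_))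
    · simp [uLargeVelocity, a2, Matrix.mul_assoc]
    · simp [uLargeVelocity, b2, Matrix.mul_assoc, Matrix.transpose_mul]
    · simp [uLargeVelocity, c2, Matrix.mul_assoc, Matrix.transpose_mul]
    · simp [uLargeVelocity, d2, Matrix.mul_assoc]

end Unitary

section Unitary

variable {n₁ n₂ p q : ℕ}

/-- For a pair of unitary groups, the quadruples of injective matrices are regular points. -/
theorem uSmall_isRegularPoint {w : UnitaryW n₁ n₂ p q} {LA : Matrix (Fin n₁) (Fin p) ℂ}
    {LB : Matrix (Fin n₂) (Fin p) ℂ} {LC : Matrix (Fin n₁) (Fin q) ℂ}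
    {LD : Matrix (Fin n₂) (Fin q) ℂ} (hA : LA * w.1 = 1) (hB : LB * w.2.1 = 1)
    (hC : LC * w.2.2.1 = 1) (hD : LD * w.2.2.2 = 1) :
    (uSmall n₁ n₂ p q).IsRegularPoint (uLarge n₁ n₂ p q) w := by
  obtain ⟨A, B, C, D⟩ := w
  simp only at hA hB hC hD
  have hAt : Aᵀ * LAᵀ = 1 := by rw [← Matrix.transpose_mul, hA, Matrix.transpose_one]
  have hBt : Bᵀ * LBᵀ = 1 := by rw [← Matrix.transpose_mul, hB, Matrix.transpose_one]
  have hCt : Cᵀ * LCᵀ = 1 := by rw [← Matrix.transpose_mul, hC, Matrix.transpose_one]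
  have hDt : Dᵀ * LDᵀ = 1 := by rw [← Matrix.transpose_mul, hD, Matrix.transpose_one]
  let T : Matrix (Fin p) (Fin p) ℂ × Matrix (Fin q) (Fin q) ℂ →ₗ[ℂ]
      Matrix (Fin n₁) (Fin n₁) ℂ × Matrix (Fin n₂) (Fin n₂) ℂ :=
    { toFun := fun k => (LA * k.1 * A, LD * k.2 * D)
      map_add' := by intro k l; simp [Matrix.mul_add, Matrix.add_mul]
      map_smul' := by intro c k; simp }
  let Δ : UnitaryW n₁ n₂ p q →ₗ[ℂ]
      Matrix (Fin n₁) (Fin n₂) ℂ × Matrix (Fin n₂) (Fin n₁) ℂ :=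
    { toFun := fun v => (v.1ᵀ * B + Aᵀ * v.2.1, v.2.2.2ᵀ * C + Dᵀ * v.2.2.1)
      map_add' := by
        intro u v
        simp only [Prod.fst_add, Prod.snd_add, Matrix.transpose_add, Matrix.add_mul, Matrix.mul_add]
        exact Prod.ext (add_add_add_comm _ _ _ _) (add_add_add_comm _ _ _ _)
      map_smul' := by intro c v; simp }
  have hfree : ∀ k ki : Matrix (Fin n₁) (Fin n₁) ℂ × Matrix (Fin n₂) (Fin n₂) ℂ,
      k.1 * ki.1 = 1 → k.2 * ki.2 = 1 →
      (A * ki.1, B * k.2ᵀ, C * k.1ᵀ, D * ki.2) = (A, B, C, D) → k = 1 := by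
    intro k ki h1 h2 h
    have e1 := congrArg (fun v => LA * v.1) h
    have e2 := congrArg (fun v => LD * v.2.2.2) h
    simp only [← Matrix.mul_assoc, hA, hD, Matrix.one_mul] at e1 e2
    rw [e1, Matrix.mul_one] at h1
    rw [e2, Matrix.mul_one] at h2
    exact Prod.ext h1 h2
  have hlift : ∀ k ki : Matrix (Fin p) (Fin p) ℂ × Matrix (Fin q) (Fin q) ℂ,
      ki.1 * k.1 = 1 → ki.2 * k.2 = 1 →
      (k.1 * (A * Cᵀ) * ki.2, k.2 * (D * Bᵀ) * ki.1) = (A * Cᵀ, D * Bᵀ) →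
      ∃ (u : (Matrix (Fin n₁) (Fin n₁) ℂ)ˣ) (v : (Matrix (Fin n₂) (Fin n₂) ℂ)ˣ),
        (k.1 * A * u⁻¹.val, ki.1ᵀ * B * v.valᵀ, ki.2ᵀ * C * u.valᵀ, k.2 * D * v⁻¹.val) =
          (A, B, C, D) := by
    intro k ki h1 h2 h
    have e1 : k.1 * (A * Cᵀ) * ki.2 = A * Cᵀ := congrArg Prod.fst h
    have e2 : k.2 * (D * Bᵀ) * ki.1 = D * Bᵀ := congrArg Prod.snd h
    obtain ⟨u, u1, u2⟩ := Matrix.exists_intertwining_unit hA hCt h1 (mul_eq_one_comm.1 h2) (by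
      nth_rewrite 2 [← e1]
      rw [Matrix.mul_assoc _ ki.2, h2, Matrix.mul_one])
    obtain ⟨v, v1, v2⟩ := Matrix.exists_intertwining_unit hD hBt h2 (mul_eq_one_comm.1 h1) (by
      nth_rewrite 2 [← e2]
      rw [Matrix.mul_assoc _ ki.1, h1, Matrix.mul_one])
    have ht : ∀ {m n : ℕ} {X Xi : Matrix (Fin m) (Fin m) ℂ} {Y : Matrix (Fin m) (Fin n) ℂ}
        {z : Matrix (Fin n) (Fin n) ℂ}, Xi * X = 1 → z * Yᵀ = Yᵀ * X → Xiᵀ * Y * zᵀ = Y := by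
      intro m n X Xi Y z hX hz
      have e := congrArg Matrix.transpose hz
      rw [Matrix.transpose_mul, Matrix.transpose_mul, Matrix.transpose_transpose] at e
      rw [Matrix.mul_assoc, e, ← Matrix.mul_assoc, ← Matrix.transpose_mul,
        mul_eq_one_comm.1 hX, Matrix.transpose_one, Matrix.one_mul]
    refine ⟨u, v, Prod.ext ?_ (Prod.ext (ht h1 v2) (Prod.ext (ht h2 u2) ?_))⟩
    · simp only
      rw [u1, Matrix.mul_assoc A, u.mul_inv, Matrix.mul_one]
    · simp only
      rw [v1, Matrix.mul_assoc D, v.mul_inv, Matrix.mul_one]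
  have hinf : ∀ X : Matrix (Fin p) (Fin p) ℂ × Matrix (Fin q) (Fin q) ℂ,
      (X.1 * (A * Cᵀ) = A * Cᵀ * X.2 ∧ X.2 * (D * Bᵀ) = D * Bᵀ * X.1) ↔
      ∃ Z : Matrix (Fin n₁) (Fin n₁) ℂ × Matrix (Fin n₂) (Fin n₂) ℂ,
        X.1 * A = A * Z.1 ∧ X.1ᵀ * B = B * Z.2ᵀ ∧ X.2ᵀ * C = C * Z.1ᵀ ∧ X.2 * D = D * Z.2 := by
    intro X
    have ht : ∀ {m n : ℕ} {X : Matrix (Fin m) (Fin m) ℂ} {Y : Matrix (Fin m) (Fin n) ℂ}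
        {z : Matrix (Fin n) (Fin n) ℂ}, z * Yᵀ = Yᵀ * X ↔ Xᵀ * Y = Y * zᵀ := by
      intro m n X Y z
      rw [← Matrix.transpose_inj, Matrix.transpose_mul, Matrix.transpose_mul,
        Matrix.transpose_transpose, eq_comm]
    constructor
    · rintro ⟨h1, h2⟩
      obtain ⟨e1, e2⟩ := Matrix.exists_intertwining hA hCt h1
      obtain ⟨e3, e4⟩ := Matrix.exists_intertwining hD hBt h2
      exact ⟨(_, _), e1, ht.1 e4, ht.1 e2, e3⟩
    · rintro ⟨Z, h1, h2, h3, h4⟩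
      rw [← Matrix.mul_assoc, h1, ← Matrix.mul_assoc X.2, h4, Matrix.mul_assoc A,
        Matrix.mul_assoc D, ht.2 h3, ht.2 h2, Matrix.mul_assoc, Matrix.mul_assoc]
      exact ⟨rfl, rfl⟩
  have hexp : ∀ (X : Matrix (Fin p) (Fin p) ℂ × Matrix (Fin q) (Fin q) ℂ)
      (Z : Matrix (Fin n₁) (Fin n₁) ℂ × Matrix (Fin n₂) (Fin n₂) ℂ),
      X.1 * A = A * Z.1 → X.1ᵀ * B = B * Z.2ᵀ → X.2ᵀ * C = C * Z.1ᵀ → X.2 * D = D * Z.2 →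
      ∀ (t : ℂ) (k : (Matrix (Fin p) (Fin p) ℂ × Matrix (Fin q) (Fin q) ℂ)ˣ),
        k.val = NormedSpace.exp (t • X) →
        (k.val.1 * A * (NormedSpace.exp (-(t • Z))).1,
          k⁻¹.val.1ᵀ * B * (NormedSpace.exp (t • Z)).2ᵀ,
          k⁻¹.val.2ᵀ * C * (NormedSpace.exp (t • Z)).1ᵀ,
          k.val.2 * D * (NormedSpace.exp (-(t • Z))).2) = (A, B, C, D) := by
    intro X Z h1 h2 h3 h4 t k hk
    have hki : k⁻¹.val = NormedSpace.exp (-(t • X)) := by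
      rw [Units.inv_eq_of_mul_eq_one_right]
      rw [hk, Matrix.exp_prod, Matrix.exp_prod]
      exact Prod.ext (Matrix.exp_mul_exp_neg _) (Matrix.exp_mul_exp_neg _)
    rw [hki, hk]
    simp only [Matrix.exp_prod, Prod.fst_neg, Prod.snd_neg, Prod.smul_fst, Prod.smul_snd,
      Matrix.exp_neg_smul, Matrix.exp_smul_transpose]
    refine Prod.ext (Matrix.forall_exp_fix_iff.2 ?_ t) (Prod.ext (Matrix.forall_exp_fix_iff.2 ?_ t)
      (Prod.ext (Matrix.forall_exp_fix_iff.2 ?_ t) (Matrix.forall_exp_fix_iff.2 ?_ t)))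
    · simp [h1]
    · simp [h2]
    · simp [h3]
    · simp [h4]
  refine ⟨?_, ?_, ?_, ?_, ?_⟩
  · intro k hk
    exact Subtype.ext (Units.ext (hfree k.1.val k.1.inv (congrArg Prod.fst k.1.val_inv)
      (congrArg Prod.snd k.1.val_inv) hk))
  · intro k' hk'
    obtain ⟨u, v, h⟩ := hlift k'.1.val k'.1.inv (congrArg Prod.fst k'.1.inv_val)
      (congrArg Prod.snd k'.1.inv_val) hk'
    exact ⟨⟨MulEquiv.prodUnits.symm (u, v), trivial⟩, h⟩
  · refine ⟨T, 0, fun k k' h => ?_⟩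
    have hT : ∀ (k ki : Matrix (Fin n₁) (Fin n₁) ℂ × Matrix (Fin n₂) (Fin n₂) ℂ)
        (l li : Matrix (Fin p) (Fin p) ℂ × Matrix (Fin q) (Fin q) ℂ),
        ki.1 * k.1 = 1 → ki.2 * k.2 = 1 →
        (l.1 * A * ki.1, li.1ᵀ * B * k.2ᵀ, li.2ᵀ * C * k.1ᵀ, l.2 * D * ki.2) = (A, B, C, D) →
        k = T l := by
      intro k ki l li h1 h2 h
      have e1 : l.1 * A * ki.1 = A := congrArg (fun v => v.1) h
      have e2 : l.2 * D * ki.2 = D := congrArg (fun v => v.2.2.2) h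
      refine Prod.ext ?_ ?_
      · simp only [T, LinearMap.coe_mk, AddHom.coe_mk]
        rw [Matrix.mul_assoc, ← Matrix.mul_one (l.1 * A), ← h1, ← Matrix.mul_assoc (l.1 * A), e1,
          ← Matrix.mul_assoc, hA, Matrix.one_mul]
      · simp only [T, LinearMap.coe_mk, AddHom.coe_mk]
        rw [Matrix.mul_assoc, ← Matrix.mul_one (l.2 * D), ← h2, ← Matrix.mul_assoc (l.2 * D), e2,
          ← Matrix.mul_assoc, hD, Matrix.one_mul]
    exact (hT k.1.val k.1.inv k'.1.val k'.1.inv (congrArg Prod.fst k.1.inv_val)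
      (congrArg Prod.snd k.1.inv_val) h).trans (add_zero _).symm
  · intro X hX
    obtain ⟨Z, h1, h2, h3, h4⟩ := (hinf X).1 (uLarge_mem_lieSet_stab.1 hX)
    exact ⟨Z, fun t => ⟨⟨uSmall_isMatrixGroup.expUnit (t • Z), trivial⟩, rfl,
      fun k' hk' => hexp X Z h1 h2 h3 h4 t k'.1 hk'⟩⟩
  · refine ⟨uSmallVelocity (A, B, C, D), uLargeVelocity (A, B, C, D), Δ,
      ?_, ?_, ?_, ?_, ?_, ?_, ?_⟩
    · intro v
      have h : ∀ v : UnitaryW n₁ n₂ p q,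
          ((A + v.1)ᵀ * (B + v.2.1), (D + v.2.2.2)ᵀ * (C + v.2.2.1)) =
          ((Aᵀ * B, Dᵀ * C) :
            Matrix (Fin n₁) (Fin n₂) ℂ × Matrix (Fin n₂) (Fin n₁) ℂ) +
          Δ v + (v.1ᵀ * v.2.1, v.2.2.2ᵀ * v.2.2.1) := by
        intro v
        simp only [Δ, LinearMap.coe_mk, AddHom.coe_mk, Matrix.transpose_add, Matrix.add_mul,
          Matrix.mul_add, Prod.mk_add_mk]
        refine Prod.ext ?_ ?_ <;> · simp only; abel
      exact h v
    · intro s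
      have h : ∀ s : Matrix (Fin n₁) (Fin n₂) ℂ × Matrix (Fin n₂) (Fin n₁) ℂ, ∃ v, Δ v = s := by
        intro s
        refine ⟨(0, LAᵀ * s.1, LDᵀ * s.2, 0), ?_⟩
        simp [Δ, ← Matrix.mul_assoc, hAt, hDt]
      exact ⟨fun _ => h s, fun _ => trivial⟩
    · intro v
      have h : Δ v = 0 ↔ ∃ X, uLargeVelocity (A, B, C, D) X = v := by
        have e1 : v.1ᵀ * B + Aᵀ * v.2.1 = 0 ↔ v.2.1ᵀ * A + Bᵀ * v.1 = 0 := by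
          rw [← Matrix.transpose_inj, add_comm]
          simp [Matrix.transpose_mul]
        have e2 : v.2.2.2ᵀ * C + Dᵀ * v.2.2.1 = 0 ↔ v.2.2.1ᵀ * D + Cᵀ * v.2.2.2 = 0 := by
          rw [← Matrix.transpose_inj, add_comm]
          simp [Matrix.transpose_mul]
        refine Prod.ext_iff.trans ((and_congr
          (e1.trans (Matrix.exists_simultaneous_solution hBt hA))
          (e2.trans (Matrix.exists_simultaneous_solution hCt hD))).trans ?_)
        simp only [Prod.ext_iff]
        constructor
        · rintro ⟨⟨X, h1, h2⟩, ⟨Y, h3, h4⟩⟩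
          refine ⟨(X, Y), h2, ?_, ?_, h4⟩
          · simpa [uLargeVelocity, Matrix.transpose_mul] using congrArg Matrix.transpose h1
          · simpa [uLargeVelocity, Matrix.transpose_mul] using congrArg Matrix.transpose h3
        · rintro ⟨⟨X, Y⟩, h1, h2, h3, h4⟩
          refine ⟨⟨X, ?_, h1⟩, ⟨Y, ?_, h4⟩⟩
          · simpa [uLargeVelocity, Matrix.transpose_mul] using congrArg Matrix.transpose h2
          · simpa [uLargeVelocity, Matrix.transpose_mul] using congrArg Matrix.transpose h3
      exact h.trans ⟨fun ⟨X, hX⟩ => ⟨X, uLarge_mem_lieAlg_top X, hX⟩, fun ⟨X, _, hX⟩ => ⟨X, hX⟩⟩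
    · intro X _ hX
      have h : ∀ X : Matrix (Fin n₁) (Fin n₁) ℂ × Matrix (Fin n₂) (Fin n₂) ℂ,
          uSmallVelocity (A, B, C, D) X = 0 → X = 0 := by
        intro X hX
        have e1 : -(A * X.1) = 0 := congrArg (fun v => v.1) hX
        have e2 : -(D * X.2) = 0 := congrArg (fun v => v.2.2.2) hX
        refine Prod.ext ?_ ?_
        · rw [← Matrix.one_mul X.1, ← hA, Matrix.mul_assoc, neg_eq_zero.1 e1, Matrix.mul_zero]; rfl
        · rw [← Matrix.one_mul X.2, ← hD, Matrix.mul_assoc, neg_eq_zero.1 e2, Matrix.mul_zero]; rfl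
      exact h X hX
    · intro X _
      refine Iff.trans ?_ uSmall_mem_lieAlg_stab.symm
      have h : ∀ X : Matrix (Fin n₁) (Fin n₁) ℂ × Matrix (Fin n₂) (Fin n₂) ℂ,
          Δ (uSmallVelocity (A, B, C, D) X) = 0 ↔
          X.1ᵀ * (Aᵀ * B) = Aᵀ * B * X.2ᵀ ∧ X.2ᵀ * (Dᵀ * C) = Dᵀ * C * X.1ᵀ := by
        intro X
        rw [Prod.ext_iff]
        simp [Δ, uSmallVelocity, Matrix.mul_assoc, Matrix.transpose_mul, neg_add_eq_zero]
      exact h X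
    · intro X _
      refine uLarge_mem_lieAlg_stab.trans ((hinf X).trans ?_)
      have h : ∀ (X : Matrix (Fin p) (Fin p) ℂ × Matrix (Fin q) (Fin q) ℂ)
          (Z : Matrix (Fin n₁) (Fin n₁) ℂ × Matrix (Fin n₂) (Fin n₂) ℂ),
          (X.1 * A = A * Z.1 ∧ X.1ᵀ * B = B * Z.2ᵀ ∧ X.2ᵀ * C = C * Z.1ᵀ ∧ X.2 * D = D * Z.2) ↔
          uSmallVelocity (A, B, C, D) (-Z) = uLargeVelocity (A, B, C, D) X := by
        intro X Z
        simp only [Prod.ext_iff, uSmallVelocity, uLargeVelocity, LinearMap.coe_mk, AddHom.coe_mk,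
          Prod.fst_neg, Prod.snd_neg, Matrix.transpose_neg, Matrix.mul_neg, neg_neg, neg_inj]
        exact and_congr eq_comm (and_congr eq_comm (and_congr eq_comm eq_comm))
      constructor
      · rintro ⟨Z, hZ⟩
        exact ⟨_, uSmall_mem_lieAlg_top (-Z), (h X Z).1 hZ⟩
      · rintro ⟨Z, _, hZ⟩
        have h' : ∀ (X : Matrix (Fin p) (Fin p) ℂ × Matrix (Fin q) (Fin q) ℂ)
            (Z : Matrix (Fin n₁) (Fin n₁) ℂ × Matrix (Fin n₂) (Fin n₂) ℂ),
            uSmallVelocity (A, B, C, D) Z = uLargeVelocity (A, B, C, D) X →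
            uSmallVelocity (A, B, C, D) (- -Z) = uLargeVelocity (A, B, C, D) X := by
          intro X Z h
          rwa [neg_neg]
        exact ⟨_, (h X _).2 (h' X Z hZ)⟩
    · intro k k' hk
      exact uSmallVelocity_uLargeVelocity_equivariant (w := (A, B, C, D)) (k := k.1.val)
        (ki := k.1.inv) (l := k'.1.val) (li := k'.1.inv) (congrArg Prod.fst k.1.inv_val)
        (congrArg Prod.snd k.1.inv_val) (congrArg Prod.fst k'.1.inv_val)
        (congrArg Prod.snd k'.1.inv_val) hk

/-- If `φ w ∈ O` and `φ' w ∈ θ(O)`, then the four matrices of `w = (A, B, C, D)` are injective: the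
fibre of `φ` through `w` contains a quadruple of injective matrices, obtained from coordinate
embeddings, for which `A Cᵀ` and `D Bᵀ` have maximal rank. -/
theorem uSmall_exists_left_inverses (f : Fin n₁ ⊕ Fin n₂ ↪ Fin p) (g : Fin n₂ ⊕ Fin n₁ ↪ Fin q)
    {O : Set (Matrix (Fin n₁) (Fin n₂) ℂ × Matrix (Fin n₂) (Fin n₁) ℂ)}
    {O' : Set (Matrix (Fin p) (Fin q) ℂ × Matrix (Fin q) (Fin p) ℂ)}
    (hO' : Member.IsThetaLiftOrbit (M := uSmall n₁ n₂ p q) (M' := uLarge n₁ n₂ p q) O O')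
    {w : UnitaryW n₁ n₂ p q} (hw : (uSmall n₁ n₂ p q).φ w ∈ O)
    (hw' : (uLarge n₁ n₂ p q).φ w ∈ O') :
    ((∃ L : Matrix (Fin n₁) (Fin p) ℂ, L * w.1 = 1) ∧
      ∃ L : Matrix (Fin n₁) (Fin q) ℂ, L * w.2.2.1 = 1) ∧
    (∃ L : Matrix (Fin n₂) (Fin q) ℂ, L * w.2.2.2 = 1) ∧
      ∃ L : Matrix (Fin n₂) (Fin p) ℂ, L * w.2.1 = 1 := by
  obtain ⟨P, Q, hP, hQ, hPQ, hQP⟩ := Matrix.exists_coordinate_embedding f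
  obtain ⟨P', Q', hP', hQ', hPQ', hQP'⟩ := Matrix.exists_coordinate_embedding g
  let B := P * (w.1ᵀ * w.2.1) + Q
  let C := P' * (w.2.2.2ᵀ * w.2.2.1) + Q'
  have hB : Pᵀ * B = w.1ᵀ * w.2.1 := by
    simp only [B, Matrix.mul_add, hPQ, ← Matrix.mul_assoc, hP, Matrix.one_mul, add_zero]
  have hC : P'ᵀ * C = w.2.2.2ᵀ * w.2.2.1 := by
    simp only [C, Matrix.mul_add, hPQ', ← Matrix.mul_assoc, hP', Matrix.one_mul, add_zero]
  have hQB : Qᵀ * B = 1 := by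
    simp only [B, Matrix.mul_add, hQ, ← Matrix.mul_assoc, hQP, Matrix.zero_mul, zero_add]
  have hQC : Q'ᵀ * C = 1 := by
    simp only [C, Matrix.mul_add, hQ', ← Matrix.mul_assoc, hQP', Matrix.zero_mul, zero_add]
  let ℓ : Matrix (Fin p) (Fin q) ℂ × Matrix (Fin q) (Fin p) ℂ →ₗ[ℂ] Matrix (Fin n₁) (Fin n₁) ℂ :=
    { toFun := fun y => Pᵀ * y.1 * Q'
      map_add' := by intro x y; simp [Matrix.mul_add, Matrix.add_mul]
      map_smul' := by intro c x; simp }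
  let ℓ' : Matrix (Fin p) (Fin q) ℂ × Matrix (Fin q) (Fin p) ℂ →ₗ[ℂ] Matrix (Fin n₂) (Fin n₂) ℂ :=
    { toFun := fun y => P'ᵀ * y.2 * Q
      map_add' := by intro x y; simp [Matrix.mul_add, Matrix.add_mul]
      map_smul' := by intro c x; simp }
  have hne : (ℓ (P * Cᵀ, P' * Bᵀ)).det ≠ 0 := by
    have e : ℓ (P * Cᵀ, P' * Bᵀ) = Pᵀ * P * (Q'ᵀ * C)ᵀ := by
      simp [ℓ, Matrix.transpose_mul, Matrix.mul_assoc]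
    rw [e, hP, hQC]
    simp
  have hne' : (ℓ' (P * Cᵀ, P' * Bᵀ)).det ≠ 0 := by
    have e : ℓ' (P * Cᵀ, P' * Bᵀ) = P'ᵀ * P' * (Qᵀ * B)ᵀ := by
      simp [ℓ', Matrix.transpose_mul, Matrix.mul_assoc]
    rw [e, hP', hQB]
    simp
  obtain ⟨k, hk⟩ := hO'.exists_ne_zero (w₁ := (P, B, C, P')) hw hw' (Prod.ext hB hC)
    (det_linear_mem_adjoin ℓ) hne
  obtain ⟨k', hk'⟩ := hO'.exists_ne_zero (w₁ := (P, B, C, P')) hw hw' (Prod.ext hB hC)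
    (det_linear_mem_adjoin ℓ') hne'
  have key : ∀ {m n l : ℕ} {S : Matrix (Fin l) (Fin m) ℂ} {a : Matrix (Fin m) (Fin m) ℂ}
      {X : Matrix (Fin m) (Fin l) ℂ} {Y : Matrix (Fin n) (Fin l) ℂ} {b : Matrix (Fin n) (Fin n) ℂ}
      {U : Matrix (Fin n) (Fin l) ℂ}, (S * (a * (X * Yᵀ) * b) * U).det ≠ 0 →
      (∃ L : Matrix (Fin l) (Fin m) ℂ, L * X = 1) ∧ ∃ L : Matrix (Fin l) (Fin n) ℂ, L * Y = 1 := by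
    intro m n l S a X Y b U h
    have e : S * (a * (X * Yᵀ) * b) * U = S * a * (X * Yᵀ) * (b * U) := by
      simp only [Matrix.mul_assoc]
    rw [e] at h
    obtain ⟨hl, R, hR⟩ := Matrix.exists_inverses_of_det_ne_zero h
    refine ⟨hl, Rᵀ, ?_⟩
    rw [← Matrix.transpose_transpose Y, ← Matrix.transpose_mul, hR, Matrix.transpose_one]
  exact ⟨key hk, key hk'⟩

end Unitary

/-! ### The pairs of complex groups -/

namespace IsSignedForm

variable {m : Type} [Fintype m] [DecidableEq m] {ε : ℂ} {F : Matrix m m ℂ}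

/-- The isometry group of `F` is closed under the transpose, because `F⁻¹ = ε F`. -/
theorem isometry_transpose (hF : IsSignedForm ε F) {g : Matrix m m ℂ} (hg : gᵀ * F * g = F) :
    g * F * gᵀ = F := by
  have h := mul_eq_one_comm.1 (hF.mul_eq_one_of_isometry hg)
  have h1 := congrArg (fun x => x * F) h
  simp only [Matrix.mul_smul, Matrix.smul_mul, Matrix.mul_assoc, hF.mul_self, Matrix.mul_one,
    smul_smul, hF.sign, one_smul, Matrix.one_mul] at h1
  rw [Matrix.mul_assoc, h1]

theorem skew_transpose (hF : IsSignedForm ε F) {X : Matrix m m ℂ} (hX : Xᵀ * F = -(F * X)) :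
    Xᵀᵀ * F = -(F * Xᵀ) := by
  have h1 := congrArg (fun x => ε • (F * x * F)) hX
  simp only [Matrix.mul_neg, Matrix.neg_mul, hF.mul_mul_self, Matrix.mul_assoc, hF.mul_self,
    Matrix.mul_smul, Matrix.smul_mul, smul_neg, smul_smul, hF.sign, one_smul, Matrix.mul_one] at h1
  rw [h1, Matrix.transpose_transpose, neg_neg]

end IsSignedForm

section Complex

variable {n p : ℕ}

theorem spC_isMatrixGroup : (spC n p).IsMatrixGroup where
  finite := inferInstanceAs (FiniteDimensional ℂ (Matrix (Fin n ⊕ Fin n) (Fin n ⊕ Fin n) ℂ))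
  continuousSMul := inferInstanceAs (ContinuousSMul ℂ (Matrix (Fin n ⊕ Fin n) (Fin n ⊕ Fin n) ℂ))
  exp_add := Matrix.exp_add_smul
  continuous_exp := Matrix.continuous_exp_smul
  onW_linear := by
    let σ : (Matrix (Fin n ⊕ Fin n) (Fin n ⊕ Fin n) ℂ) →ₗ[ℂ]
        (Matrix (Fin p) (Fin n ⊕ Fin n) ℂ →ₗ[ℂ] Matrix (Fin p) (Fin n ⊕ Fin n) ℂ) :=
      LinearMap.mk₂ ℂ (fun k w => w * k) (by intro k l w; simp [Matrix.mul_add])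
        (by intro c k w; simp) (by intro k w v; simp [Matrix.add_mul]) (by intro c k w; simp)
    exact ⟨0, σ, fun k => LinearMap.ext fun w => (zero_add _).symm⟩

theorem oC_isMatrixGroup : (oC n p).IsMatrixGroup where
  finite := inferInstanceAs (FiniteDimensional ℂ (Matrix (Fin p) (Fin p) ℂ))
  continuousSMul := inferInstanceAs (ContinuousSMul ℂ (Matrix (Fin p) (Fin p) ℂ))
  exp_add := Matrix.exp_add_smul
  continuous_exp := Matrix.continuous_exp_smul
  onW_linear := by
    let ρ : Matrix (Fin p) (Fin p) ℂ →ₗ[ℂ]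
        (Matrix (Fin p) (Fin n ⊕ Fin n) ℂ →ₗ[ℂ] Matrix (Fin p) (Fin n ⊕ Fin n) ℂ) :=
      LinearMap.mk₂ ℂ (fun k w => k * w) (by intro k l w; simp [Matrix.add_mul])
        (by intro c k w; simp) (by intro k w v; simp [Matrix.mul_add]) (by intro c k w; simp)
    exact ⟨ρ, 0, fun k => LinearMap.ext fun w => (add_zero _).symm⟩

theorem spC_mem_lieSet_stab {s X : Matrix (Fin n ⊕ Fin n) (Fin n ⊕ Fin n) ℂ} :
    X ∈ (spC n p).lieSet ((spC n p).stab s) ↔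
      Xᵀ * Jmat n = -(Jmat n * X) ∧ Xᵀ * s = -(s * X) := by
  have h : (∀ t : ℂ, (NormedSpace.exp (t • X))ᵀ * Jmat n * NormedSpace.exp (t • X) = Jmat n ∧
      (NormedSpace.exp (-(t • X)))ᵀ * s * NormedSpace.exp (-(t • X)) = s) ↔
      Xᵀ * Jmat n = -(Jmat n * X) ∧ Xᵀ * s = -(s * X) := by
    simp only [Matrix.exp_neg_smul, Matrix.exp_smul_transpose, forall_and,
      Matrix.forall_exp_fix_iff]
    simp [neg_eq_iff_eq_neg]
  refine Iff.trans (spC_isMatrixGroup.mem_lieSet_iff.trans ?_) h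
  exact forall_congr' fun t => ⟨fun ⟨h1, h2⟩ => ⟨h1, h2⟩, fun h => ⟨h.1, h.2⟩⟩

theorem oC_mem_lieSet_stab {s X : Matrix (Fin p) (Fin p) ℂ} :
    X ∈ (oC n p).lieSet ((oC n p).stab s) ↔ Xᵀ * 1 = -(1 * X) ∧ X * s = -(s * Xᵀ) := by
  have h : (∀ t : ℂ, (NormedSpace.exp (t • X))ᵀ * 1 * NormedSpace.exp (t • X) = 1 ∧
      NormedSpace.exp (t • X) * s * (NormedSpace.exp (t • X))ᵀ = s) ↔
      Xᵀ * 1 = -(1 * X) ∧ X * s = -(s * Xᵀ) := by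
    simp only [Matrix.exp_smul_transpose, forall_and, Matrix.forall_exp_fix_iff]
  refine Iff.trans (oC_isMatrixGroup.mem_lieSet_iff.trans ?_) h
  exact forall_congr' fun t => ⟨fun ⟨h1, h2⟩ => ⟨h1, h2⟩, fun h => ⟨h.1, h.2⟩⟩

theorem spC_mem_lieAlg_stab {s X : Matrix (Fin n ⊕ Fin n) (Fin n ⊕ Fin n) ℂ} :
    X ∈ (spC n p).lieAlg ((spC n p).stab s) ↔
      Xᵀ * Jmat n = -(Jmat n * X) ∧ Xᵀ * s = -(s * X) := by
  have hadd : ∀ X Y : Matrix (Fin n ⊕ Fin n) (Fin n ⊕ Fin n) ℂ,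
      (Xᵀ * Jmat n = -(Jmat n * X) ∧ Xᵀ * s = -(s * X)) →
      (Yᵀ * Jmat n = -(Jmat n * Y) ∧ Yᵀ * s = -(s * Y)) →
      (X + Y)ᵀ * Jmat n = -(Jmat n * (X + Y)) ∧ (X + Y)ᵀ * s = -(s * (X + Y)) := by
    intro X Y hX hY
    simp [Matrix.add_mul, Matrix.mul_add, hX, hY, add_comm]
  exact (Member.mem_lieAlg_iff fun X hX Y hY => spC_mem_lieSet_stab.2
    (hadd X Y (spC_mem_lieSet_stab.1 hX) (spC_mem_lieSet_stab.1 hY))).trans spC_mem_lieSet_stab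

theorem oC_mem_lieAlg_stab {s X : Matrix (Fin p) (Fin p) ℂ} :
    X ∈ (oC n p).lieAlg ((oC n p).stab s) ↔ Xᵀ * 1 = -(1 * X) ∧ X * s = -(s * Xᵀ) := by
  have hadd : ∀ X Y : Matrix (Fin p) (Fin p) ℂ,
      (Xᵀ * 1 = -(1 * X) ∧ X * s = -(s * Xᵀ)) → (Yᵀ * 1 = -(1 * Y) ∧ Y * s = -(s * Yᵀ)) →
      (X + Y)ᵀ * 1 = -(1 * (X + Y)) ∧ (X + Y) * s = -(s * (X + Y)ᵀ) := by
    rintro X Y ⟨hX1, hX2⟩ ⟨hY1, hY2⟩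
    rw [Matrix.transpose_add, Matrix.add_mul, Matrix.add_mul, Matrix.mul_add, Matrix.mul_add, hX1,
      hX2, hY1, hY2, neg_add, neg_add]
    exact ⟨rfl, rfl⟩
  exact (Member.mem_lieAlg_iff fun X hX Y hY => oC_mem_lieSet_stab.2
    (hadd X Y (oC_mem_lieSet_stab.1 hX) (oC_mem_lieSet_stab.1 hY))).trans oC_mem_lieSet_stab

theorem spC_mem_lieAlg_top {X : Matrix (Fin n ⊕ Fin n) (Fin n ⊕ Fin n) ℂ} :
    X ∈ (spC n p).lieAlg ⊤ ↔ Xᵀ * Jmat n = -(Jmat n * X) := by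
  have h0 : (spC n p).stab (0 : Matrix (Fin n ⊕ Fin n) (Fin n ⊕ Fin n) ℂ) = ⊤ :=
    eq_top_iff.2 fun k _ => map_zero ((spC n p).onP k)
  have h := spC_mem_lieAlg_stab (n := n) (p := p) (s := 0) (X := X)
  simpa only [h0, Matrix.mul_zero, Matrix.zero_mul, neg_zero, and_true] using h

theorem oC_mem_lieAlg_top {X : Matrix (Fin p) (Fin p) ℂ} :
    X ∈ (oC n p).lieAlg ⊤ ↔ Xᵀ * 1 = -(1 * X) := by
  have h0 : (oC n p).stab (0 : Matrix (Fin p) (Fin p) ℂ) = ⊤ :=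
    eq_top_iff.2 fun k _ => map_zero ((oC n p).onP k)
  have h := oC_mem_lieAlg_stab (n := n) (p := p) (s := 0) (X := X)
  rw [h0, Matrix.mul_zero, Matrix.zero_mul, neg_zero] at h
  exact h.trans (and_iff_left rfl)

theorem spC_hasInvariantForms : (spC n p).HasInvariantForms where
  onP_mem k s hs := by
    have h : ∀ g s : Matrix (Fin n ⊕ Fin n) (Fin n ⊕ Fin n) ℂ, sᵀ = s → (gᵀ * s * g)ᵀ =
        gᵀ * s * g := by
      intro g s hs
      simp [Matrix.transpose_mul, hs, Matrix.mul_assoc]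
    exact h _ _ hs
  onP_form := by
    have hJ := isSignedForm_Jmat n
    let B : (Matrix (Fin n ⊕ Fin n) (Fin n ⊕ Fin n) ℂ) →ₗ[ℂ] (Matrix (Fin n ⊕ Fin n)
        (Fin n ⊕ Fin n) ℂ) →ₗ[ℂ] ℂ :=
      LinearMap.mk₂ ℂ (fun s t => (Jmat n * s * Jmat n * t).trace)
        (by intro x y z; simp [Matrix.mul_add, Matrix.add_mul]) (by intro c x y; simp)
        (by intro x y z; simp [Matrix.mul_add]) (by intro c x y; simp)
    have hB : ∀ s t, B s t = (Jmat n * s * Jmat n * t).trace := fun s t => rfl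
    have hinv : ∀ k : Matrix (Fin n ⊕ Fin n) (Fin n ⊕ Fin n) ℂ, kᵀ * Jmat n * k = Jmat n →
        ∀ s t : Matrix (Fin n ⊕ Fin n) (Fin n ⊕ Fin n) ℂ,
        B (kᵀ * s * k) (kᵀ * t * k) = B s t := by
      intro k hk s t
      have hk' := hJ.isometry_transpose hk
      have e : Jmat n * (kᵀ * s * k) * Jmat n * (kᵀ * t * k) =
          Jmat n * kᵀ * (s * (k * Jmat n * kᵀ) * t * k) := by
        simp only [Matrix.mul_assoc]
      rw [hB, hB, e, hk', Matrix.trace_mul_comm]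
      have e' : s * Jmat n * t * k * (Jmat n * kᵀ) = s * Jmat n * t * (k * Jmat n * kᵀ) := by
        simp only [Matrix.mul_assoc]
      rw [e', hk', Matrix.trace_mul_comm]
      simp only [Matrix.mul_assoc]
    have hnd : ∀ s : Matrix (Fin n ⊕ Fin n) (Fin n ⊕ Fin n) ℂ, sᵀ = s → (∀ t : Matrix
        (Fin n ⊕ Fin n) (Fin n ⊕ Fin n) ℂ, tᵀ = t → B s t = 0) → s = 0 := by
      intro s hs h
      have h1 := h (Jmat n * s * Jmat n)ᴴ (by
        have e : (Jmat n * s * Jmat n)ᵀ = Jmat n * s * Jmat n := by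
          rw [Matrix.transpose_mul, Matrix.transpose_mul, hs, hJ.transpose]
          simp [Matrix.mul_assoc]
        exact congrArg Matrix.conjTranspose e)
      have h2 := congrArg (fun x => Jmat n * x * Jmat n) (Matrix.eq_zero_of_trace
          ((hB _ _).symm.trans h1))
      simpa [Matrix.mul_assoc, hJ.mul_mul_self, hJ.mul_self] using h2
    exact ⟨B, fun k => hinv _ (k⁻¹).2, hnd⟩
  Ad_form := by
    have hJ := isSignedForm_Jmat n
    have hnd : ∀ X : Matrix (Fin n ⊕ Fin n) (Fin n ⊕ Fin n) ℂ, Xᵀ * Jmat n = -(Jmat n * X) →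
        (∀ Y : Matrix (Fin n ⊕ Fin n) (Fin n ⊕ Fin n) ℂ, Yᵀ * Jmat n = -(Jmat n * Y) →
            Matrix.traceBilin _ _ X Y = 0) → X = 0 :=
      fun X hX h => Matrix.eq_zero_of_trace (h Xᴴ (hJ.skew_conjTranspose hX))
    exact ⟨Matrix.traceBilin _ _, fun k => Matrix.trace_conj_mul k.1.inv_val,
      fun X hX h => hnd X (spC_mem_lieAlg_top.1 hX) fun Y hY => h Y (spC_mem_lieAlg_top.2 hY)⟩

theorem oC_hasInvariantForms : (oC n p).HasInvariantForms where
  onP_mem k s hs := by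
    have h : ∀ g s : Matrix (Fin p) (Fin p) ℂ, sᵀ = -s → (g * s * gᵀ)ᵀ = -(g * s * gᵀ) := by
      intro g s hs
      simp [Matrix.transpose_mul, hs, Matrix.mul_assoc]
    exact h _ _ hs
  onP_form := by
    have hinv : ∀ k : Matrix (Fin p) (Fin p) ℂ, kᵀ * 1 * k = 1 →
        ∀ s t : Matrix (Fin p) (Fin p) ℂ,
        Matrix.traceBilin _ _ (k * s * kᵀ) (k * t * kᵀ) = Matrix.traceBilin _ _ s t := by
      intro k hk s t
      rw [Matrix.mul_one] at hk
      simp only [Matrix.mul_assoc]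
      exact Matrix.trace_conj_mul hk s t
    have hnd : ∀ s : Matrix (Fin p) (Fin p) ℂ, sᵀ = -s →
        (∀ t : Matrix (Fin p) (Fin p) ℂ, tᵀ = -t → Matrix.traceBilin _ _ s t = 0) → s = 0 := by
      intro s hs h
      refine Matrix.eq_zero_of_trace (h sᴴ ?_)
      rw [← Matrix.conjTranspose_neg, ← hs]
      rfl
    exact ⟨Matrix.traceBilin _ _, fun k => hinv _ k.2, hnd⟩
  Ad_form := by
    have hnd : ∀ X : Matrix (Fin p) (Fin p) ℂ, Xᵀ * 1 = -(1 * X) →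
        (∀ Y : Matrix (Fin p) (Fin p) ℂ, Yᵀ * 1 = -(1 * Y) → Matrix.traceBilin _ _ X Y = 0) →
        X = 0 :=
      fun X hX h => Matrix.eq_zero_of_trace (h Xᴴ (isSignedForm_one.skew_conjTranspose hX))
    exact ⟨Matrix.traceBilin _ _, fun k => Matrix.trace_conj_mul k.1.inv_val,
      fun X hX h => hnd X (oC_mem_lieAlg_top.1 hX) fun Y hY => h Y (oC_mem_lieAlg_top.2 hY)⟩

theorem spC_oC_isDualPair : (spC n p).IsDualPair (oC n p) where
  commute k k' v := Matrix.mul_assoc k'.1.val v k.1⁻¹.val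
  φ_onW k v := by
    have h : ∀ ki : Matrix (Fin n ⊕ Fin n) (Fin n ⊕ Fin n) ℂ, (v * ki)ᵀ * (v * ki) = kiᵀ *
        (vᵀ * v) * ki := by
      intro ki
      simp [Matrix.transpose_mul, Matrix.mul_assoc]
    exact h _
  φ_onW' k v := by
    have h : ∀ k : Matrix (Fin p) (Fin p) ℂ, kᵀ * 1 * k = 1 → (k * v)ᵀ * (k * v) = vᵀ * v := by
      intro k hk
      rw [Matrix.mul_one] at hk
      rw [Matrix.transpose_mul, Matrix.mul_assoc, ← Matrix.mul_assoc kᵀ, hk, Matrix.one_mul]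
    exact h _ k.2
  φ_zero := Matrix.mul_zero _
  φ'_zero := by
    have h : (0 : Matrix (Fin p) (Fin n ⊕ Fin n) ℂ) * Jmat n *
        (0 : Matrix (Fin p) (Fin n ⊕ Fin n) ℂ)ᵀ = 0 := by simp
    exact h

theorem oC_spC_isDualPair : (oC n p).IsDualPair (spC n p) where
  commute k k' v := (Matrix.mul_assoc k.1.val v k'.1⁻¹.val).symm
  φ_onW k v := by
    have h : ∀ k : Matrix (Fin p) (Fin p) ℂ,
        k * v * Jmat n * (k * v)ᵀ = k * (v * Jmat n * vᵀ) * kᵀ := by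
      intro k
      simp [Matrix.transpose_mul, Matrix.mul_assoc]
    exact h _
  φ_onW' k v := by
    have h : ∀ g : Matrix (Fin n ⊕ Fin n) (Fin n ⊕ Fin n) ℂ, gᵀ * Jmat n * g = Jmat n →
        v * g * Jmat n * (v * g)ᵀ = v * Jmat n * vᵀ := by
      intro g hg
      have e : v * g * Jmat n * (v * g)ᵀ = v * (g * Jmat n * gᵀ) * vᵀ := by
        simp [Matrix.transpose_mul, Matrix.mul_assoc]
      rw [e, (isSignedForm_Jmat n).isometry_transpose hg]
    exact h _ (k⁻¹).2
  φ_zero := spC_oC_isDualPair.φ'_zero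
  φ'_zero := spC_oC_isDualPair.φ_zero

/-- The velocity of `A` under `X` in the Lie algebra of `Sp_{2n}`. -/
def spCVelocity (A : Matrix (Fin p) (Fin n ⊕ Fin n) ℂ) :
    (Matrix (Fin n ⊕ Fin n) (Fin n ⊕ Fin n) ℂ) →ₗ[ℂ] Matrix (Fin p) (Fin n ⊕ Fin n) ℂ where
  toFun X := -(A * X)
  map_add' X Y := by simp [Matrix.mul_add, add_comm]
  map_smul' c X := by simp

/-- The velocity of `A` under `X` in the Lie algebra of `O_p`. -/
def oCVelocity (A : Matrix (Fin p) (Fin n ⊕ Fin n) ℂ) :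
    Matrix (Fin p) (Fin p) ℂ →ₗ[ℂ] Matrix (Fin p) (Fin n ⊕ Fin n) ℂ where
  toFun X := X * A
  map_add' X Y := by simp [Matrix.add_mul]
  map_smul' c X := by simp

/-- The equivariance of the velocities under an element that fixes `A`. -/
theorem spCVelocity_oCVelocity_equivariant {A : Matrix (Fin p) (Fin n ⊕ Fin n) ℂ} {k ki : Matrix
    (Fin n ⊕ Fin n) (Fin n ⊕ Fin n) ℂ}
    {l li : Matrix (Fin p) (Fin p) ℂ} (hk : ki * k = 1) (hl : li * l = 1) (h : l * A * ki = A) :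
    (∀ X, l * spCVelocity A X * ki = spCVelocity A (k * (X * ki))) ∧
    ∀ X, l * oCVelocity A X * ki = oCVelocity A (l * (X * li)) := by
  obtain ⟨h1, h2⟩ := Matrix.conj_of_fix hk hl h
  refine ⟨fun X => ?_, fun X => ?_⟩
  · simp [spCVelocity, h1, Matrix.mul_assoc]
  · simp [oCVelocity, h2, Matrix.mul_assoc]

/-- Over `Sp_{2n}`, the injective matrices are regular points. -/
theorem spC_isRegularPoint {w : Matrix (Fin p) (Fin n ⊕ Fin n) ℂ}
    {L : Matrix (Fin n ⊕ Fin n) (Fin p) ℂ} (hL : L * w = 1) :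
    (spC n p).IsRegularPoint (oC n p) w := by
  have hJ := isSignedForm_Jmat n
  have hR : wᵀ * Lᵀ = 1 := by rw [← Matrix.transpose_mul, hL, Matrix.transpose_one]
  let T : Matrix (Fin p) (Fin p) ℂ →ₗ[ℂ] (Matrix (Fin n ⊕ Fin n) (Fin n ⊕ Fin n) ℂ) :=
    { toFun := fun k => L * k * w
      map_add' := by intro k l; simp [Matrix.mul_add, Matrix.add_mul]
      map_smul' := by intro c k; simp }
  let D : Matrix (Fin p) (Fin n ⊕ Fin n) ℂ →ₗ[ℂ] (Matrix (Fin n ⊕ Fin n) (Fin n ⊕ Fin n) ℂ) :=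
    { toFun := fun v => vᵀ * w + wᵀ * v
      map_add' := by
        intro u v
        simp only [Matrix.transpose_add, Matrix.add_mul, Matrix.mul_add]
        exact add_add_add_comm _ _ _ _
      map_smul' := by intro c v; simp }
  have hfree : ∀ k ki : Matrix (Fin n ⊕ Fin n) (Fin n ⊕ Fin n) ℂ, k * ki = 1 → w * ki = w → k =
      1 := by
    intro k ki hk h
    have h1 := congrArg (fun v => L * v) h
    simp only [← Matrix.mul_assoc, hL, Matrix.one_mul] at h1
    rwa [h1, Matrix.mul_one] at hk
  have hlift : ∀ k ki : Matrix (Fin p) (Fin p) ℂ, ki * k = 1 →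
      k * (w * Jmat n * wᵀ) * kᵀ = w * Jmat n * wᵀ →
      ∃ u : (Matrix (Fin n ⊕ Fin n) (Fin n ⊕ Fin n) ℂ)ˣ, u.valᵀ * Jmat n * u.val =
          Jmat n ∧ k * w * u⁻¹.val = w := by
    intro k ki hk h
    have hkt : kᵀ * kiᵀ = 1 := by rw [← Matrix.transpose_mul, hk, Matrix.transpose_one]
    obtain ⟨g, hg, e⟩ := hJ.exists_isometry hR (k := kᵀ) (k' := kiᵀ) (mul_eq_one_comm.1 hkt) (by
      rw [Matrix.transpose_transpose, Matrix.transpose_transpose]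
      nth_rewrite 2 [← h]
      rw [Matrix.mul_assoc _ kᵀ, hkt, Matrix.mul_one])
    have hg' : gᵀᵀ * Jmat n * gᵀ = Jmat n := hJ.isometry_transpose hg
    have e' : k * w = w * gᵀ := by
      simpa [Matrix.transpose_mul] using (congrArg Matrix.transpose e).symm
    refine ⟨hJ.unitOfIsometry hg', hg', ?_⟩
    rw [e', Matrix.mul_assoc]
    exact (congrArg (w * ·) (hJ.unitOfIsometry hg').mul_inv).trans (Matrix.mul_one _)
  have hinf : ∀ X : Matrix (Fin p) (Fin p) ℂ,
      X * (w * Jmat n * wᵀ) = -(w * Jmat n * wᵀ * Xᵀ) ↔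
      ∃ Z : Matrix (Fin n ⊕ Fin n) (Fin n ⊕ Fin n) ℂ, Zᵀ * Jmat n = -(Jmat n * Z) ∧ X * w =
          w * Z := by
    intro X
    have h := hJ.exists_skew hR (X := Xᵀ)
    rw [Matrix.transpose_transpose, Matrix.transpose_transpose] at h
    refine h.trans ⟨fun ⟨Y, hY, e⟩ => ⟨Yᵀ, hJ.skew_transpose hY, ?_⟩,
      fun ⟨Z, hZ, e⟩ => ⟨Zᵀ, hJ.skew_transpose hZ, ?_⟩⟩
    · simpa [Matrix.transpose_mul] using (congrArg Matrix.transpose e).symm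
    · simpa [Matrix.transpose_mul] using (congrArg Matrix.transpose e).symm
  have hexp : ∀ (X : Matrix (Fin p) (Fin p) ℂ) (Z : Matrix (Fin n ⊕ Fin n) (Fin n ⊕ Fin n) ℂ),
      X * w = w * Z → ∀ (t : ℂ) (k : Matrix (Fin p) (Fin p) ℂ), k = NormedSpace.exp (t • X) →
        k * w * NormedSpace.exp (-(t • Z)) = w := by
    rintro X Z e t _ rfl
    rw [Matrix.exp_neg_smul]
    exact Matrix.forall_exp_fix_iff.2 (show X * w = -(w * -Z) by rw [e]; simp) t
  refine ⟨?_, ?_, ?_, ?_, ?_⟩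
  · intro k hk
    exact Subtype.ext (Units.ext (hfree _ _ k.1.val_inv hk))
  · intro k' hk'
    obtain ⟨u, hu, h⟩ := hlift _ _ k'.1.inv_val hk'
    exact ⟨⟨u, hu⟩, h⟩
  · refine ⟨T, 0, fun k k' h => ?_⟩
    have hT : ∀ (k ki : Matrix (Fin n ⊕ Fin n) (Fin n ⊕ Fin n) ℂ) (l : Matrix (Fin p) (Fin p) ℂ),
        ki * k = 1 → l * w * ki = w →
        k = T l := by
      intro k ki l hk h
      simp only [T, LinearMap.coe_mk, AddHom.coe_mk]
      rw [Matrix.mul_assoc, ← Matrix.mul_one (l * w), ← hk, ← Matrix.mul_assoc (l * w) ki, h,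
        ← Matrix.mul_assoc, hL, Matrix.one_mul]
    exact (hT _ _ _ k.1.inv_val h).trans (add_zero _).symm
  · intro X hX
    obtain ⟨Z, hZ, e⟩ := (hinf X).1 (oC_mem_lieSet_stab.1 hX).2
    have hZl := spC_isMatrixGroup.mem_lieSet_iff.1
      ((spC_mem_lieSet_stab (n := n) (p := p) (s := 0) (X := Z)).2 ⟨hZ, by simp⟩)
    exact ⟨Z, fun t => ⟨⟨spC_isMatrixGroup.expUnit _, (hZl t).1⟩, rfl,
      fun k' hk' => hexp X Z e t _ hk'⟩⟩
  · refine ⟨spCVelocity w, oCVelocity w, D, ?_, ?_, ?_, ?_, ?_, ?_, ?_⟩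
    · have h : ∀ v : Matrix (Fin p) (Fin n ⊕ Fin n) ℂ,
          (w + v)ᵀ * (w + v) = wᵀ * w + D v + vᵀ * v := by
        intro v
        simp only [D, LinearMap.coe_mk, AddHom.coe_mk, Matrix.transpose_add, Matrix.add_mul,
          Matrix.mul_add]
        abel
      exact h
    · have h : ∀ s : Matrix (Fin n ⊕ Fin n) (Fin n ⊕ Fin n) ℂ, sᵀ = s ↔ ∃ v, D v = s := by
        intro s
        have h := isSignedForm_one.exists_tangent hL (S := s)
        simp only [one_smul, Matrix.mul_one] at h
        exact h
      exact h
    · intro v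
      have h := isSignedForm_one.exists_skew_mul_eq hL (v := v)
      rw [Matrix.mul_one, Matrix.mul_one] at h
      exact h.trans (exists_congr fun X => and_congr_left' oC_mem_lieAlg_top.symm)
    · intro X _ hX
      have h : ∀ X : Matrix (Fin n ⊕ Fin n) (Fin n ⊕ Fin n) ℂ, -(w * X) = 0 → X = 0 := by
        intro X hX
        rw [← Matrix.one_mul X, ← hL, Matrix.mul_assoc, neg_eq_zero.1 hX, Matrix.mul_zero]
      exact h X hX
    · intro X hX
      refine Iff.trans ?_ spC_mem_lieAlg_stab.symm
      have h : ∀ X : Matrix (Fin n ⊕ Fin n) (Fin n ⊕ Fin n) ℂ, D (-(w * X)) = 0 ↔ Xᵀ * (wᵀ * w) =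
          -(wᵀ * w * X) := by
        intro X
        rw [eq_neg_iff_add_eq_zero, ← neg_eq_zero]
        simp [D, Matrix.mul_assoc, Matrix.transpose_mul, add_comm]
      exact (h X).trans ⟨fun h => ⟨spC_mem_lieAlg_top.1 hX, h⟩, fun h => h.2⟩
    · intro X hX
      refine oC_mem_lieAlg_stab.trans ?_
      have hneg : ∀ Z : Matrix (Fin n ⊕ Fin n) (Fin n ⊕ Fin n) ℂ, Z ∈ (spC n p).lieAlg ⊤ → -Z ∈
          (spC n p).lieAlg ⊤ :=
        fun Z hZ => Submodule.neg_mem _ hZ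
      have h1 : ∀ (X : Matrix (Fin p) (Fin p) ℂ) (Z : Matrix (Fin n ⊕ Fin n) (Fin n ⊕ Fin n) ℂ),
          X * w = w * Z →
          spCVelocity w (-Z) = oCVelocity w X := by
        intro X Z h
        simp [spCVelocity, oCVelocity, h]
      have h2 : ∀ (X : Matrix (Fin p) (Fin p) ℂ) (Z : Matrix (Fin n ⊕ Fin n) (Fin n ⊕ Fin n) ℂ),
          spCVelocity w Z = oCVelocity w X →
          X * w = w * -Z := by
        intro X Z h
        rw [Matrix.mul_neg]
        exact h.symm
      constructor
      · intro h
        obtain ⟨Z, hZ, e⟩ := (hinf X).1 h.2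
        exact ⟨_, hneg Z (spC_mem_lieAlg_top.2 hZ), h1 X Z e⟩
      · rintro ⟨Z, hZ, e⟩
        exact ⟨oC_mem_lieAlg_top.1 hX,
          (hinf X).2 ⟨_, spC_mem_lieAlg_top.1 (hneg Z hZ), h2 X Z e⟩⟩
    · intro k k' hk
      exact spCVelocity_oCVelocity_equivariant k.1.inv_val k'.1.inv_val hk

/-- Over `O_p`, the surjective matrices are regular points. -/
theorem oC_isRegularPoint {w : Matrix (Fin p) (Fin n ⊕ Fin n) ℂ}
    {R : Matrix (Fin n ⊕ Fin n) (Fin p) ℂ} (hR : w * R = 1) :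
    (oC n p).IsRegularPoint (spC n p) w := by
  have hJ := isSignedForm_Jmat n
  have hO : IsSignedForm 1 (1 : Matrix (Fin p) (Fin p) ℂ) := isSignedForm_one
  have hL : Rᵀ * wᵀ = 1 := by rw [← Matrix.transpose_mul, hR, Matrix.transpose_one]
  let T : (Matrix (Fin n ⊕ Fin n) (Fin n ⊕ Fin n) ℂ) →ₗ[ℂ] Matrix (Fin p) (Fin p) ℂ :=
    { toFun := fun k => w * k * R
      map_add' := by intro k l; simp [Matrix.mul_add, Matrix.add_mul]
      map_smul' := by intro c k; simp }
  let D : Matrix (Fin p) (Fin n ⊕ Fin n) ℂ →ₗ[ℂ] Matrix (Fin p) (Fin p) ℂ :=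
    { toFun := fun v => v * Jmat n * wᵀ + w * Jmat n * vᵀ
      map_add' := by
        intro u v
        simp only [Matrix.transpose_add, Matrix.add_mul, Matrix.mul_add]
        exact add_add_add_comm _ _ _ _
      map_smul' := by intro c v; simp }
  have hcancel : ∀ X Y : Matrix (Fin p) (Fin p) ℂ, X * w = Y * w → X = Y := by
    intro X Y h
    simpa [Matrix.mul_assoc, hR] using congrArg (fun x => x * R) h
  have hlift : ∀ k ki : Matrix (Fin n ⊕ Fin n) (Fin n ⊕ Fin n) ℂ, ki * k = 1 → kiᵀ *
      (wᵀ * w) * ki = wᵀ * w →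
      ∃ g : Matrix (Fin p) (Fin p) ℂ, gᵀ * 1 * g = 1 ∧ g * (w * ki) = w := by
    intro k ki hk h
    have hkt : kᵀ * kiᵀ = 1 := by rw [← Matrix.transpose_mul, hk, Matrix.transpose_one]
    obtain ⟨g, hg, e⟩ := hO.exists_isometry hR hk (by
      rw [Matrix.mul_one]
      nth_rewrite 1 [← h]
      rw [← Matrix.mul_assoc, ← Matrix.mul_assoc, hkt, Matrix.one_mul])
    refine ⟨g, hg, ?_⟩
    rw [← Matrix.mul_assoc, e, Matrix.mul_assoc, mul_eq_one_comm.1 hk, Matrix.mul_one]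
  have hinf : ∀ X : Matrix (Fin n ⊕ Fin n) (Fin n ⊕ Fin n) ℂ, Xᵀ * (wᵀ * w) = -(wᵀ * w * X) ↔
      ∃ Y : Matrix (Fin p) (Fin p) ℂ, Yᵀ * 1 = -(1 * Y) ∧ Y * w = w * X := by
    intro X
    have h := hO.exists_skew hR (X := X)
    rwa [Matrix.mul_one wᵀ] at h
  have hexp : ∀ (X : Matrix (Fin n ⊕ Fin n) (Fin n ⊕ Fin n) ℂ) (Y : Matrix (Fin p) (Fin p) ℂ),
      Y * w = w * X → ∀ (t : ℂ) (k : (Matrix (Fin n ⊕ Fin n) (Fin n ⊕ Fin n) ℂ)ˣ),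
        k.val = NormedSpace.exp (t • X) → NormedSpace.exp (t • Y) * (w * k⁻¹.val) = w := by
    intro X Y e t k hk
    have hki : k⁻¹.val = NormedSpace.exp (-(t • X)) := by
      rw [Units.inv_eq_of_mul_eq_one_right]
      rw [hk, Matrix.exp_mul_exp_neg]
    rw [hki, Matrix.exp_neg_smul, ← Matrix.mul_assoc]
    exact Matrix.forall_exp_fix_iff.2 (show Y * w = -(w * -X) by rw [e]; simp) t
  refine ⟨?_, ?_, ?_, ?_, ?_⟩
  · intro k hk
    have h : ∀ k : Matrix (Fin p) (Fin p) ℂ, k * w = w → k = 1 :=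
      fun k h => hcancel _ _ (by rw [h, Matrix.one_mul])
    exact Subtype.ext (Units.ext (h _ hk))
  · intro k' hk'
    obtain ⟨g, hg, h⟩ := hlift _ _ k'.1.inv_val hk'
    exact ⟨⟨hO.unitOfIsometry hg, hg⟩, h⟩
  · refine ⟨T, 0, fun k k' h => ?_⟩
    have hT : ∀ (k ki : Matrix (Fin n ⊕ Fin n) (Fin n ⊕ Fin n) ℂ) (l : Matrix (Fin p) (Fin p) ℂ),
        ki * k = 1 → l * (w * ki) = w →
        l = T k := by
      intro k ki l hk h
      have e1 : l * w = w * k := by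
        nth_rewrite 2 [← h]
        rw [Matrix.mul_assoc, Matrix.mul_assoc w, hk, Matrix.mul_one]
      simp only [T, LinearMap.coe_mk, AddHom.coe_mk]
      rw [← e1, Matrix.mul_assoc, hR, Matrix.mul_one]
    exact (hT _ _ _ k'.1.inv_val h).trans (add_zero _).symm
  · intro X hX
    obtain ⟨Y, hY, e⟩ := (hinf X).1 (spC_mem_lieSet_stab.1 hX).2
    have hYl := oC_isMatrixGroup.mem_lieSet_iff.1
      ((oC_mem_lieSet_stab (n := n) (p := p) (s := 0) (X := Y)).2 ⟨hY, by simp⟩)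
    exact ⟨Y, fun t => ⟨⟨oC_isMatrixGroup.expUnit _, (hYl t).1⟩, rfl,
      fun k' hk' => hexp X Y e t k'.1 hk'⟩⟩
  · refine ⟨oCVelocity w, spCVelocity w, D, ?_, ?_, ?_, ?_, ?_, ?_, ?_⟩
    · have h : ∀ v : Matrix (Fin p) (Fin n ⊕ Fin n) ℂ,
          (w + v) * Jmat n * (w + v)ᵀ = w * Jmat n * wᵀ + D v + v * Jmat n * vᵀ := by
        intro v
        simp only [D, LinearMap.coe_mk, AddHom.coe_mk, Matrix.transpose_add, Matrix.add_mul,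
          Matrix.mul_add]
        abel
      exact h
    · have h : ∀ s : Matrix (Fin p) (Fin p) ℂ, sᵀ = -s ↔ ∃ v, D v = s := by
        intro s
        have h := hJ.exists_tangent hL (S := s)
        rw [neg_one_smul, Matrix.transpose_transpose] at h
        refine h.trans ⟨fun ⟨v, hv⟩ => ⟨vᵀ, ?_⟩, fun ⟨v, hv⟩ => ⟨vᵀ, ?_⟩⟩
        · simpa [D] using hv
        · simpa [D] using hv
      exact h
    · intro v
      have h : D v = 0 ↔ ∃ X : Matrix (Fin n ⊕ Fin n) (Fin n ⊕ Fin n) ℂ, Xᵀ * Jmat n =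
          -(Jmat n * X) ∧ spCVelocity w X = v := by
        have h := hJ.exists_skew_mul_eq hL (v := vᵀ)
        rw [Matrix.transpose_transpose, Matrix.transpose_transpose] at h
        refine h.trans ⟨fun ⟨X, hX, e⟩ => ⟨-Xᵀ, ?_, ?_⟩, fun ⟨X, hX, e⟩ => ⟨-Xᵀ, ?_, ?_⟩⟩
        · rw [Matrix.transpose_neg, Matrix.neg_mul, hJ.skew_transpose hX, Matrix.mul_neg]
        · simpa [spCVelocity, Matrix.transpose_mul] using congrArg Matrix.transpose e
        · rw [Matrix.transpose_neg, Matrix.neg_mul, hJ.skew_transpose hX, Matrix.mul_neg]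
        · simpa [spCVelocity, Matrix.transpose_mul] using congrArg Matrix.transpose e
      exact h.trans (exists_congr fun X => and_congr_left' spC_mem_lieAlg_top.symm)
    · intro X _ hX
      have h : ∀ X : Matrix (Fin p) (Fin p) ℂ, X * w = 0 → X = 0 :=
        fun X h => hcancel _ _ (by rw [h, Matrix.zero_mul])
      exact h X hX
    · intro X hX
      refine Iff.trans ?_ oC_mem_lieAlg_stab.symm
      have h : ∀ X : Matrix (Fin p) (Fin p) ℂ, D (X * w) = 0 ↔
          X * (w * Jmat n * wᵀ) = -(w * Jmat n * wᵀ * Xᵀ) := by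
        intro X
        rw [eq_neg_iff_add_eq_zero]
        simp [D, Matrix.mul_assoc, Matrix.transpose_mul]
      exact (h X).trans ⟨fun h => ⟨oC_mem_lieAlg_top.1 hX, h⟩, fun h => h.2⟩
    · intro X hX
      refine spC_mem_lieAlg_stab.trans ?_
      have hneg : ∀ Y : Matrix (Fin p) (Fin p) ℂ,
          Y ∈ (oC n p).lieAlg ⊤ → -Y ∈ (oC n p).lieAlg ⊤ :=
        fun Y hY => Submodule.neg_mem _ hY
      have h1 : ∀ (X : Matrix (Fin n ⊕ Fin n) (Fin n ⊕ Fin n) ℂ) (Y : Matrix (Fin p) (Fin p) ℂ),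
          Y * w = w * X →
          oCVelocity w (-Y) = spCVelocity w X := by
        intro X Y h
        simp [spCVelocity, oCVelocity, h]
      have h2 : ∀ (X : Matrix (Fin n ⊕ Fin n) (Fin n ⊕ Fin n) ℂ) (Y : Matrix (Fin p) (Fin p) ℂ),
          oCVelocity w Y = spCVelocity w X →
          -Y * w = w * X := by
        intro X Y h
        rw [Matrix.neg_mul, neg_eq_iff_eq_neg]
        exact h
      constructor
      · intro h
        obtain ⟨Y, hY, e⟩ := (hinf X).1 h.2
        exact ⟨_, hneg Y (oC_mem_lieAlg_top.2 hY), h1 X Y e⟩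
      · rintro ⟨Y, hY, e⟩
        exact ⟨spC_mem_lieAlg_top.1 hX,
          (hinf X).2 ⟨_, oC_mem_lieAlg_top.1 (hneg Y hY), h2 X Y e⟩⟩
    · intro k k' hk
      have h : ∀ (k ki : Matrix (Fin n ⊕ Fin n) (Fin n ⊕ Fin n) ℂ) (l li : Matrix (Fin p)
          (Fin p) ℂ), ki * k = 1 → li * l = 1 →
          l * (w * ki) = w → (∀ X, l * (oCVelocity w X * ki) = oCVelocity w (l * (X * li))) ∧
          ∀ X, l * (spCVelocity w X * ki) = spCVelocity w (k * (X * ki)) := by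
        intro k ki l li hk hl h
        obtain ⟨h1, h2⟩ := spCVelocity_oCVelocity_equivariant hk hl
          ((Matrix.mul_assoc l w ki).trans h)
        exact ⟨fun X => (Matrix.mul_assoc _ _ _).symm.trans (h2 X),
          fun X => (Matrix.mul_assoc _ _ _).symm.trans (h1 X)⟩
      exact h _ _ _ _ k'.1.inv_val k.1.inv_val hk

/-- If `φ w ∈ O` and `φ' w ∈ θ(O)`, then `w` is injective. -/
theorem spC_exists_left_inverse
    (hU : HasHyperbolicSubspace (Fin n ⊕ Fin n) (1 : Matrix (Fin p) (Fin p) ℂ))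
    {O : Set (Matrix (Fin n ⊕ Fin n) (Fin n ⊕ Fin n) ℂ)} {O' : Set (Matrix (Fin p) (Fin p) ℂ)}
    (hO' : Member.IsThetaLiftOrbit (M := spC n p) (M' := oC n p) O O')
    {w : Matrix (Fin p) (Fin n ⊕ Fin n) ℂ} (hw : (spC n p).φ w ∈ O) (hw' : (oC n p).φ w ∈ O') :
    ∃ L : Matrix (Fin n ⊕ Fin n) (Fin p) ℂ, L * w = 1 := by
  have hJ := isSignedForm_Jmat n
  obtain ⟨U, V, h1, h2, h3⟩ := hU
  obtain ⟨A, L, hL, hA⟩ := isSignedForm_one.exists_gram_eq h1 h2 h3 (S := wᵀ * w)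
    (by simp [Matrix.transpose_mul])
  rw [Matrix.mul_one] at hA
  let ℓ : Matrix (Fin p) (Fin p) ℂ →ₗ[ℂ] (Matrix (Fin n ⊕ Fin n) (Fin n ⊕ Fin n) ℂ) :=
    { toFun := fun y => L * y * Lᵀ
      map_add' := by intro x y; simp [Matrix.mul_add, Matrix.add_mul]
      map_smul' := by intro c x; simp }
  have hne : (ℓ (A * Jmat n * Aᵀ)).det ≠ 0 := by
    have e : ℓ (A * Jmat n * Aᵀ) = L * A * Jmat n * (L * A)ᵀ := by
      simp [ℓ, Matrix.transpose_mul, Matrix.mul_assoc]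
    rw [e, hL, Matrix.one_mul, Matrix.transpose_one, Matrix.mul_one]
    exact hJ.det_ne_zero
  obtain ⟨k, hk⟩ := hO'.exists_ne_zero (w₁ := A) hw hw' hA (det_linear_mem_adjoin ℓ) hne
  have h : ∀ k : Matrix (Fin p) (Fin p) ℂ, (L * (k * (w * Jmat n * wᵀ) * kᵀ) * Lᵀ).det ≠ 0 →
      ∃ L : Matrix (Fin n ⊕ Fin n) (Fin p) ℂ, L * w = 1 := by
    intro k hk
    have e : L * (k * (w * Jmat n * wᵀ) * kᵀ) * Lᵀ =
        L * k * (w * (Jmat n * wᵀ)) * (kᵀ * Lᵀ) := by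
      simp only [Matrix.mul_assoc]
    rw [e] at hk
    exact (Matrix.exists_inverses_of_det_ne_zero hk).1
  exact h _ hk

/-- If `φ w ∈ O` and `φ' w ∈ θ(O)`, then `w` is surjective. -/
theorem oC_exists_right_inverse (hU : HasHyperbolicSubspace (Fin p) (Jmat n))
    {O : Set (Matrix (Fin p) (Fin p) ℂ)} {O' : Set (Matrix (Fin n ⊕ Fin n) (Fin n ⊕ Fin n) ℂ)}
    (hO' : Member.IsThetaLiftOrbit (M := oC n p) (M' := spC n p) O O')
    {w : Matrix (Fin p) (Fin n ⊕ Fin n) ℂ} (hw : (oC n p).φ w ∈ O) (hw' : (spC n p).φ w ∈ O') :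
    ∃ R : Matrix (Fin n ⊕ Fin n) (Fin p) ℂ, w * R = 1 := by
  have hJ := isSignedForm_Jmat n
  obtain ⟨U, V, h1, h2, h3⟩ := hU
  obtain ⟨A, L, hL, hA⟩ := hJ.exists_gram_eq h1 h2 h3 (S := w * Jmat n * wᵀ)
    (by simp [Matrix.transpose_mul, hJ.transpose, Matrix.mul_assoc])
  let ℓ : (Matrix (Fin n ⊕ Fin n) (Fin n ⊕ Fin n) ℂ) →ₗ[ℂ] Matrix (Fin p) (Fin p) ℂ :=
    { toFun := fun y => L * y * Lᵀ
      map_add' := by intro x y; simp [Matrix.mul_add, Matrix.add_mul]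
      map_smul' := by intro c x; simp }
  have hne : (ℓ (Aᵀᵀ * Aᵀ)).det ≠ 0 := by
    have e : ℓ (Aᵀᵀ * Aᵀ) = L * A * (L * A)ᵀ := by
      simp [ℓ, Matrix.transpose_mul, Matrix.mul_assoc]
    rw [e, hL]
    simp
  obtain ⟨k, hk⟩ := hO'.exists_ne_zero (w₁ := Aᵀ) hw hw'
    (by exact (congrArg (fun x => Aᵀ * Jmat n * x) (Matrix.transpose_transpose A)).trans hA)
    (det_linear_mem_adjoin ℓ) hne
  have h : ∀ k : Matrix (Fin n ⊕ Fin n) (Fin n ⊕ Fin n) ℂ, (L * (kᵀ * (wᵀ * w) * k) * Lᵀ).det ≠ 0 →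
      ∃ R : Matrix (Fin n ⊕ Fin n) (Fin p) ℂ, w * R = 1 := by
    intro k hk
    have e : L * (kᵀ * (wᵀ * w) * k) * Lᵀ = L * kᵀ * (wᵀ * w) * (k * Lᵀ) := by
      simp only [Matrix.mul_assoc]
    rw [e] at hk
    exact (Matrix.exists_inverses_of_det_ne_zero hk).2
  exact h _ hk

end Complex

/-! ### The theta lift in stable range -/

theorem mem_symMatrices_iff {n : Type} (S : Matrix n n ℂ) :
    S ∈ symMatrices n ↔ Sᵀ = (1 : ℂ) • S := by
  rw [one_smul]
  rfl

theorem mem_altMatrices_iff {n : Type} (S : Matrix n n ℂ) :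
    S ∈ altMatrices n ↔ Sᵀ = (-1 : ℂ) • S := by
  rw [neg_one_smul]
  rfl

theorem propositionG {W : Type} [AddCommGroup W] [Module ℂ W] (M M' : Member W)
    (hM : StableRange M M')
    {V : Type*} [AddCommGroup V] [Module ℂ V]
    (O : Set M.E) (x : M.E) (χ : Representation ℂ (M.coverStab x) V)
    (hχ : Member.IsAdmissibleOrbitDatum O x χ)
    (O' : Set M'.E) (hO' : Member.IsThetaLiftOrbit O O')
    (w : W) (hw : M.φ w = x) (x' : M'.E) (hw' : M'.φ w = x') (hx' : x' ∈ O') :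
    (∃! χ' : Representation ℂ (M'.coverStab x') V, Member.IsThetaLift w O x χ O' x' χ') ∧
      ∀ χ' : Representation ℂ (M'.coverStab x') V,
        Member.IsThetaLift w O x χ O' x' χ' → Member.IsAdmissibleOrbitDatum O' x' χ' := by
  subst hw
  subst hw'
  have hfin : ∀ (a b c : ℕ), a + b ≤ c → Nonempty (Fin a ⊕ Fin b ↪ Fin c) := fun a b c h =>
    Function.Embedding.nonempty_of_card_le (by simpa using h)
  cases hM with
  | sp_o n p q hp hq =>
    obtain ⟨f⟩ := hfin n n p (by omega)
    obtain ⟨g⟩ := hfin n n q (by omega)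
    obtain ⟨⟨L, hL⟩, L', hL'⟩ := glMember_exists_left_inverses isSignedForm_one isSignedForm_one
      (hasHyperbolicSubspace_one f) (hasHyperbolicSubspace_one g) hO' hχ.mem hx'
    exact (glMember_isRegularPoint isSignedForm_one isSignedForm_one mem_symMatrices_iff hL
      hL').thetaLift glMember_isMatrixGroup isoMember_isMatrixGroup
      (glMember_hasInvariantForms isSignedForm_one mem_symMatrices_iff)
      glMember_isoMember_isDualPair hχ hO' hx'
  | o_sp n p q h =>
    obtain ⟨f⟩ := hfin p q n h
    obtain ⟨⟨R, hR⟩, R', hR'⟩ := isoMember_exists_right_inverses isSignedForm_one isSignedForm_one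
      f hO' hχ.mem hx'
    exact (isoMember_isRegularPoint isSignedForm_one isSignedForm_one hR hR').thetaLift
      isoMember_isMatrixGroup glMember_isMatrixGroup
      (isoMember_hasInvariantForms isSignedForm_one isSignedForm_one)
      isoMember_glMember_isDualPair hχ hO' hx'
  | u_u n₁ n₂ p q hp hq =>
    obtain ⟨f⟩ := hfin n₁ n₂ p hp
    obtain ⟨g⟩ := hfin n₂ n₁ q (by omega)
    obtain ⟨⟨⟨_, hA⟩, _, hC⟩, ⟨_, hD⟩, _, hB⟩ := uSmall_exists_left_inverses f g hO' hχ.mem hx'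
    exact (uSmall_isRegularPoint hA hB hC hD).thetaLift uSmall_isMatrixGroup uLarge_isMatrixGroup
      uSmall_hasInvariantForms uSmall_uLarge_isDualPair hχ hO' hx'
  | oStar_sp n p q hp hq =>
    obtain ⟨⟨L, hL⟩, L', hL'⟩ := glMember_exists_left_inverses (isSignedForm_Jmat p)
      (isSignedForm_Jmat q) (hasHyperbolicSubspace_Jmat (Fin.castLEEmb hp))
      (hasHyperbolicSubspace_Jmat (Fin.castLEEmb hq)) hO' hχ.mem hx'
    exact (glMember_isRegularPoint (isSignedForm_Jmat p) (isSignedForm_Jmat q) mem_altMatrices_iff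
      hL hL').thetaLift glMember_isMatrixGroup isoMember_isMatrixGroup
      (glMember_hasInvariantForms (isSignedForm_Jmat p) mem_altMatrices_iff)
      glMember_isoMember_isDualPair hχ hO' hx'
  | sp_oStar n p q h =>
    obtain ⟨f⟩ : Nonempty ((Fin p ⊕ Fin p) ⊕ (Fin q ⊕ Fin q) ↪ Fin n) :=
      Function.Embedding.nonempty_of_card_le (by simp; omega)
    obtain ⟨⟨R, hR⟩, R', hR'⟩ := isoMember_exists_right_inverses (isSignedForm_Jmat p)
      (isSignedForm_Jmat q) f hO' hχ.mem hx'
    exact (isoMember_isRegularPoint (isSignedForm_Jmat p) (isSignedForm_Jmat q) hR hR').thetaLift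
      isoMember_isMatrixGroup glMember_isMatrixGroup
      (isoMember_hasInvariantForms (isSignedForm_Jmat p) (isSignedForm_Jmat q))
      isoMember_glMember_isDualPair hχ hO' hx'
  | spC_oC n p h =>
    obtain ⟨f⟩ : Nonempty ((Fin n ⊕ Fin n) ⊕ (Fin n ⊕ Fin n) ↪ Fin p) :=
      Function.Embedding.nonempty_of_card_le (by simp; omega)
    obtain ⟨L, hL⟩ := spC_exists_left_inverse (hasHyperbolicSubspace_one f) hO' hχ.mem hx'
    exact (spC_isRegularPoint hL).thetaLift spC_isMatrixGroup oC_isMatrixGroup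
      spC_hasInvariantForms spC_oC_isDualPair hχ hO' hx'
  | oC_spC n p h =>
    obtain ⟨R, hR⟩ := oC_exists_right_inverse (hasHyperbolicSubspace_Jmat (Fin.castLEEmb h)) hO'
      hχ.mem hx'
    exact (oC_isRegularPoint hR).thetaLift oC_isMatrixGroup spC_isMatrixGroup
      oC_hasInvariantForms oC_spC_isDualPair hχ hO' hx'
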